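/- Let $(a_n)_{n\ge 1}$, $(b_n)_{n\ge 1}$ be i.i.d. square integrable real random variables (the whole family of $a$'s and $b$'s being independent and identically distributed) with $\mathbb E[a_1]=0$, $\mathbb E[a_1^2]=1$ and density $\rho=e^{-\Psi}$ on $\mathbb R$, where $\Psi\in C^\infty(\mathbb R)$ and $\Psi^{(p)}\in\bigcap_{1\le q<\infty}L^q(e^{-\Psi(x)}dx)$ for all $p\ge 1$. For $N\ge 1$ put $$X_N(t)=\frac1{\sqrt N}\sum_{n=1}^N\Big\{a_n\cos\Big(\frac{nt}N\Big)+b_n\sin\Big(\frac{nt}N\Big)\Big\},\qquad t\in\mathbb R.$$ Let $I\subset\mathbb R$ be a compact interval, let $m\ge 1$ be an integer, let $Z_{X_N}(I)$ be the number of (distinct) zeros of $X_N$ in $I$, and write $x^{[m]}=x(x-1)\cdots(x-m+1)$. Put $$D_m=\{\mathbf t\in I^m:\exists\, i\ne j,\ t_i=t_j\},\qquad D_m^{\varepsilon}=\{\mathbf t\in I^m:\exists\, i\neq j,\ |t_i-t_j|<\varepsilon\}\quad(\varepsilon>0).$$ Then there are an integer $N_0\ge 1$ and a constant $C$, depending only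 on $m$, $I$ and the density $\rho$ (in particular neither on $N$ nor on $\varepsilon$), such that for all $N\ge N_0$: 1. almost surely $X_N$ has finitely many zeros in $I$, and $Z_{X_N}(I)^{[m]}$ is integrable; 2. for every $\mathbf t=(t_1,\dots,t_m)\in I^m\setminus D_m$ the random vector $(X_N(t_1),\dots,X_N(t_m),X_N'(t_1),\dots,X_N'(t_m))$ has a (unique) continuous density $(\mathbf x;\mathbf x')\mapsto p_{N,\mathbf t}(\mathbf x;\mathbf x')$ on $\mathbb R^{m}\times\mathbb R^m$; 3. for every $\varepsilon>0$ the function $(\mathbf t,\mathbf y)\mapsto|y_1|\cdots|y_m|\,p_{N,\mathbf t}(\mathbf 0;\mathbf y)$ is integrable on $(I^m\setminus D_m^\varepsilon)\times\mathbb R^m$, and $$\left|\ \mathbb E\big[Z_{X_N}(I)^{[m]}\big]-\int_{I^m\setminus D_m^{\varepsilon}}\int_{\mathbb R^m}|y_1|\cdots|y_m|\;p_{N,\mathbf t}(\mathbf 0;\mathbf y)\,d\mathbf y\,d\mathbf t\ \right|\le C\,\varepsilon^{1/5}.$$ -/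

import Mathlib

open MeasureTheory ProbabilityTheory
open scoped NNReal ENNReal

namespace RandomTrig

noncomputable section

/-- The measure on `ℝ` with Lebesgue density `ρ = exp (-Ψ)`. -/
def coeffLaw (Ψ : ℝ → ℝ) : Measure ℝ :=
  volume.withDensity fun x => ENNReal.ofReal (Real.exp (-Ψ x))

/-- The assumptions on the common law `exp (-Ψ x) dx` of the coefficients: it is a probability
measure, square integrable, centred, of variance one, `Ψ` is smooth, and every derivative of `Ψ`
of order at least one lies in all the spaces `L^q (exp (-Ψ x) dx)`, `1 ≤ q < ∞`. -/
structure IsAdmissible (Ψ : ℝ → ℝ) : Prop where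
  isProbabilityMeasure : IsProbabilityMeasure (coeffLaw Ψ)
  memLp_two : MemLp (fun x : ℝ => x) 2 (coeffLaw Ψ)
  mean : ∫ x, x ∂(coeffLaw Ψ) = 0
  variance : ∫ x, x ^ 2 ∂(coeffLaw Ψ) = 1
  smooth : ContDiff ℝ ((⊤ : ℕ∞) : WithTop ℕ∞) Ψ
  memLp_deriv : ∀ p : ℕ, 1 ≤ p → ∀ q : ℝ≥0, 1 ≤ q → MemLp (iteratedDeriv p Ψ) q (coeffLaw Ψ)

/-- The normalized trigonometric polynomial
`X_N(t) = N^{-1/2} ∑_{k=1}^N (a_k cos (k t / N) + b_k sin (k t / N))`.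
The sequences are indexed from `0`: `a n`, `b n` are the coefficients `a_{n+1}`, `b_{n+1}`. -/
def trigPoly (a b : ℕ → ℝ) (N : ℕ) (t : ℝ) : ℝ :=
  (1 / Real.sqrt N) * ∑ n ∈ Finset.range N,
    (a n * Real.cos (((n : ℝ) + 1) * t / N) + b n * Real.sin (((n : ℝ) + 1) * t / N))

/-- The zeros of `f` in `I`. -/
def zeroSet (f : ℝ → ℝ) (I : Set ℝ) : Set ℝ := {t ∈ I | f t = 0}

/-- The number of zeros of `f` in `I`, each zero counted once (meaningful when `zeroSet f I` is
finite). -/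
def zeroCount (f : ℝ → ℝ) (I : Set ℝ) : ℕ := (zeroSet f I).ncard

/-- The cube `I^m`. -/
def cube (m : ℕ) (I : Set ℝ) : Set (Fin m → ℝ) := {t | ∀ i, t i ∈ I}

/-- The set of hyper-diagonals of `I^m`. -/
def diag (m : ℕ) (I : Set ℝ) : Set (Fin m → ℝ) :=
  {t ∈ cube m I | ∃ i j, i ≠ j ∧ t i = t j}

/-- The `ε`-enlargement of the set of hyper-diagonals of `I^m`. -/
def diagEnl (m : ℕ) (I : Set ℝ) (ε : ℝ) : Set (Fin m → ℝ) :=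
  {t ∈ cube m I | ∃ i j, i ≠ j ∧ |t i - t j| < ε}

/-- The vector `(f(t_1), …, f(t_m); f'(t_1), …, f'(t_m))`. -/
def jetVector {m : ℕ} (f : ℝ → ℝ) (t : Fin m → ℝ) : (Fin m → ℝ) × (Fin m → ℝ) :=
  (fun i => f (t i), fun i => deriv f (t i))

/-- `p` is the continuous density of `ν` with respect to Lebesgue measure on `ℝ^m × ℝ^m`. A measure
has at most one continuous density, so that its value at each single point is determined. -/
structure IsContinuousDensity {m : ℕ} (ν : Measure ((Fin m → ℝ) × (Fin m → ℝ)))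
    (p : (Fin m → ℝ) × (Fin m → ℝ) → ℝ) : Prop where
  continuous : Continuous p
  nonneg : ∀ z, 0 ≤ p z
  eq_withDensity : ν = volume.withDensity fun z => ENNReal.ofReal (p z)

end

end RandomTrig

/-! Two estimates, uniform in the degree, carry the proof. First, integration by parts against `exp
(-Ψ)` in each coordinate gives E f'(S) = E[f(S) ∑ u_i Ψ'(w_i)] for S = ∑ u_i w_i with ∑ u_i² = 1.
The weighted score sum has second moment E[Ψ'²], so an arctangent test function yields the small
ball bound P(|S| ≤ r) ≤ C r (`IsAdmissible.measure_abs_sum_le`). The value X_N(t) is such a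
normalized sum for all N ≥ 1 and t. Second, the frequencies n/N are at most 1, so every derivative
of X_N has second moment at most 1 at each point, and a one-dimensional Sobolev inequality with
Markov's inequality controls its supremum.

Together with Rolle's theorem they give two facts. Many zeros in an interval of length 1/2 make X_N
exponentially small at its left end unless a high derivative is exponentially large, so all moments
of the zero count are bounded uniformly in N (`exists_moment_bound`). A zero within η³ of a critical
point makes X_N of order η⁵ on a grid of mesh η³ near it unless |X_N''| exceeds 1/η, an event of
probability O(η²) (`measure_closeZeros_le`). Letting η tend to 0, almost surely all zeros are
simple.

For the density, condition on all modes but the first m. The map from the 2m low coefficients to the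
jet vector is invertible off the diagonals. A vector in its kernel is a trigonometric sum of degree
m without constant term and with m double zeros, whose associated polynomial is c R² with the roots
of R on the unit circle. The middle coefficient of R² is a unimodular number times ∑ |R_k|², hence
nonzero, while that of the sum is zero (`trigSum_eq_zero_of_double_zeros`). The jet density is then
an average of translates of a bounded continuous density (`isContinuousDensity_jetDensity`).

The Kac–Rice identity is proved for continuous test functions supported off the diagonals
(`kac_rice`): the kernels |f'| 1_{|f|<δ}/(2δ) converge to the counting measure of the zeros, with a
bound depending only on the number of critical points, at most 2N.

Finally, a cutoff at scale ε/2 shows that the Kac–Rice mass off the enlarged diagonal is at most the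
factorial moment. A cutoff at scale ε shows that the excess comes only from outcomes with two zeros
closer than 2ε. With η = (2ε)^{1/3} these have probability O(η²), and Z^m ≤ η Z^{2m} + η⁻¹ bounds
the excess by O(η), which is better than ε^{1/5} for small ε; large ε is covered by the moment bound
alone. -/

namespace RandomTrig

/-! ### The score `Ψ'` and integration by parts for a single coefficient. -/

variable {Ψ : ℝ → ℝ}

lemma integrable_coeffLaw_iff (hΨ : Continuous Ψ) {g : ℝ → ℝ} :
    Integrable g (coeffLaw Ψ) ↔ Integrable (fun x => Real.exp (-Ψ x) * g x) := by
  unfold coeffLaw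
  rw [integrable_withDensity_iff_integrable_smul' (by fun_prop) (by simp)]
  simp [ENNReal.toReal_ofReal (Real.exp_pos _).le]

lemma integral_coeffLaw (hΨ : Continuous Ψ) (g : ℝ → ℝ) :
    ∫ x, g x ∂(coeffLaw Ψ) = ∫ x, Real.exp (-Ψ x) * g x := by
  unfold coeffLaw
  rw [integral_withDensity_eq_integral_toReal_smul (by fun_prop) (by simp)]
  simp [ENNReal.toReal_ofReal (Real.exp_pos _).le]

namespace IsAdmissible

lemma continuous (h : IsAdmissible Ψ) : Continuous Ψ := h.smooth.continuous

lemma hasDerivAt (h : IsAdmissible Ψ) (x : ℝ) : HasDerivAt Ψ (deriv Ψ x) x :=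
  (h.smooth.differentiable (by simp) x).hasDerivAt

lemma continuous_deriv (h : IsAdmissible Ψ) : Continuous (deriv Ψ) :=
  h.smooth.continuous_deriv (by simp)

lemma memLp_score (h : IsAdmissible Ψ) : MemLp (deriv Ψ) 2 (coeffLaw Ψ) := by
  have := h.memLp_deriv 1 le_rfl 2 (by norm_num)
  simpa [iteratedDeriv_one] using this

lemma integrable_score (h : IsAdmissible Ψ) : Integrable (deriv Ψ) (coeffLaw Ψ) :=
  have := h.isProbabilityMeasure
  h.memLp_score.integrable (by norm_num)

lemma hasDerivAt_exp (h : IsAdmissible Ψ) (x : ℝ) :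
    HasDerivAt (fun x => Real.exp (-Ψ x)) (Real.exp (-Ψ x) * (-deriv Ψ x)) x :=
  (h.hasDerivAt x).neg.exp

/-- The density has derivative `-Ψ' exp (-Ψ)`, so this is integration by parts on the line. No
boundary term appears because the three products involved are integrable. -/
lemma integral_deriv_eq (h : IsAdmissible Ψ) {g g' : ℝ → ℝ} (hg : ∀ x, HasDerivAt g (g' x) x)
    (hg' : Continuous g') {C C' : ℝ} (hC : ∀ x, |g x| ≤ C) (hC' : ∀ x, |g' x| ≤ C') :
    ∫ x, g' x ∂(coeffLaw Ψ) = ∫ x, g x * deriv Ψ x ∂(coeffLaw Ψ) := by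
  have := h.isProbabilityMeasure
  have hgc : Continuous g := continuous_iff_continuousAt.2 fun x => (hg x).continuousAt
  have i1 : Integrable (fun x => g x * deriv Ψ x) (coeffLaw Ψ) :=
    h.integrable_score.bdd_mul hgc.aestronglyMeasurable (Filter.Eventually.of_forall hC)
  have i2 : Integrable g' (coeffLaw Ψ) :=
    Integrable.of_bound hg'.aestronglyMeasurable C' (Filter.Eventually.of_forall hC')
  have i3 : Integrable g (coeffLaw Ψ) :=
    Integrable.of_bound hgc.aestronglyMeasurable C (Filter.Eventually.of_forall hC)
  rw [integrable_coeffLaw_iff h.continuous] at i1 i2 i3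
  have key := integral_mul_deriv_eq_deriv_mul_of_integrable (u := g) (u' := g')
    (v := fun x => Real.exp (-Ψ x)) (v' := fun x => Real.exp (-Ψ x) * (-deriv Ψ x))
    (fun x _ => hg x) (fun x _ => h.hasDerivAt_exp x)
    (by
      refine i1.neg.congr (Filter.Eventually.of_forall fun x => ?_)
      simp only [Pi.neg_apply, Pi.mul_apply]; ring)
    (by
      refine i2.congr (Filter.Eventually.of_forall fun x => ?_)
      simp only [Pi.mul_apply]; ring)
    (by
      refine i3.congr (Filter.Eventually.of_forall fun x => ?_)
      simp only [Pi.mul_apply]; ring)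
  rw [integral_coeffLaw h.continuous, integral_coeffLaw h.continuous]
  have e1 : ∫ x, Real.exp (-Ψ x) * (g x * deriv Ψ x)
      = -∫ x, g x * (Real.exp (-Ψ x) * (-deriv Ψ x)) := by
    rw [← integral_neg]; congr 1; ext x; ring
  rw [e1, key, neg_neg]
  congr 1; ext x; ring

lemma integral_score (h : IsAdmissible Ψ) : ∫ x, deriv Ψ x ∂(coeffLaw Ψ) = 0 := by
  have := h.integral_deriv_eq (g := fun _ => 1) (g' := fun _ => 0)
    (fun x => hasDerivAt_const x 1) continuous_const (C := 1) (C' := 0) (by simp) (by simp)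
  simpa using this.symm

/-- The derivative of the density is integrable because the score is, so the density differs from
its value at 0 by at most the `L¹` norm of that derivative. -/
lemma exists_density_le (h : IsAdmissible Ψ) : ∃ B : ℝ, 0 < B ∧ ∀ x, Real.exp (-Ψ x) ≤ B := by
  have i1 := (integrable_coeffLaw_iff h.continuous).1 h.integrable_score
  have i2 : Integrable (fun x => Real.exp (-Ψ x) * (-deriv Ψ x)) :=
    i1.neg.congr (Filter.Eventually.of_forall fun x => by simp)
  refine ⟨Real.exp (-Ψ 0) + ∫ x, |Real.exp (-Ψ x) * (-deriv Ψ x)|,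
    add_pos_of_pos_of_nonneg (Real.exp_pos _) (integral_nonneg fun x => abs_nonneg _), fun x => ?_⟩
  have e := intervalIntegral.integral_eq_sub_of_hasDerivAt (a := 0) (b := x)
    (fun y _ => h.hasDerivAt_exp y) i2.intervalIntegrable
  have b : |∫ y in (0 : ℝ)..x, Real.exp (-Ψ y) * (-deriv Ψ y)|
      ≤ ∫ x, |Real.exp (-Ψ x) * (-deriv Ψ x)| := by
    rw [← Real.norm_eq_abs]
    refine intervalIntegral.norm_integral_le_integral_norm_uIoc.trans ?_
    exact setIntegral_le_integral i2.norm (Filter.Eventually.of_forall fun x => abs_nonneg _)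
  have := (le_abs_self _).trans b
  linarith

end IsAdmissible

/-! ### Linear combinations of independent copies: means and second moments. -/

section Pi

variable {ι : Type*} [Fintype ι] {μ : Measure ℝ} [IsProbabilityMeasure μ]

lemma iIndepFun_eval : iIndepFun (fun (i : ι) (w : ι → ℝ) => w i) (Measure.pi fun _ => μ) :=
  iIndepFun_pi (X := fun _ x => x) (fun _ => aemeasurable_id)

lemma map_eval_pi (i : ι) : (Measure.pi fun _ : ι => μ).map (fun w => w i) = μ :=
  (measurePreserving_eval (fun _ : ι => μ) i).map_eq

lemma integral_eval_pi (i : ι) {g : ℝ → ℝ} (hg : Measurable g) :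
    ∫ w, g (w i) ∂(Measure.pi fun _ : ι => μ) = ∫ x, g x ∂μ := by
  have := integral_map (μ := Measure.pi fun _ : ι => μ) (φ := fun w => w i)
    (measurable_pi_apply i).aemeasurable (f := g) hg.aestronglyMeasurable
  rw [map_eval_pi] at this
  exact this.symm

lemma memLp_eval_pi (i : ι) {g : ℝ → ℝ} (hg : MemLp g 2 μ) :
    MemLp (fun w : ι → ℝ => g (w i)) 2 (Measure.pi fun _ : ι => μ) :=
  hg.comp_measurePreserving (measurePreserving_eval (fun _ : ι => μ) i)

lemma memLp_sum_pi (u : ι → ℝ) {g : ℝ → ℝ} (hg : MemLp g 2 μ) :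
    MemLp (fun w : ι → ℝ => ∑ i, u i * g (w i)) 2 (Measure.pi fun _ : ι => μ) :=
  memLp_finsetSum _ fun i _ => (memLp_eval_pi i hg).const_mul (u i)

lemma integral_sum_sq_pi (u : ι → ℝ) {g : ℝ → ℝ} (hgm : Measurable g) (hg : MemLp g 2 μ)
    (h0 : ∫ x, g x ∂μ = 0) :
    ∫ w, (∑ i, u i * g (w i)) ^ 2 ∂(Measure.pi fun _ : ι => μ)
      = (∑ i, u i ^ 2) * ∫ x, g x ^ 2 ∂μ := by
  set π := Measure.pi fun _ : ι => μ
  have hL : ∀ i, MemLp (fun w : ι → ℝ => u i * g (w i)) 2 π :=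
    fun i => (memLp_eval_pi i hg).const_mul (u i)
  have hind : iIndepFun (fun (i : ι) (w : ι → ℝ) => u i * g (w i)) π :=
    iIndepFun_eval.comp (fun i x => u i * g x) (fun i => hgm.const_mul _)
  have hv := IndepFun.variance_sum (μ := π) (s := Finset.univ)
    (X := fun (i : ι) (w : ι → ℝ) => u i * g (w i)) (fun i _ => hL i)
    (fun i _ j _ hij => hind.indepFun hij)
  have m0 : ∀ i, ∫ w, u i * g (w i) ∂π = 0 := fun i => by
    rw [integral_const_mul, integral_eval_pi i hgm, h0, mul_zero]
  have ms : ∫ w, (∑ i, (fun (i : ι) (w : ι → ℝ) => u i * g (w i)) i) w ∂π = 0 := by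
    simp only [Finset.sum_apply]
    rw [integral_finsetSum _ fun i _ => (hL i).integrable (by norm_num)]
    simp [m0]
  rw [variance_of_integral_eq_zero _ ms] at hv
  · simp only [Finset.sum_apply] at hv
    rw [hv, Finset.sum_mul]
    refine Finset.sum_congr rfl fun i _ => ?_
    rw [variance_of_integral_eq_zero (hL i).aestronglyMeasurable.aemeasurable (m0 i)]
    simp only [mul_pow]
    rw [integral_const_mul, integral_eval_pi i (hgm.pow_const 2)]
  · exact (memLp_finsetSum' _ fun i _ => hL i).aestronglyMeasurable.aemeasurable

end Pi

/-! ### Small ball estimate for normalized linear combinations of the coefficients. -/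

section SmallBall

variable {ι : Type*} [Fintype ι]

/-- Integration by parts in coordinate `i` alone: the remaining part `T` of the sum is independent
of `w i`, so Fubini reduces to the one-dimensional formula at each frozen value of `T`. -/
lemma IsAdmissible.integral_partial (h : IsAdmissible Ψ) (u : ι → ℝ) (i : ι) {f f' : ℝ → ℝ}
    (hf : ∀ x, HasDerivAt f (f' x) x) (hf' : Continuous f') {C C' : ℝ} (hC : ∀ x, |f x| ≤ C)
    (hC' : ∀ x, |f' x| ≤ C') :
    ∫ w, u i * f' (∑ j, u j * w j) ∂(Measure.pi fun _ : ι => coeffLaw Ψ)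
      = ∫ w, f (∑ j, u j * w j) * deriv Ψ (w i) ∂(Measure.pi fun _ : ι => coeffLaw Ψ) := by
  classical
  have := h.isProbabilityMeasure
  set μ := coeffLaw Ψ
  set π := Measure.pi fun _ : ι => μ
  have hfc : Continuous f := continuous_iff_continuousAt.2 fun x => (hf x).continuousAt
  set T : (ι → ℝ) → ℝ := fun w => ∑ j ∈ Finset.univ.erase i, u j * w j
  have hTm : Measurable T := by fun_prop
  have hsplit : ∀ w : ι → ℝ, ∑ j, u j * w j = u i * w i + T w := fun w =>
    (Finset.add_sum_erase Finset.univ (fun j => u j * w j) (Finset.mem_univ i)).symm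
  have hdis : Disjoint ({i} : Finset ι) (Finset.univ.erase i) := by simp
  have hind : IndepFun (fun w : ι → ℝ => w i) T π := by
    have h0 := (iIndepFun_eval (ι := ι) (μ := μ)).indepFun_finset {i} (Finset.univ.erase i) hdis
      (fun j => measurable_pi_apply j)
    have hφ : Measurable (fun v : ↥({i} : Finset ι) → ℝ => v ⟨i, by simp⟩) :=
      measurable_pi_apply _
    have hψ : Measurable (fun v : ↥((Finset.univ : Finset ι).erase i) → ℝ => ∑ j, u j.1 * v j) := by
      fun_prop
    have h1 := h0.comp hφ hψ
    have hT' : T = (fun v : ↥((Finset.univ : Finset ι).erase i) → ℝ => ∑ j, u j.1 * v j) ∘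
        (fun w j => w j) := by
      ext w
      exact (Finset.sum_coe_sort (Finset.univ.erase i) (fun j => u j * w j)).symm
    rw [hT']
    exact h1
  have hprod : π.map (fun w : ι → ℝ => (w i, T w)) = μ.prod (π.map T) := by
    rw [(indepFun_iff_map_prod_eq_prod_map_map (measurable_pi_apply i).aemeasurable
      hTm.aemeasurable).1 hind, map_eval_pi]
  have : IsProbabilityMeasure (π.map T) := Measure.isProbabilityMeasure_map hTm.aemeasurable
  have tr : ∀ G : ℝ × ℝ → ℝ, Measurable G → Integrable G (μ.prod (π.map T)) →
      ∫ w, G (w i, T w) ∂π = ∫ y, ∫ x, G (x, y) ∂μ ∂(π.map T) := fun G hG hGi => by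
    rw [← integral_prod_symm _ hGi, ← hprod, integral_map (by fun_prop) hG.aestronglyMeasurable]
  have hdm : Measurable (deriv Ψ) := h.continuous_deriv.measurable
  have iS : Integrable (fun z : ℝ × ℝ => deriv Ψ z.1) (μ.prod (π.map T)) :=
    h.integrable_score.comp_fst _
  have e1 := tr (fun z => u i * f' (u i * z.1 + z.2)) (by fun_prop)
    (Integrable.of_bound (by fun_prop) (|u i| * C') (Filter.Eventually.of_forall fun z => by
      rw [Real.norm_eq_abs, abs_mul]; gcongr; exact hC' _))
  have e2 := tr (fun z => f (u i * z.1 + z.2) * deriv Ψ z.1) (by fun_prop)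
    (iS.bdd_mul (by fun_prop) (Filter.Eventually.of_forall fun z => hC _))
  simp only [hsplit]
  rw [e1, e2]
  congr 1; ext y
  refine h.integral_deriv_eq (g := fun x => f (u i * x + y)) (g' := fun x => u i * f' (u i * x + y))
    (fun x => ?_) (by fun_prop) (fun x => hC _) (C' := |u i| * C') (fun x => ?_)
  · have := (hf (u i * x + y)).comp x (((hasDerivAt_id x).const_mul (u i)).add_const y)
    exact this.congr_deriv (by simp [mul_comm])
  · rw [abs_mul]; gcongr; exact hC' _

/-- The standard deviation of the score `Ψ'`. -/
noncomputable def scoreNorm (Ψ : ℝ → ℝ) : ℝ := Real.sqrt (∫ x, deriv Ψ x ^ 2 ∂(coeffLaw Ψ))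

/-- A normalized linear combination of the coefficients has a density bounded by the standard
deviation of the score. -/
lemma IsAdmissible.measure_abs_sum_le (h : IsAdmissible Ψ) (u : ι → ℝ) (hu : ∑ i, u i ^ 2 = 1)
    {r : ℝ} (hr : 0 < r) :
    (Measure.pi fun _ : ι => coeffLaw Ψ).real {w | |∑ i, u i * w i| ≤ r}
      ≤ Real.pi * scoreNorm Ψ * r := by
  have := h.isProbabilityMeasure
  set π := Measure.pi fun _ : ι => coeffLaw Ψ
  -- A bounded function of size `r π / 2` whose derivative lies in `[0, 1]` and is at least `1/2` on
  -- `[-r, r]`; the factor `r` in its size is the gain in the estimate.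
  set f : ℝ → ℝ := fun x => r * Real.arctan (r⁻¹ * x) with hfdef
  set f' : ℝ → ℝ := fun x => 1 / (1 + (r⁻¹ * x) ^ 2) with hf'def
  have hf : ∀ x, HasDerivAt f (f' x) x := fun x => by
    have := (((hasDerivAt_id x).const_mul r⁻¹).arctan).const_mul r
    refine this.congr_deriv ?_
    simp only [hf'def, id]
    field_simp
  have hf'c : Continuous f' := by
    refine continuous_const.div (by fun_prop) fun x => by positivity
  have hfc : Continuous f := by fun_prop
  have hC : ∀ x, |f x| ≤ r * (Real.pi / 2) := fun x => by
    simp only [hfdef, abs_mul, abs_of_pos hr]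
    gcongr
    exact (abs_lt.2 ⟨Real.neg_pi_div_two_lt_arctan _, Real.arctan_lt_pi_div_two _⟩).le
  have hf'0 : ∀ x, 0 ≤ f' x := fun x => by simp only [hf'def]; positivity
  have hC' : ∀ x, |f' x| ≤ 1 := fun x => by
    rw [abs_of_nonneg (hf'0 x)]
    simp only [hf'def]
    rw [div_le_one (by positivity)]
    nlinarith [sq_nonneg (r⁻¹ * x)]
  set S : (ι → ℝ) → ℝ := fun w => ∑ i, u i * w i with hS
  set W : (ι → ℝ) → ℝ := fun w => ∑ i, u i * deriv Ψ (w i) with hW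
  have hSm : Measurable S := by fun_prop
  have hWL : MemLp W 2 π := memLp_sum_pi u h.memLp_score
  have hWi : Integrable W π := hWL.integrable (by norm_num)
  have hW2 : ∫ w, W w ^ 2 ∂π = ∫ x, deriv Ψ x ^ 2 ∂(coeffLaw Ψ) := by
    rw [integral_sum_sq_pi u h.continuous_deriv.measurable h.memLp_score h.integral_score, hu,
      one_mul]
  have hfi : Integrable (fun w => f' (S w)) π :=
    Integrable.of_bound (by fun_prop) 1 (Filter.Eventually.of_forall fun w => hC' _)
  -- Since `∑ u i ^ 2 = 1`, the left side is the `u i`-weighted sum of the one-coordinate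
  -- identities.
  have ibp : ∫ w, f' (S w) ∂π = ∫ w, f (S w) * W w ∂π := by
    have hsc : ∀ i, Integrable (fun w : ι → ℝ => f (S w) * deriv Ψ (w i)) π := fun i =>
      ((memLp_eval_pi i h.memLp_score).integrable (by norm_num)).bdd_mul
        (by fun_prop) (Filter.Eventually.of_forall fun z => hC _)
    calc ∫ w, f' (S w) ∂π = ∑ i, u i * ∫ w, u i * f' (S w) ∂π := by
          simp_rw [integral_const_mul]
          simp_rw [← mul_assoc, ← sq]
          rw [← Finset.sum_mul, hu, one_mul]
      _ = ∑ i, ∫ w, u i * (f (S w) * deriv Ψ (w i)) ∂π := by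
          refine Finset.sum_congr rfl fun i _ => ?_
          rw [h.integral_partial u i hf hf'c hC hC', integral_const_mul]
      _ = ∫ w, f (S w) * W w ∂π := by
          rw [← integral_finsetSum _ fun i _ => (hsc i).const_mul _]
          congr 1; ext w
          simp only [hW, Finset.mul_sum]
          exact Finset.sum_congr rfl fun i _ => by ring
  -- Cauchy–Schwarz, in the form that `|W|` has nonnegative variance.
  have hW1 : ∫ w, |W w| ∂π ≤ scoreNorm Ψ := by
    refine Real.le_sqrt_of_sq_le ?_
    rw [← hW2]
    have hv := variance_nonneg |W| π
    rw [variance_eq_sub hWL.abs] at hv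
    simp only [Pi.pow_apply, Pi.abs_apply, sq_abs] at hv
    linarith
  have hWa : ∫ w, f (S w) * W w ∂π ≤ r * (Real.pi / 2) * scoreNorm Ψ := by
    calc ∫ w, f (S w) * W w ∂π ≤ ∫ w, r * (Real.pi / 2) * |W w| ∂π := by
          refine integral_mono (hWi.bdd_mul (by fun_prop)
            (Filter.Eventually.of_forall fun z => hC _)) (hWi.abs.const_mul _) fun w => ?_
          refine (le_abs_self _).trans ?_
          rw [abs_mul]; gcongr; exact hC _
      _ = r * (Real.pi / 2) * ∫ w, |W w| ∂π := integral_const_mul _ _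
      _ ≤ _ := by gcongr
  have hms : MeasurableSet {w | |S w| ≤ r} := measurableSet_le (by fun_prop) measurable_const
  have hlow : π.real {w | |S w| ≤ r} * (1 / 2) ≤ ∫ w, f' (S w) ∂π := by
    have := integral_indicator_const (μ := π) (1 / 2 : ℝ) hms
    rw [smul_eq_mul] at this
    rw [← this]
    refine integral_mono ((integrable_const _).indicator hms) hfi fun w => ?_
    by_cases hw : |S w| ≤ r
    · rw [Set.indicator_of_mem (by exact hw)]
      simp only [hf'def]
      apply one_div_le_one_div_of_le (by positivity)
      have : |r⁻¹ * S w| ≤ 1 := by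
        rw [abs_mul, abs_of_pos (inv_pos.2 hr), inv_mul_le_iff₀ hr]; simpa using hw
      have := (sq_le_one_iff_abs_le_one _).2 this
      linarith
    · rw [Set.indicator_of_notMem (by exact hw)]; exact hf'0 _
  rw [ibp] at hlow
  nlinarith [hlow.trans hWa]

end SmallBall

end RandomTrig

namespace RandomTrig

open Filter Topology

/-! ### Deterministic consequences of Rolle's theorem, and a Sobolev inequality. -/

section Rolle

lemma exists_finset_deriv_eq_zero {f f' : ℝ → ℝ} (hf : ∀ x, HasDerivAt f (f' x) x) {a b : ℝ} {k : ℕ}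
    (s : Finset ℝ) (hs : s.card = k + 1) (hsI : ∀ x ∈ s, x ∈ Set.Icc a b) (h0 : ∀ x ∈ s, f x = 0) :
    ∃ s' : Finset ℝ, s'.card = k ∧ (∀ x ∈ s', x ∈ Set.Icc a b) ∧ ∀ x ∈ s', f' x = 0 := by
  classical
  set e := s.orderEmbOfFin hs
  have he : ∀ i, e i ∈ s := fun i => s.orderEmbOfFin_mem hs i
  have hfc : Continuous f := continuous_iff_continuousAt.2 fun x => (hf x).continuousAt
  have hc : ∀ i : Fin k, ∃ c ∈ Set.Ioo (e i.castSucc) (e i.succ), f' c = 0 := fun i =>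
    exists_hasDerivAt_eq_zero (e.strictMono Fin.castSucc_lt_succ) hfc.continuousOn
      (by rw [h0 _ (he _), h0 _ (he _)]) (fun x _ => hf x)
  choose c hcI hc0 using hc
  have hmono : StrictMono c := fun i j hij => by
    have : e i.succ ≤ e j.castSucc := e.monotone (by
      rw [Fin.le_def]; simpa using hij)
    exact (hcI i).2.trans_le (this.trans (hcI j).1.le)
  refine ⟨Finset.univ.image c, ?_, ?_, ?_⟩
  · rw [Finset.card_image_of_injective _ hmono.injective]; simp
  · intro x hx
    obtain ⟨i, -, rfl⟩ := Finset.mem_image.1 hx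
    exact ⟨(hsI _ (he _)).1.trans (hcI i).1.le, (hcI i).2.le.trans (hsI _ (he _)).2⟩
  · intro x hx
    obtain ⟨i, -, rfl⟩ := Finset.mem_image.1 hx
    exact hc0 i

lemma abs_sub_le_of_deriv_le {f f' : ℝ → ℝ} (hf : ∀ x, HasDerivAt f (f' x) x) {a b M : ℝ}
    (hM : ∀ x ∈ Set.Icc a b, |f' x| ≤ M) {x y : ℝ} (hx : x ∈ Set.Icc a b) (hy : y ∈ Set.Icc a b) :
    |f y - f x| ≤ M * |y - x| :=
  Convex.norm_image_sub_le_of_norm_hasDerivWithin_le (fun z _ => (hf z).hasDerivWithinAt)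
    hM (convex_Icc a b) hx hy

/-- Each derivative loses at most one zero by Rolle, and each integration from a zero gains a factor
`ℓ`. The induction replaces `F` by the shifted family, so the hypothesis on `F k` keeps its form. -/
lemma abs_le_of_card_zeros {F : ℕ → ℝ → ℝ} (hF : ∀ k x, HasDerivAt (F k) (F (k + 1) x) x)
    {σ ℓ M : ℝ} {k : ℕ} (hM : ∀ x ∈ Set.Icc σ (σ + ℓ), |F k x| ≤ M)
    (s : Finset ℝ) (hs : s.card = k) (hsI : ∀ x ∈ s, x ∈ Set.Icc σ (σ + ℓ))
    (h0 : ∀ x ∈ s, F 0 x = 0) {x : ℝ} (hx : x ∈ Set.Icc σ (σ + ℓ)) : |F 0 x| ≤ ℓ ^ k * M := by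
  have hℓ : 0 ≤ ℓ := by linarith [hx.1, hx.2]
  induction k generalizing F s x with
  | zero => simpa using hM x hx
  | succ k ih =>
    obtain ⟨s', hs', hsI', h0'⟩ := exists_finset_deriv_eq_zero (hF 0) s hs hsI h0
    have h1 : ∀ y ∈ Set.Icc σ (σ + ℓ), |F 1 y| ≤ ℓ ^ k * M := fun y hy =>
      ih (F := fun j => F (j + 1)) (fun j => hF (j + 1)) hM s' hs' hsI' h0' hy
    obtain ⟨z, hz⟩ : s.Nonempty := Finset.card_pos.1 (by omega)
    have h2 := abs_sub_le_of_deriv_le (hF 0) h1 (hsI z hz) hx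
    rw [h0 z hz, sub_zero] at h2
    have h3 : |x - z| ≤ ℓ := by
      have := hsI z hz
      rw [abs_le]; constructor <;> linarith [hx.1, hx.2, this.1, this.2]
    have hM0 : 0 ≤ ℓ ^ k * M := (abs_nonneg _).trans (h1 x hx)
    calc |F 0 x| ≤ ℓ ^ k * M * |x - z| := h2
      _ ≤ ℓ ^ k * M * ℓ := by gcongr
      _ = ℓ ^ (k + 1) * M := by ring

/-- Integrating from the critical point gives `f' = O(ε M)` between `s` and `τ`, and integrating
again from the zero gives `O(ε² M)`. The second power of `ε` beats the `1/ε` points of a grid of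
mesh `ε`. -/
lemma abs_le_of_close_zeros {f f' f'' : ℝ → ℝ} (hf : ∀ x, HasDerivAt f (f' x) x)
    (hf' : ∀ x, HasDerivAt f' (f'' x) x) {a b M ε s c τ : ℝ}
    (hM : ∀ x ∈ Set.Icc a b, |f'' x| ≤ M) (hs : s ∈ Set.Icc a b) (hc : c ∈ Set.Icc a b)
    (hτ : τ ∈ Set.Icc a b) (hfs : f s = 0) (hfc : f' c = 0) (hsc : |s - c| ≤ ε) (hsτ : |τ - s| ≤ ε) :
    |f τ| ≤ 2 * ε ^ 2 * M := by
  have hε : 0 ≤ ε := (abs_nonneg _).trans hsc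
  have hM0 : 0 ≤ M := (abs_nonneg _).trans (hM s hs)
  have hsub : Set.uIcc τ s ⊆ Set.Icc a b := Set.uIcc_subset_Icc hτ hs
  have h1 : ∀ x ∈ Set.uIcc τ s, |f' x| ≤ M * (2 * ε) := fun x hx => by
    have h2 := abs_sub_le_of_deriv_le hf' hM hc (hsub hx)
    rw [hfc, sub_zero] at h2
    refine h2.trans ?_
    gcongr
    have h3 : |x - s| ≤ |τ - s| := by
      have := Set.abs_sub_right_of_mem_uIcc hx
      rwa [abs_sub_comm s x, abs_sub_comm s τ] at this
    calc |x - c| = |(x - s) + (s - c)| := by ring_nf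
      _ ≤ |x - s| + |s - c| := abs_add_le _ _
      _ ≤ 2 * ε := by linarith
  have h4 := abs_sub_le_of_deriv_le hf h1 (x := s) (y := τ) Set.right_mem_uIcc Set.left_mem_uIcc
  rw [hfs, sub_zero] at h4
  calc |f τ| ≤ M * (2 * ε) * |τ - s| := h4
    _ ≤ M * (2 * ε) * ε := by gcongr
    _ = 2 * ε ^ 2 * M := by ring

lemma exists_deriv_zero_of_close_zeros {f f' : ℝ → ℝ} (hf : ∀ x, HasDerivAt f (f' x) x)
    {s t : ℝ} (hst : s ≠ t) (hs : f s = 0) (ht : f t = 0) :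
    ∃ c ∈ Set.uIcc s t, f' c = 0 := by
  have hfc : Continuous f := continuous_iff_continuousAt.2 fun x => (hf x).continuousAt
  rcases lt_or_gt_of_ne hst with h | h
  · obtain ⟨c, hc, h0⟩ := exists_hasDerivAt_eq_zero h hfc.continuousOn (by rw [hs, ht])
      (fun x _ => hf x)
    exact ⟨c, by rw [Set.uIcc_of_lt h]; exact Set.Ioo_subset_Icc_self hc, h0⟩
  · obtain ⟨c, hc, h0⟩ := exists_hasDerivAt_eq_zero h hfc.continuousOn (by rw [hs, ht])
      (fun x _ => hf x)
    exact ⟨c, by rw [Set.uIcc_of_gt h]; exact Set.Ioo_subset_Icc_self hc, h0⟩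

/-- From `(f²)' = 2 f f' ≤ f² + f'²`. It turns second moments at fixed points into control of a
supremum. -/
lemma sq_le_sobolev {f f' : ℝ → ℝ} (hf : ∀ x, HasDerivAt f (f' x) x) (hf' : Continuous f')
    {a b t : ℝ} (ht : t ∈ Set.Icc a b) :
    f t ^ 2 ≤ f a ^ 2 + ∫ s in Set.Icc a b, (f s ^ 2 + f' s ^ 2) := by
  have hfc : Continuous f := continuous_iff_continuousAt.2 fun x => (hf x).continuousAt
  have hd : ∀ x, HasDerivAt (fun x => f x ^ 2) (2 * f x * f' x) x := fun x => by
    exact ((hf x).pow 2).congr_deriv (by simp)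
  have hcont : Continuous fun x => 2 * f x * f' x := by fun_prop
  have e := intervalIntegral.integral_eq_sub_of_hasDerivAt (a := a) (b := t)
    (fun y _ => hd y) (hcont.intervalIntegrable _ _)
  have hi : IntegrableOn (fun s => f s ^ 2 + f' s ^ 2) (Set.Icc a b) :=
    (by fun_prop : Continuous fun s => f s ^ 2 + f' s ^ 2).continuousOn.integrableOn_Icc
  have h1 : ∫ y in a..t, 2 * f y * f' y ≤ ∫ s in Set.Icc a b, (f s ^ 2 + f' s ^ 2) := by
    rw [intervalIntegral.integral_of_le ht.1]
    calc ∫ y in Set.Ioc a t, 2 * f y * f' y ≤ ∫ y in Set.Ioc a t, (f y ^ 2 + f' y ^ 2) := by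
          refine setIntegral_mono
            (hcont.continuousOn.integrableOn_Icc.mono_set Set.Ioc_subset_Icc_self)
            (hi.mono_set fun x hx => ⟨hx.1.le, hx.2.trans ht.2⟩) fun y => ?_
          nlinarith [sq_nonneg (f y - f' y)]
      _ ≤ _ := setIntegral_mono_set hi (Eventually.of_forall fun x => by positivity)
          (LE.le.eventuallyLE fun x hx => ⟨hx.1.le, hx.2.trans ht.2⟩)
  linarith

end Rolle

/-! ### Approximate counting of zeros by `|f'| 1_{|f| < δ} / (2δ)`. -/

section LocalLimit

/-- The approximate zero-counting density `|f'| 1_{|f| < δ} / (2δ)`. -/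
noncomputable def kd (f f' : ℝ → ℝ) (δ t : ℝ) : ℝ := if |f t| < δ then |f' t| / (2 * δ) else 0

variable {f f' : ℝ → ℝ} {a b δ : ℝ}

lemma kd_nonneg (hδ : 0 < δ) (t : ℝ) : 0 ≤ kd f f' δ t := by
  unfold kd; split_ifs <;> positivity

lemma kd_le (hδ : 0 < δ) (t : ℝ) : kd f f' δ t ≤ |f' t| / (2 * δ) := by
  unfold kd; split_ifs
  · exact le_rfl
  · positivity

lemma measurable_kd (hf : Measurable f) (hf' : Measurable f') : Measurable (kd f f' δ) :=
  Measurable.ite (measurableSet_lt (by fun_prop) measurable_const) (by fun_prop) measurable_const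

lemma integrableOn_kd (hf : Continuous f) (hf' : Continuous f') (hδ : 0 < δ) :
    IntegrableOn (kd f f' δ) (Set.Icc a b) := by
  have : IntegrableOn (fun t => |f' t| / (2 * δ)) (Set.Icc a b) :=
    (by fun_prop : Continuous fun t => |f' t| / (2 * δ)).continuousOn.integrableOn_Icc
  refine Integrable.mono' this (measurable_kd hf.measurable hf'.measurable).aestronglyMeasurable
    (Eventually.of_forall fun t => ?_)
  rw [Real.norm_eq_abs, abs_of_nonneg (kd_nonneg hδ t)]
  exact kd_le hδ t

lemma injOn_Ioo_of_deriv_ne_zero (hf : ∀ x, HasDerivAt f (f' x) x)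
    (h0 : ∀ x ∈ Set.Ioo a b, f' x ≠ 0) : Set.InjOn f (Set.Ioo a b) := by
  intro x hx y hy hxy
  by_contra hne
  have hfc : Continuous f := continuous_iff_continuousAt.2 fun x => (hf x).continuousAt
  wlog h : x < y generalizing x y
  · exact this hy hx hxy.symm (Ne.symm hne) (lt_of_le_of_ne (not_lt.1 h) (Ne.symm hne))
  obtain ⟨c, hc, h1⟩ := exists_hasDerivAt_eq_zero h hfc.continuousOn hxy (fun x _ => hf x)
  exact h0 c ⟨hx.1.trans hc.1, hc.2.trans hy.2⟩ h1

lemma integral_kd_of_injOn (hf : ∀ x, HasDerivAt f (f' x) x) {s : Set ℝ} (hs : MeasurableSet s)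
    (hinj : Set.InjOn f s) :
    ∫ t in s, kd f f' δ t = ∫ x in f '' s, (if |x| < δ then 1 / (2 * δ) else 0) := by
  rw [integral_image_eq_integral_abs_deriv_smul hs (fun x _ => (hf x).hasDerivWithinAt) hinj]
  congr 1; ext t
  unfold kd
  split_ifs <;> simp [div_eq_mul_inv]

lemma integrable_box (hδ : 0 < δ) :
    Integrable (fun x : ℝ => if |x| < δ then 1 / (2 * δ) else 0) ∧
    ∫ x : ℝ, (if |x| < δ then 1 / (2 * δ) else 0) = 1 := by
  have e : (fun x : ℝ => if |x| < δ then 1 / (2 * δ) else 0)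
      = (Set.Ioo (-δ) δ).indicator fun _ => 1 / (2 * δ) := by
    ext x; simp only [Set.indicator, Set.mem_Ioo, abs_lt]
  rw [e]
  constructor
  · exact (integrable_indicator_iff measurableSet_Ioo).2 (integrableOn_const (by simp))
  · rw [integral_indicator_const _ measurableSet_Ioo]
    simp only [Measure.real, Real.volume_Ioo, smul_eq_mul]
    rw [ENNReal.toReal_ofReal (by linarith)]
    field_simp; ring

/-- Between consecutive critical points `f` is injective, and the change of variables `x = f t`
bounds that piece by the total mass 1 of the box. Cutting at one critical point at a time doubles
the bound. What matters later is that it does not depend on `δ`. -/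
lemma integral_kd_le (hf : ∀ x, HasDerivAt f (f' x) x) (hf' : Continuous f') (hδ : 0 < δ)
    (s : Finset ℝ) (h0 : ∀ x ∈ Set.Ioo a b, f' x = 0 → x ∈ s) :
    ∫ t in Set.Icc a b, kd f f' δ t ≤ 2 ^ s.card := by
  classical
  have hfc : Continuous f := continuous_iff_continuousAt.2 fun x => (hf x).continuousAt
  rw [integral_Icc_eq_integral_Ioo]
  induction s using Finset.induction generalizing a b with
  | empty =>
    have hinj : Set.InjOn f (Set.Ioo a b) :=
      injOn_Ioo_of_deriv_ne_zero hf fun x hx h => by simpa using h0 x hx h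
    rw [integral_kd_of_injOn hf measurableSet_Ioo hinj]
    simp only [Finset.card_empty, pow_zero]
    exact (setIntegral_le_integral (integrable_box hδ).1
      (Eventually.of_forall fun x => by positivity)).trans_eq (integrable_box hδ).2
  | insert c s hc ih =>
    rw [Finset.card_insert_of_notMem hc, pow_succ]
    by_cases hcI : c ∈ Set.Ioo a b
    · have h1 : ∫ t in Set.Ioo a c, kd f f' δ t ≤ 2 ^ s.card :=
        ih fun x hx hx0 => (Finset.mem_insert.1 (h0 x ⟨hx.1, hx.2.trans hcI.2⟩ hx0)).resolve_left
          hx.2.ne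
      have h2 : ∫ t in Set.Ioo c b, kd f f' δ t ≤ 2 ^ s.card :=
        ih fun x hx hx0 => (Finset.mem_insert.1 (h0 x ⟨hcI.1.trans hx.1, hx.2⟩ hx0)).resolve_left
          hx.1.ne'
      rw [← integral_Ioc_eq_integral_Ioo, ← Set.Ioc_union_Ioc_eq_Ioc hcI.1.le hcI.2.le,
        setIntegral_union (Set.Ioc_disjoint_Ioc_of_le le_rfl) measurableSet_Ioc
          ((integrableOn_kd hfc hf' hδ).mono_set Set.Ioc_subset_Icc_self)
          ((integrableOn_kd hfc hf' hδ).mono_set Set.Ioc_subset_Icc_self),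
        integral_Ioc_eq_integral_Ioo, integral_Ioc_eq_integral_Ioo]
      linarith
    · have h1 : ∫ t in Set.Ioo a b, kd f f' δ t ≤ 2 ^ s.card :=
        ih fun x hx hx0 => (Finset.mem_insert.1 (h0 x hx hx0)).resolve_left
          fun h => hcI (h ▸ hx)
      have : (0 : ℝ) < 2 ^ s.card := by positivity
      linarith

/-- Off small balls around the zeros, `|f|` is bounded below by compactness. On each ball `f` is
injective, because its derivative does not vanish there. -/
lemma exists_radius (hf : ∀ x, HasDerivAt f (f' x) x) (hf' : Continuous f') {Z : Finset ℝ}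
    (hZ : ∀ t, t ∈ Z ↔ t ∈ Set.Icc a b ∧ f t = 0) (hZI : ∀ z ∈ Z, z ∈ Set.Ioo a b)
    (hZd : ∀ z ∈ Z, f' z ≠ 0) {r₀ : ℝ} (hr₀ : 0 < r₀) :
    ∃ r, 0 < r ∧ r ≤ r₀ ∧ (∀ z ∈ Z, Metric.ball z r ⊆ Set.Icc a b) ∧
      (∀ z ∈ Z, ∀ z' ∈ Z, z ≠ z' → Disjoint (Metric.ball z r) (Metric.ball z' r)) ∧
      ∀ᶠ δ in 𝓝[>] (0 : ℝ), (∀ t ∈ Set.Icc a b, |f t| < δ → ∃ z ∈ Z, t ∈ Metric.ball z r) ∧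
        ∀ z ∈ Z, ∫ t in Metric.ball z r, kd f f' δ t = 1 := by
  have hfc : Continuous f := continuous_iff_continuousAt.2 fun x => (hf x).continuousAt
  have small : ∀ c : ℝ, 0 < c → ∀ᶠ r in 𝓝[>] (0 : ℝ), r < c := fun c hc =>
    mem_nhdsWithin_of_mem_nhds (Iio_mem_nhds hc)
  have nb : ∀ {s : Set ℝ} {z : ℝ}, s ∈ 𝓝 z → ∀ᶠ r in 𝓝[>] (0 : ℝ), Metric.ball z r ⊆ s :=
    fun {s z} hs => by
      obtain ⟨c, hc, hcs⟩ := Metric.mem_nhds_iff.1 hs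
      filter_upwards [small c hc] with r hr
      exact (Metric.ball_subset_ball hr.le).trans hcs
  have e1 : ∀ᶠ r in 𝓝[>] (0 : ℝ), ∀ z ∈ Z, Metric.ball z r ⊆ Set.Ioo a b :=
    (Filter.eventually_all_finset Z).2 fun z hz => nb (Ioo_mem_nhds (hZI z hz).1 (hZI z hz).2)
  have e2 : ∀ᶠ r in 𝓝[>] (0 : ℝ), ∀ z ∈ Z, ∀ z' ∈ Z, z ≠ z' →
      Disjoint (Metric.ball z r) (Metric.ball z' r) :=
    (Filter.eventually_all_finset Z).2 fun z hz => (Filter.eventually_all_finset Z).2 fun z' hz' => by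
      by_cases h : z = z'
      · simp [h]
      · filter_upwards [small (dist z z' / 2) (by have := dist_pos.2 h; positivity)] with r hr _
        exact Metric.ball_disjoint_ball (by linarith)
  have e3 : ∀ᶠ r in 𝓝[>] (0 : ℝ), ∀ z ∈ Z, Metric.ball z r ⊆ {t | f' t ≠ 0} :=
    (Filter.eventually_all_finset Z).2 fun z hz =>
      nb ((isOpen_ne_fun hf' continuous_const).mem_nhds (hZd z hz))
  obtain ⟨r, hr1, hr2, hr3, hrr, hr0⟩ :=
    (e1.and (e2.and (e3.and ((small r₀ hr₀).and self_mem_nhdsWithin)))).exists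
  have hr0 : 0 < r := hr0
  refine ⟨r, hr0, hrr.le, fun z hz => (hr1 z hz).trans Set.Ioo_subset_Icc_self, hr2, ?_⟩
  have d1 : ∀ᶠ δ in 𝓝[>] (0 : ℝ), ∀ t ∈ Set.Icc a b, |f t| < δ → ∃ z ∈ Z, t ∈ Metric.ball z r := by
    set K := Set.Icc a b \ ⋃ z ∈ Z, Metric.ball z r with hK
    have hKc : IsCompact K :=
      isCompact_Icc.diff (isOpen_biUnion fun z _ => Metric.isOpen_ball)
    rcases K.eq_empty_or_nonempty with hKe | hKn
    · filter_upwards with δ t ht _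
      by_contra hcon
      have : t ∈ K := ⟨ht, by simpa using hcon⟩
      simp [hKe] at this
    · obtain ⟨t₀, ht₀, hmin⟩ := hKc.exists_isMinOn hKn (hfc.abs.continuousOn)
      have hpos : 0 < |f t₀| := by
        rw [abs_pos]
        intro h0
        refine ht₀.2 (Set.mem_biUnion ((hZ t₀).2 ⟨ht₀.1, h0⟩) (Metric.mem_ball_self hr0))
      filter_upwards [small _ hpos] with δ hδ t ht hft
      by_contra hcon
      have : t ∈ K := ⟨ht, by simpa using hcon⟩
      exact absurd (hmin this) (by simpa using hft.trans hδ)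
  have d2 : ∀ᶠ δ in 𝓝[>] (0 : ℝ), ∀ z ∈ Z, ∫ t in Metric.ball z r, kd f f' δ t = 1 := by
    refine (Filter.eventually_all_finset Z).2 fun z hz => ?_
    have hst : HasStrictDerivAt f (f' z) z :=
      hasStrictDerivAt_of_hasDerivAt_of_continuousAt (Eventually.of_forall hf) hf'.continuousAt
    -- The image of the ball is a neighbourhood of 0, so for small `δ` it contains all of `(-δ, δ)`
    -- and the local mass is exactly 1.
    have him : f '' Metric.ball z r ∈ 𝓝 (0 : ℝ) := by
      rw [← ((hZ z).1 hz).2, ← hst.map_nhds_eq (hZd z hz)]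
      exact image_mem_map (Metric.ball_mem_nhds z hr0)
    have hinj : Set.InjOn f (Metric.ball z r) := by
      rw [Real.ball_eq_Ioo]
      exact injOn_Ioo_of_deriv_ne_zero hf fun x hx => hr3 z hz (by rwa [Real.ball_eq_Ioo])
    filter_upwards [nb him, self_mem_nhdsWithin] with δ hδ hδ0
    rw [integral_kd_of_injOn hf measurableSet_ball hinj]
    refine (setIntegral_eq_integral_of_forall_compl_eq_zero
      (f := fun x : ℝ => if |x| < δ then 1 / (2 * δ) else 0) fun x hx => ?_).trans
      (integrable_box hδ0).2
    exact if_neg fun h => hx (hδ (by simpa using h))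
  exact d1.and d2

lemma cube_eq_pi (m : ℕ) (I : Set ℝ) : cube m I = Set.univ.pi fun _ => I := by
  ext t; simp [cube]

lemma isCompact_cube (m : ℕ) (a b : ℝ) : IsCompact (cube m (Set.Icc a b)) := by
  rw [cube_eq_pi]; exact isCompact_univ_pi fun _ => isCompact_Icc

lemma measurableSet_cube (m : ℕ) (a b : ℝ) : MeasurableSet (cube m (Set.Icc a b)) :=
  (isCompact_cube m a b).isClosed.measurableSet

lemma setIntegral_pi_prod {m : ℕ} (B : Fin m → Set ℝ) (g : ℝ → ℝ) :
    ∫ t in Set.univ.pi B, ∏ i, g (t i) = ∏ i, ∫ x in B i, g x := by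
  rw [volume_pi, Measure.restrict_pi_pi, integral_fintype_prod_eq_prod (fun _ => g)]

lemma integrableOn_pi_prod {m : ℕ} (B : Fin m → Set ℝ) {g : ℝ → ℝ}
    (hg : ∀ i, IntegrableOn g (B i)) :
    IntegrableOn (fun t : Fin m → ℝ => ∏ i, g (t i)) (Set.univ.pi B) := by
  rw [IntegrableOn, volume_pi, Measure.restrict_pi_pi]
  exact Integrable.fintype_prod (f := fun _ => g) hg

lemma abs_integral_prod_kd_le {m : ℕ} (hf : ∀ x, HasDerivAt f (f' x) x) (hf' : Continuous f')
    (hδ : 0 < δ) (s : Finset ℝ) (h0 : ∀ x ∈ Set.Ioo a b, f' x = 0 → x ∈ s)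
    {h : (Fin m → ℝ) → ℝ} {H : ℝ} (hH : ∀ t ∈ cube m (Set.Icc a b), |h t| ≤ H) (hH0 : 0 ≤ H) :
    |∫ t in cube m (Set.Icc a b), h t * ∏ i, kd f f' δ (t i)| ≤ H * (2 ^ s.card) ^ m := by
  have hfc : Continuous f := continuous_iff_continuousAt.2 fun x => (hf x).continuousAt
  have hi : IntegrableOn (fun t : Fin m → ℝ => ∏ i, kd f f' δ (t i)) (cube m (Set.Icc a b)) := by
    rw [cube_eq_pi]
    exact integrableOn_pi_prod _ fun _ => integrableOn_kd hfc hf' hδ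
  have hk0 : ∀ t : Fin m → ℝ, 0 ≤ ∏ i, kd f f' δ (t i) := fun t =>
    Finset.prod_nonneg fun i _ => kd_nonneg hδ _
  calc |∫ t in cube m (Set.Icc a b), h t * ∏ i, kd f f' δ (t i)|
      ≤ ∫ t in cube m (Set.Icc a b), H * ∏ i, kd f f' δ (t i) := by
        rw [← Real.norm_eq_abs]
        refine norm_integral_le_of_norm_le (hi.const_mul H) ?_
        filter_upwards [ae_restrict_mem (measurableSet_cube m a b)] with t ht
        rw [Real.norm_eq_abs, abs_mul, abs_of_nonneg (hk0 t)]
        exact mul_le_mul_of_nonneg_right (hH t ht) (hk0 t)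
    _ = H * (∫ x in Set.Icc a b, kd f f' δ x) ^ m := by
        rw [integral_const_mul, cube_eq_pi, setIntegral_pi_prod]; simp
    _ ≤ H * (2 ^ s.card) ^ m := by
        have : 0 ≤ ∫ x in Set.Icc a b, kd f f' δ x := integral_nonneg fun x => kd_nonneg hδ x
        gcongr
        exact integral_kd_le hf hf' hδ s h0

/-- If all zeros of `f` are interior and nondegenerate, the approximate zero-counting densities
converge to the counting measure on tuples of zeros. -/
lemma tendsto_integral_prod_kd {m : ℕ} (hf : ∀ x, HasDerivAt f (f' x) x) (hf' : Continuous f')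
    {Z : Finset ℝ} (hZ : ∀ t, t ∈ Z ↔ t ∈ Set.Icc a b ∧ f t = 0)
    (hZI : ∀ z ∈ Z, z ∈ Set.Ioo a b) (hZd : ∀ z ∈ Z, f' z ≠ 0)
    {h : (Fin m → ℝ) → ℝ} (hh : Continuous h) :
    Tendsto (fun δ => ∫ t in cube m (Set.Icc a b), h t * ∏ i, kd f f' δ (t i)) (𝓝[>] (0 : ℝ))
      (𝓝 (∑ τ ∈ Fintype.piFinset (fun _ : Fin m => Z), h τ)) := by
  classical
  have hfc : Continuous f := continuous_iff_continuousAt.2 fun x => (hf x).continuousAt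
  set T := Fintype.piFinset (fun _ : Fin m => Z) with hT
  rw [Metric.tendsto_nhds]
  intro η hη
  set η' := η / (T.card + 1) with hη'
  have hη'0 : 0 < η' := by positivity
  have e0 : ∀ᶠ r in 𝓝[>] (0 : ℝ), ∀ τ ∈ T, ∀ t, dist t τ ≤ r → |h t - h τ| ≤ η' := by
    refine (Filter.eventually_all_finset T).2 fun τ _ => ?_
    obtain ⟨c, hc, hcs⟩ := Metric.continuousAt_iff.1 (hh.continuousAt (x := τ)) η' hη'0
    filter_upwards [mem_nhdsWithin_of_mem_nhds (Iio_mem_nhds hc)] with r hr t ht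
    exact (hcs (lt_of_le_of_lt ht hr)).le
  obtain ⟨r₀, hr₀, hr₀0⟩ := (e0.and self_mem_nhdsWithin).exists
  obtain ⟨r, hr0, hrr, hrI, hrd, hev⟩ := exists_radius hf hf' hZ hZI hZd hr₀0
  filter_upwards [hev, self_mem_nhdsWithin] with δ hδ hδ0
  obtain ⟨hcov, hone⟩ := hδ
  have hδ0 : 0 < δ := hδ0
  have hk0 : ∀ t : Fin m → ℝ, 0 ≤ ∏ i, kd f f' δ (t i) := fun t =>
    Finset.prod_nonneg fun i _ => kd_nonneg hδ0 _
  set box : (Fin m → ℝ) → Set (Fin m → ℝ) := fun τ => Set.univ.pi fun i => Metric.ball (τ i) r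
    with hbox
  have hboxm : ∀ τ, MeasurableSet (box τ) := fun τ =>
    MeasurableSet.univ_pi fun i => measurableSet_ball
  have hTm : ∀ τ, τ ∈ T ↔ ∀ i, τ i ∈ Z := fun τ => Fintype.mem_piFinset
  have hboxsub : ∀ τ ∈ T, box τ ⊆ cube m (Set.Icc a b) := fun τ hτ t ht i =>
    hrI _ ((hTm τ).1 hτ i) (ht i trivial)
  have hki : IntegrableOn (fun t : Fin m → ℝ => ∏ i, kd f f' δ (t i)) (cube m (Set.Icc a b)) := by
    rw [cube_eq_pi]
    exact integrableOn_pi_prod _ fun _ => integrableOn_kd hfc hf' hδ0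
  have hi : IntegrableOn (fun t : Fin m → ℝ => h t * ∏ i, kd f f' δ (t i))
      (cube m (Set.Icc a b)) :=
    IntegrableOn.continuousOn_mul hh.continuousOn hki (isCompact_cube m a b)
  have hdis : (T : Set (Fin m → ℝ)).Pairwise (Function.onFun Disjoint box) := by
    intro τ hτ τ' hτ' hne
    obtain ⟨i, hi⟩ := Function.ne_iff.1 hne
    exact Set.disjoint_univ_pi.2 ⟨i, hrd _ ((hTm τ).1 hτ i) _ ((hTm τ').1 hτ' i) hi⟩
  have hone' : ∀ τ ∈ T, ∫ t in box τ, ∏ i, kd f f' δ (t i) = 1 := fun τ hτ => by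
    rw [hbox, setIntegral_pi_prod]
    exact Finset.prod_eq_one fun i _ => hone _ ((hTm τ).1 hτ i)
  -- The product kernel vanishes unless every coordinate lies in a ball around some zero, that is,
  -- unless `t` is in the box of some tuple of zeros.
  have hsplit : ∫ t in cube m (Set.Icc a b), h t * ∏ i, kd f f' δ (t i)
      = ∑ τ ∈ T, ∫ t in box τ, h t * ∏ i, kd f f' δ (t i) := by
    rw [← integral_biUnion_finset T (fun τ _ => hboxm τ) hdis
      (fun τ hτ => hi.mono_set (hboxsub τ hτ))]
    refine setIntegral_eq_of_subset_of_forall_sdiff_eq_zero (measurableSet_cube m a b)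
      (Set.iUnion₂_subset hboxsub) fun t ht => ?_
    by_contra hne
    have hz : ∀ i, ∃ z ∈ Z, t i ∈ Metric.ball z r := fun i => by
      refine hcov _ (ht.1 i) ?_
      by_contra hlt
      refine hne ?_
      rw [Finset.prod_eq_zero (Finset.mem_univ i) (by rw [kd, if_neg hlt]), mul_zero]
    choose τ hτ hτb using hz
    exact ht.2 (Set.mem_biUnion (x := τ) ((hTm τ).2 hτ) fun i _ => hτb i)
  have hest : ∀ τ ∈ T, |(∫ t in box τ, h t * ∏ i, kd f f' δ (t i)) - h τ| ≤ η' := fun τ hτ => by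
    have hib := hi.mono_set (hboxsub τ hτ)
    have hkib := hki.mono_set (hboxsub τ hτ)
    have e : (∫ t in box τ, h t * ∏ i, kd f f' δ (t i)) - h τ
        = ∫ t in box τ, (h t - h τ) * ∏ i, kd f f' δ (t i) := by
      simp_rw [sub_mul]
      rw [integral_sub hib (hkib.const_mul _), integral_const_mul, hone' τ hτ, mul_one]
    rw [e, ← Real.norm_eq_abs]
    calc _ ≤ ∫ t in box τ, η' * ∏ i, kd f f' δ (t i) := by
          refine norm_integral_le_of_norm_le (hkib.const_mul η') ?_
          filter_upwards [ae_restrict_mem (hboxm τ)] with t ht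
          rw [Real.norm_eq_abs, abs_mul, abs_of_nonneg (hk0 t)]
          refine mul_le_mul_of_nonneg_right (hr₀ τ hτ t ?_) (hk0 t)
          refine ((dist_pi_le_iff hr0.le).2 fun i => ?_).trans hrr
          exact (Metric.mem_ball.1 (ht i trivial)).le
      _ = η' := by rw [integral_const_mul, hone' τ hτ, mul_one]
  rw [hsplit, Real.dist_eq, ← Finset.sum_sub_distrib]
  calc _ ≤ ∑ τ ∈ T, |(∫ t in box τ, h t * ∏ i, kd f f' δ (t i)) - h τ| :=
        Finset.abs_sum_le_sum_abs _ _
    _ ≤ ∑ τ ∈ T, η' := Finset.sum_le_sum hest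
    _ = T.card * η' := by simp
    _ < η := by
        rw [hη', mul_div_assoc', div_lt_iff₀ (by positivity)]
        nlinarith

end LocalLimit

end RandomTrig

namespace RandomTrig

/-! ### Zeros and double zeros of trigonometric sums, through algebraic polynomials on the unit
circle. -/

section TrigSum

open Polynomial ComplexConjugate

variable {N : ℕ}

/-- The real trigonometric sum `∑ Re (g_n e^{i(n+1)s})`. -/
noncomputable def trigSum (g : Fin N → ℂ) (s : ℝ) : ℝ :=
  ∑ n, (g n * Complex.exp (s * Complex.I) ^ ((n : ℕ) + 1)).re

/-- The polynomial `P` of degree at most `2N` with `P (e^{is}) = 2 e^{iNs} trigSum g s`. -/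
noncomputable def trigPolynomial (g : Fin N → ℂ) : ℂ[X] :=
  ∑ n : Fin N, (C (g n) * X ^ (N + (n + 1)) + C (conj (g n)) * X ^ (N - (n + 1)))

lemma eval_trigPolynomial (g : Fin N → ℂ) (s : ℝ) :
    (trigPolynomial g).eval (Complex.exp (s * Complex.I))
      = 2 * Complex.exp (s * Complex.I) ^ N * trigSum g s := by
  set z := Complex.exp (s * Complex.I) with hz
  have hzz : z * conj z = 1 := by
    rw [Complex.mul_conj, Complex.normSq_eq_norm_sq, hz, Complex.norm_exp_ofReal_mul_I]; simp
  simp only [trigPolynomial, eval_finsetSum, eval_add, eval_mul, eval_C, eval_pow, eval_X, trigSum,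
    Complex.ofReal_sum, Finset.mul_sum, ← hz]
  refine Finset.sum_congr rfl fun n _ => ?_
  have h1 : z ^ (N - (n + 1)) = z ^ N * conj z ^ ((n : ℕ) + 1) := by
    obtain ⟨k, hk⟩ := Nat.exists_eq_add_of_le (show (n : ℕ) + 1 ≤ N from n.2)
    rw [show N - ((n : ℕ) + 1) = k by omega]
    have hk' : z ^ N = z ^ ((n : ℕ) + 1) * z ^ k := by rw [← pow_add, ← hk]
    rw [hk', mul_right_comm, ← mul_pow, hzz, one_pow, one_mul]
  rw [h1, pow_add]
  have h2 := Complex.add_conj (g n * z ^ ((n : ℕ) + 1))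
  rw [map_mul, map_pow, Complex.ofReal_mul, Complex.ofReal_ofNat] at h2
  linear_combination z ^ N * h2

lemma coeff_trigPolynomial (g : Fin N → ℂ) (n : Fin N) :
    (trigPolynomial g).coeff (N + (n + 1)) = g n := by
  simp only [trigPolynomial, finsetSum_coeff, coeff_add, coeff_C_mul, coeff_X_pow]
  rw [Finset.sum_eq_single n]
  · have : ¬ N + ((n : ℕ) + 1) = N - (n + 1) := by omega
    simp [this]
  · intro k _ hk
    have h1 : ¬ N + ((n : ℕ) + 1) = N - (k + 1) := by omega
    have h2 : ¬ N + ((n : ℕ) + 1) = N + (k + 1) := fun h => hk (Fin.ext (by omega))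
    rw [if_neg h1, if_neg h2]; simp
  · simp

/-- This records the absence of a constant term, which is what contradicts the existence of too many
double zeros. -/
lemma coeff_trigPolynomial_mid (g : Fin N → ℂ) : (trigPolynomial g).coeff N = 0 := by
  simp only [trigPolynomial, finsetSum_coeff, coeff_add, coeff_C_mul, coeff_X_pow]
  refine Finset.sum_eq_zero fun k _ => ?_
  have h1 : ¬ N = N - ((k : ℕ) + 1) := by have := k.2; omega
  have h2 : ¬ N = N + ((k : ℕ) + 1) := by omega
  rw [if_neg h1, if_neg h2]; simp

lemma natDegree_trigPolynomial_le (g : Fin N → ℂ) : (trigPolynomial g).natDegree ≤ 2 * N := by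
  refine natDegree_sum_le_of_forall_le _ _ fun n _ => ?_
  refine (natDegree_add_le _ _).trans (max_le ?_ ?_)
  · exact (natDegree_C_mul_X_pow_le _ _).trans (by have := n.2; omega)
  · exact (natDegree_C_mul_X_pow_le _ _).trans (by omega)

lemma trigPolynomial_ne_zero {g : Fin N → ℂ} (hg : g ≠ 0) : trigPolynomial g ≠ 0 := by
  intro h
  refine hg (funext fun n => ?_)
  rw [← coeff_trigPolynomial g n, h]; simp

lemma exp_mul_I_injOn {a b : ℝ} (hab : b - a < 2 * Real.pi) :
    Set.InjOn (fun s : ℝ => Complex.exp (s * Complex.I)) (Set.Icc a b) := by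
  intro x hx y hy h
  obtain ⟨n, hn⟩ := Complex.exp_eq_exp_iff_exists_int.1 h
  have h1 : x = y + n * (2 * Real.pi) := by
    have := congrArg Complex.im hn
    simpa using this
  have hpi := Real.pi_pos
  have h2 : |(n : ℝ)| * (2 * Real.pi) < 1 * (2 * Real.pi) := by
    have : |(n : ℝ)| * (2 * Real.pi) = |x - y| := by
      rw [h1, add_sub_cancel_left, abs_mul, abs_of_pos (by positivity : (0 : ℝ) < 2 * Real.pi)]
    rw [this, one_mul]
    refine lt_of_le_of_lt ?_ hab
    rw [abs_le]; constructor <;> linarith [hx.1, hx.2, hy.1, hy.2]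
  have h3 : |(n : ℝ)| < 1 := lt_of_mul_lt_mul_right h2 (by positivity)
  have h4 : n = 0 := by
    rw [← Int.abs_lt_one_iff]; exact_mod_cast h3
  simpa [h4] using h1

/-- On an interval shorter than `2π` the map `s ↦ e^{is}` is injective and sends zeros to roots of a
nonzero polynomial of degree at most `2N`. -/
lemma exists_finset_zeros_trigSum {g : Fin N → ℂ} (hg : g ≠ 0) {a b : ℝ}
    (hab : b - a < 2 * Real.pi) :
    ∃ s : Finset ℝ, s.card ≤ 2 * N ∧ ∀ t, t ∈ s ↔ t ∈ Set.Icc a b ∧ trigSum g t = 0 := by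
  classical
  set P := trigPolynomial g
  have hP : P ≠ 0 := trigPolynomial_ne_zero hg
  set Z : Set ℝ := {t | t ∈ Set.Icc a b ∧ trigSum g t = 0}
  have hinj : Set.InjOn (fun s : ℝ => Complex.exp (s * Complex.I)) Z :=
    (exp_mul_I_injOn hab).mono fun t ht => ht.1
  have hmaps : Set.MapsTo (fun s : ℝ => Complex.exp (s * Complex.I)) Z (P.roots.toFinset : Set ℂ) := by
    intro t ht
    simp only [Finset.mem_coe, Multiset.mem_toFinset, mem_roots hP, IsRoot, P]
    rw [eval_trigPolynomial, ht.2]; simp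
  have hfin : Z.Finite := Set.Finite.of_injOn hmaps hinj (Finset.finite_toSet _)
  refine ⟨hfin.toFinset, ?_, fun t => by simp [Z]⟩
  calc hfin.toFinset.card ≤ P.roots.toFinset.card :=
        Finset.card_le_card_of_injOn _ (by simpa using hmaps) (by simpa using hinj)
    _ ≤ P.roots.card := Multiset.toFinset_card_le _
    _ ≤ P.natDegree := card_roots' P
    _ ≤ 2 * N := natDegree_trigPolynomial_le g

lemma hasDerivAt_trigSum (g : Fin N → ℂ) (s : ℝ) :
    HasDerivAt (trigSum g) (trigSum (fun n => (Complex.I * ((n : ℕ) + 1)) * g n) s) s := by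
  unfold trigSum
  refine HasDerivAt.fun_sum fun n _ => ?_
  have h1 : HasDerivAt (fun s : ℝ => Complex.exp (s * Complex.I))
      (Complex.exp (s * Complex.I) * Complex.I) s := by
    have := ((hasDerivAt_id (s : ℂ)).mul_const Complex.I).cexp.comp_ofReal
    simpa using this
  have h2 := (h1.pow ((n : ℕ) + 1)).const_mul (g n)
  have h3 := Complex.reCLM.hasFDerivAt.comp_hasDerivAt s h2
  refine h3.congr_deriv ?_
  change Complex.re _ = Complex.re _
  congr 1
  push_cast
  ring

/-- For roots on the unit circle, inversion equals conjugation, so reversing the coefficients agrees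
with conjugating them up to a constant. -/
lemma reverse_prod_X_sub_C {ι : Type*} (s : Finset ι) (z : ι → ℂ) (hz : ∀ i, z i * conj (z i) = 1) :
    (∏ i ∈ s, (X - C (z i))).reverse
      = C (∏ i ∈ s, -z i) * (∏ i ∈ s, (X - C (z i))).map (starRingEnd ℂ) := by
  classical
  have h1 : ∀ c : ℂ, c * conj c = 1 → (X - C c).reverse = C (-c) * (X - C (conj c)) := fun c hc => by
    ext n
    rw [coeff_reverse, natDegree_X_sub_C]
    rcases n with _ | _ | n
    · simp [revAt_le, hc, coeff_X]
    · simp [revAt_le, coeff_X, coeff_C]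
    · rw [revAt_eq_self_of_lt (by omega)]
      simp [coeff_X]
  induction s using Finset.induction with
  | empty => simpa using reverse_C (1 : ℂ)
  | insert i s hi ih =>
    rw [Finset.prod_insert hi, Finset.prod_insert hi, reverse_mul_of_domain, ih, h1 _ (hz i)]
    simp only [Polynomial.map_mul, Polynomial.map_sub, map_X, map_C, C_mul]
    ring

/-- With `R_{m-k} = c * conj R_k` and `c = ∏ (-z i)`, the convolution giving the middle coefficient
of `R²` becomes `c * ∑ |R_k|²`. It is nonzero since `R` is monic. -/
lemma coeff_prod_X_sub_C_sq_ne_zero {m : ℕ} (z : Fin m → ℂ) (hz : ∀ i, z i * conj (z i) = 1) :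
    ((∏ i, (X - C (z i))) * ∏ i, (X - C (z i))).coeff m ≠ 0 := by
  set R : ℂ[X] := ∏ i, (X - C (z i)) with hR
  have hdeg : R.natDegree = m := by rw [hR, natDegree_prod_of_monic _ _ fun i _ => monic_X_sub_C _]; simp
  have hmon : R.Monic := monic_prod_of_monic _ _ fun i _ => monic_X_sub_C _
  have hrev : ∀ k ≤ m, R.coeff (m - k) = (∏ i, -z i) * conj (R.coeff k) := fun k hk => by
    have h := congrArg (fun p => coeff p k) (reverse_prod_X_sub_C Finset.univ z hz)
    simp only [← hR, coeff_reverse, hdeg, revAt_le hk, coeff_C_mul, coeff_map] at h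
    exact h
  have hsum : (R * R).coeff m = (∏ i, -z i) *
      ((∑ x ∈ Finset.HasAntidiagonal.antidiagonal m, Complex.normSq (R.coeff x.1) : ℝ) : ℂ) := by
    rw [coeff_mul, Complex.ofReal_sum, Finset.mul_sum]
    refine Finset.sum_congr rfl fun x hx => ?_
    have hx' : x.1 + x.2 = m := Finset.HasAntidiagonal.mem_antidiagonal.1 hx
    rw [show x.2 = m - x.1 by omega, hrev _ (by omega), ← Complex.mul_conj]
    ring
  rw [hsum]
  refine mul_ne_zero (Finset.prod_ne_zero_iff.2 fun i _ => neg_ne_zero.2 fun h0 => ?_) ?_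
  · have := hz i; rw [h0] at this; simp at this
  · rw [Complex.ofReal_ne_zero]
    refine ne_of_gt (Finset.sum_pos' (fun x _ => Complex.normSq_nonneg _) ⟨(m, 0), by simp, ?_⟩)
    have : R.coeff m = 1 := by rw [← hdeg]; exact hmon
    simp [this]

/-- A trigonometric sum with frequencies `1, …, m` (and no constant term) that has `m` distinct
double zeros modulo `2π` vanishes. -/
lemma trigSum_eq_zero_of_double_zeros {m : ℕ} {g : Fin m → ℂ} {s : Fin m → ℝ}
    (hs : Function.Injective fun i => Complex.exp (s i * Complex.I))
    (h0 : ∀ i, trigSum g (s i) = 0)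
    (h1 : ∀ i, trigSum (fun n => (Complex.I * ((n : ℕ) + 1)) * g n) (s i) = 0) : g = 0 := by
  by_contra hg
  set P := trigPolynomial g with hPdef
  have hP : P ≠ 0 := trigPolynomial_ne_zero hg
  set z : Fin m → ℂ := fun i => Complex.exp (s i * Complex.I) with hz
  have hzz : ∀ i, z i * conj (z i) = 1 := fun i => by
    rw [Complex.mul_conj, Complex.normSq_eq_norm_sq, hz, Complex.norm_exp_ofReal_mul_I]; simp
  have hroot : ∀ i, P.IsRoot (z i) := fun i => by
    simp only [IsRoot, hz, hPdef]; rw [eval_trigPolynomial, h0]; simp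
  have hroot' : ∀ i, (derivative P).IsRoot (z i) := fun i => by
    have e1 : HasDerivAt (fun x : ℝ => Complex.exp (x * Complex.I)) (z i * Complex.I) (s i) := by
      have := ((hasDerivAt_id (s i : ℂ)).mul_const Complex.I).cexp.comp_ofReal
      simpa [hz] using this
    have d1 := (P.hasDerivAt (z i)).comp (s i) e1
    have d2 := ((e1.pow m).const_mul 2).mul (hasDerivAt_trigSum g (s i)).ofReal_comp
    -- Differentiating `P(e^{is}) = 2 e^{ims} trigSum g s` at a double zero of the sum shows that
    -- `P'` vanishes at `e^{is}`.
    have heq : (fun x => eval x P) ∘ (fun x : ℝ => Complex.exp (x * Complex.I))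
        = fun x : ℝ => 2 * Complex.exp (x * Complex.I) ^ m * trigSum g x := by
      ext x; simp only [Function.comp, hPdef]; exact eval_trigPolynomial g x
    rw [heq] at d1
    have := d1.unique d2
    rw [h0, h1] at this
    simp only [Complex.ofReal_zero, mul_zero, add_zero] at this
    rcases mul_eq_zero.1 this with h | h
    · exact h
    · exfalso
      rcases mul_eq_zero.1 h with h | h
      · have := hzz i; rw [h] at this; simp at this
      · exact Complex.I_ne_zero h
  set R : ℂ[X] := ∏ i, (X - C (z i)) with hR
  have hdvd : R * R ∣ P := by
    have e : R * R = ∏ i, (X - C (z i)) ^ 2 := by rw [hR, ← sq, Finset.prod_pow]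
    rw [e]
    refine Finset.prod_dvd_of_coprime (fun i _ j _ hij => ?_) fun i _ => ?_
    · exact ((pairwise_coprime_X_sub_C hs) hij).pow
    · have : 1 < P.rootMultiplicity (z i) :=
        (one_lt_rootMultiplicity_iff_isRoot hP).2 ⟨hroot i, hroot' i⟩
      exact (le_rootMultiplicity_iff hP).1 this
  obtain ⟨Q, hQ⟩ := hdvd
  have hmon : R.Monic := monic_prod_of_monic _ _ fun i _ => monic_X_sub_C _
  have hdeg : R.natDegree = m := by
    rw [hR, natDegree_prod_of_monic _ _ fun i _ => monic_X_sub_C _]; simp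
  -- `R * R` already has the maximal degree `2m`, so `P` is a constant multiple of it, and its
  -- middle coefficient gives the contradiction.
  have hQd : Q.natDegree = 0 := by
    have h2 := natDegree_trigPolynomial_le g
    rw [← hPdef, hQ, (hmon.mul hmon).natDegree_mul' (by rintro rfl; simp [hQ] at hP),
      hmon.natDegree_mul hmon, hdeg] at h2
    omega
  rw [eq_C_of_natDegree_eq_zero hQd] at hQ
  have h3 := coeff_trigPolynomial_mid g
  rw [← hPdef, hQ, coeff_mul_C] at h3
  rcases mul_eq_zero.1 h3 with h | h
  · exact coeff_prod_X_sub_C_sq_ne_zero z hzz h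
  · exact hP (by rw [hQ, h]; simp)

end TrigSum

end RandomTrig

namespace RandomTrig

/-! ### The random trigonometric polynomial and its derivatives as linear forms in the coefficients.
-/

section Field

variable {N : ℕ}

/-- The frequency of the `n`-th mode. -/
noncomputable def freq (N : ℕ) (n : Fin N) : ℝ := ((n : ℕ) + 1) / N

/-- The weights of the coefficients in the `k`-th derivative of the trigonometric polynomial. -/
noncomputable def wt (N k : ℕ) (t : ℝ) : Fin N ⊕ Fin N → ℝ :=
  Sum.elim (fun n => freq N n ^ k * Real.cos (freq N n * t + k * (Real.pi / 2)) / Real.sqrt N)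
    (fun n => freq N n ^ k * Real.sin (freq N n * t + k * (Real.pi / 2)) / Real.sqrt N)

/-- The `k`-th derivative of the trigonometric polynomial with coefficients `w`. -/
noncomputable def field (w : Fin N ⊕ Fin N → ℝ) (k : ℕ) (t : ℝ) : ℝ := ∑ i, wt N k t i * w i

lemma freq_pos (n : Fin N) : 0 < freq N n := by
  have : 0 < N := n.pos
  unfold freq; positivity

lemma freq_le_one (n : Fin N) : freq N n ≤ 1 := by
  have : 0 < N := n.pos
  unfold freq
  rw [div_le_one (by positivity)]
  exact_mod_cast n.2

/-- Differentiation multiplies by the frequency and advances the phase by `π/2`, so all derivatives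
share one formula. -/
lemma hasDerivAt_wt (k : ℕ) (i : Fin N ⊕ Fin N) (t : ℝ) :
    HasDerivAt (fun t => wt N k t i) (wt N (k + 1) t i) t := by
  have harg : ∀ n : Fin N, HasDerivAt (fun t => freq N n * t + k * (Real.pi / 2)) (freq N n) t :=
    fun n => by
      have := ((hasDerivAt_id t).const_mul (freq N n)).add_const (k * (Real.pi / 2))
      exact this.congr_deriv (by simp)
  have hs : ∀ n : Fin N, freq N n * t + ((k + 1 : ℕ) : ℝ) * (Real.pi / 2)
      = freq N n * t + k * (Real.pi / 2) + Real.pi / 2 := fun n => by push_cast; ring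
  rcases i with n | n
  · simp only [wt, Sum.elim_inl, hs, Real.cos_add_pi_div_two]
    refine (((harg n).cos.const_mul (freq N n ^ k)).div_const _).congr_deriv ?_
    ring
  · simp only [wt, Sum.elim_inr, hs, Real.sin_add_pi_div_two]
    refine (((harg n).sin.const_mul (freq N n ^ k)).div_const _).congr_deriv ?_
    ring

@[fun_prop]
lemma continuous_wt (k : ℕ) (i : Fin N ⊕ Fin N) : Continuous fun t => wt N k t i :=
  continuous_iff_continuousAt.2 fun t => (hasDerivAt_wt k i t).continuousAt

lemma hasDerivAt_field (w : Fin N ⊕ Fin N → ℝ) (k : ℕ) (t : ℝ) :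
    HasDerivAt (field w k) (field w (k + 1) t) t :=
  HasDerivAt.fun_sum fun i _ => (hasDerivAt_wt k i t).mul_const (w i)

lemma continuous_field_uncurry (k : ℕ) :
    Continuous fun p : (Fin N ⊕ Fin N → ℝ) × ℝ => field p.1 k p.2 := by
  unfold field
  refine continuous_finsetSum _ fun i _ => ?_
  exact ((continuous_wt k i).comp continuous_snd).mul ((continuous_apply i).comp continuous_fst)

lemma continuous_field (w : Fin N ⊕ Fin N → ℝ) (k : ℕ) : Continuous (field w k) :=
  continuous_iff_continuousAt.2 fun t => (hasDerivAt_field w k t).continuousAt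

lemma continuous_field_left (k : ℕ) (t : ℝ) :
    Continuous fun w : Fin N ⊕ Fin N → ℝ => field w k t := by
  unfold field; fun_prop

lemma sum_wt_sq (k : ℕ) (t : ℝ) : ∑ i, wt N k t i ^ 2 = ∑ n : Fin N, freq N n ^ (2 * k) / N := by
  rw [Fintype.sum_sum_type, ← Finset.sum_add_distrib]
  refine Finset.sum_congr rfl fun n _ => ?_
  have h : Real.sqrt N ^ 2 = N := Real.sq_sqrt (Nat.cast_nonneg N)
  simp only [wt, Sum.elim_inl, Sum.elim_inr, div_pow, mul_pow, h]
  rw [← add_div, ← mul_add, Real.cos_sq_add_sin_sq, mul_one, ← pow_mul, mul_comm k 2]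

/-- Since frequencies do not exceed 1, no derivative has larger variance than the field; this is the
source of uniformity in `N`. -/
lemma sum_wt_sq_le_one (k : ℕ) (t : ℝ) : ∑ i, wt N k t i ^ 2 ≤ 1 := by
  rw [sum_wt_sq]
  calc ∑ n : Fin N, freq N n ^ (2 * k) / N ≤ ∑ n : Fin N, 1 / (N : ℝ) := by
        gcongr with n
        exact pow_le_one₀ (freq_pos n).le (freq_le_one n)
    _ ≤ 1 := by
        simp only [Finset.sum_const, Finset.card_univ, Fintype.card_fin, nsmul_eq_mul]
        rw [mul_one_div]; exact div_self_le_one _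

lemma sum_wt_zero_sq (hN : 0 < N) (t : ℝ) : ∑ i, wt N 0 t i ^ 2 = 1 := by
  rw [sum_wt_sq]
  simp only [mul_zero, pow_zero, Finset.sum_const, Finset.card_univ, Fintype.card_fin,
    nsmul_eq_mul]
  field_simp

lemma trigPoly_eq_field (a b : ℕ → ℝ) (N : ℕ) (t : ℝ) :
    trigPoly a b N t = field (Sum.elim (fun n : Fin N => a n) (fun n : Fin N => b n)) 0 t := by
  unfold trigPoly field
  rw [Fintype.sum_sum_type, ← Finset.sum_add_distrib, Finset.mul_sum, Finset.sum_range]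
  refine Finset.sum_congr rfl fun n _ => ?_
  simp only [wt, Sum.elim_inl, Sum.elim_inr, freq]
  have h : ((n : ℕ) + 1 : ℝ) / N * t + ((0 : ℕ) : ℝ) * (Real.pi / 2) = ((n : ℕ) + 1 : ℝ) * t / N := by
    push_cast; ring
  rw [h]
  ring

/-- Writes a mode as a real part of a power of `e^{it/N}`, so that `field` becomes a `trigSum` at
the rescaled point `t / N`. This is why intervals of length below `2πN` are allowed. -/
lemma wt_mode_eq (k : ℕ) (n : Fin N) (t x y : ℝ) :
    wt N k t (Sum.inl n) * x + wt N k t (Sum.inr n) * y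
      = (((freq N n ^ k / Real.sqrt N : ℝ) : ℂ) * Complex.I ^ k * (x - Complex.I * y)
        * Complex.exp ((t / N : ℝ) * Complex.I) ^ ((n : ℕ) + 1)).re := by
  have e1 : Complex.exp ((t / N : ℝ) * Complex.I) ^ ((n : ℕ) + 1)
      = Complex.exp ((freq N n * t : ℝ) * Complex.I) := by
    rw [← Complex.exp_nat_mul]
    congr 1
    unfold freq
    push_cast; ring
  have e2 : Complex.I ^ k = Complex.exp ((k * (Real.pi / 2) : ℝ) * Complex.I) := by
    conv_lhs => rw [← Complex.exp_pi_div_two_mul_I, ← Complex.exp_nat_mul]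
    congr 1
    push_cast; ring
  have e3 : Complex.I ^ k * Complex.exp ((freq N n * t : ℝ) * Complex.I)
      = (Real.cos (freq N n * t + k * (Real.pi / 2)) : ℂ)
        + (Real.sin (freq N n * t + k * (Real.pi / 2)) : ℂ) * Complex.I := by
    rw [e2, ← Complex.exp_add, ← add_mul, ← Complex.ofReal_add, Complex.exp_mul_I,
      ← Complex.ofReal_cos, ← Complex.ofReal_sin]
    rw [add_comm (k * (Real.pi / 2) : ℝ)]
  rw [e1, mul_right_comm, mul_assoc, mul_assoc, ← mul_assoc (Complex.I ^ k), e3]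
  simp only [wt, Sum.elim_inl, Sum.elim_inr]
  rw [Complex.re_ofReal_mul]
  generalize Real.cos (freq N n * t + k * (Real.pi / 2)) = c
  generalize Real.sin (freq N n * t + k * (Real.pi / 2)) = s
  simp only [Complex.mul_re, Complex.add_re, Complex.add_im, Complex.sub_re, Complex.sub_im,
    Complex.ofReal_re, Complex.ofReal_im, Complex.I_re, Complex.I_im, Complex.mul_im]
  ring

lemma field_eq_trigSum (w : Fin N ⊕ Fin N → ℝ) (k : ℕ) (t : ℝ) :
    field w k t = trigSum (fun n => ((freq N n ^ k / Real.sqrt N : ℝ) : ℂ) * Complex.I ^ k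
      * (w (Sum.inl n) - Complex.I * w (Sum.inr n))) (t / N) := by
  unfold field trigSum
  rw [Fintype.sum_sum_type, ← Finset.sum_add_distrib]
  exact Finset.sum_congr rfl fun n _ => wt_mode_eq k n t _ _

lemma sub_I_mul_eq_zero_iff {x y : ℝ} : (x : ℂ) - Complex.I * y = 0 ↔ x = 0 ∧ y = 0 := by
  rw [Complex.ext_iff]; simp

lemma exists_finset_zeros_field {w : Fin N ⊕ Fin N → ℝ} (hw : w ≠ 0) (k : ℕ) {a b : ℝ}
    (hab : b - a < 2 * Real.pi * N) :
    ∃ s : Finset ℝ, s.card ≤ 2 * N ∧ ∀ t, t ∈ s ↔ t ∈ Set.Icc a b ∧ field w k t = 0 := by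
  classical
  have hN : 0 < N := by
    rcases Nat.eq_zero_or_pos N with rfl | h
    · exact absurd (Subsingleton.elim w 0) hw
    · exact h
  have hN' : (0 : ℝ) < N := by exact_mod_cast hN
  set g : Fin N → ℂ := fun n => ((freq N n ^ k / Real.sqrt N : ℝ) : ℂ) * Complex.I ^ k
      * (w (Sum.inl n) - Complex.I * w (Sum.inr n)) with hg
  have hg0 : g ≠ 0 := by
    intro h
    refine hw (funext fun i => ?_)
    have h1 : ∀ n, w (Sum.inl n) = 0 ∧ w (Sum.inr n) = 0 := fun n => by
      have h2 := congrFun h n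
      simp only [hg, Pi.zero_apply] at h2
      have h3 : ((freq N n ^ k / Real.sqrt N : ℝ) : ℂ) * Complex.I ^ k ≠ 0 := by
        refine mul_ne_zero ?_ (pow_ne_zero _ Complex.I_ne_zero)
        rw [Complex.ofReal_ne_zero]
        have := freq_pos n
        positivity
      exact sub_I_mul_eq_zero_iff.1 ((mul_eq_zero.1 h2).resolve_left h3)
    rcases i with n | n
    · exact (h1 n).1
    · exact (h1 n).2
  obtain ⟨s, hs, hs'⟩ := exists_finset_zeros_trigSum hg0 (a := a / N) (b := b / N) (by
    rw [← sub_div, div_lt_iff₀ hN']; exact hab)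
  refine ⟨s.image fun x => x * N, Finset.card_image_le.trans hs, fun t => ?_⟩
  rw [Finset.mem_image, field_eq_trigSum]
  constructor
  · rintro ⟨x, hx, rfl⟩
    obtain ⟨h1, h2⟩ := (hs' x).1 hx
    rw [mul_div_cancel_right₀ _ hN'.ne']
    exact ⟨⟨(div_le_iff₀ hN').1 h1.1, (le_div_iff₀ hN').1 h1.2⟩, h2⟩
  · rintro ⟨h1, h2⟩
    refine ⟨t / N, (hs' _).2 ⟨⟨?_, ?_⟩, h2⟩, by field_simp⟩
    · gcongr; exact h1.1
    · gcongr; exact h1.2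

end Field

end RandomTrig

namespace RandomTrig

/-! ### Density of an invertible linear image of a vector plus an independent vector. -/

section AffineDensity

variable {Ω E : Type*} [MeasurableSpace Ω] [NormedAddCommGroup E] [NormedSpace ℝ E]
  [FiniteDimensional ℝ E] [MeasureSpace E] [BorelSpace E]
  [(volume : Measure E).IsAddHaarMeasure]

lemma lintegral_comp_affine (T : E ≃L[ℝ] E) (r : E) {G : E → ℝ≥0∞} (hG : Measurable G) :
    ∫⁻ v, G (T v + r) = ENNReal.ofReal |(LinearMap.det (T : E →ₗ[ℝ] E))⁻¹| * ∫⁻ z, G z := by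
  have hdet : LinearMap.det (T : E →ₗ[ℝ] E) ≠ 0 := (LinearEquiv.isUnit_det' T.toLinearEquiv).ne_zero
  have h1 := Measure.map_linearMap_addHaar_eq_smul_addHaar (volume : Measure E) hdet
  have h2 : ∫⁻ v, G (T v + r) = ∫⁻ z, G (z + r) ∂(volume.map (T : E →ₗ[ℝ] E)) :=
    (lintegral_map (f := fun z => G (z + r)) (g := T) (hG.comp (measurable_id.add_const r))
      T.continuous.measurable).symm
  rw [h2, h1, lintegral_smul_measure, lintegral_add_right_eq_self, smul_eq_mul]

/-- Conditionally on `R` the density follows from the linear change of variables; integrating over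
`R` averages it. `R` itself may have any law. -/
lemma map_affine_eq_withDensity {π : Measure Ω} [IsProbabilityMeasure π] {V R : Ω → E}
    (hV : Measurable V) (hR : Measurable R) (hind : IndepFun V R π) {q : E → ℝ≥0∞}
    (hq : Measurable q) (hlaw : π.map V = volume.withDensity q) (T : E ≃L[ℝ] E) :
    π.map (fun ω => T (V ω) + R ω) = volume.withDensity fun z =>
      ∫⁻ ω, ENNReal.ofReal |(LinearMap.det (T : E →ₗ[ℝ] E))⁻¹| * q (T.symm (z - R ω)) ∂π := by
  have hTm : Measurable T := T.continuous.measurable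
  have hTsm : Measurable T.symm := T.symm.continuous.measurable
  have : IsProbabilityMeasure (π.map V) := Measure.isProbabilityMeasure_map hV.aemeasurable
  have : IsProbabilityMeasure (π.map R) := Measure.isProbabilityMeasure_map hR.aemeasurable
  have hprod := (indepFun_iff_map_prod_eq_prod_map_map hV.aemeasurable hR.aemeasurable).1 hind
  ext s hs
  set F : E → ℝ≥0∞ := s.indicator 1 with hF
  have hFm : Measurable F := measurable_one.indicator hs
  have hm : Measurable fun ω => T (V ω) + R ω := (hTm.comp hV).add hR
  rw [← lintegral_indicator_one hs, lintegral_map hFm hm, withDensity_apply _ hs]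
  have hFT : Measurable fun p : E × E => F (T p.1 + p.2) :=
    hFm.comp ((hTm.comp measurable_fst).add measurable_snd)
  have e1 : ∫⁻ ω, F (T (V ω) + R ω) ∂π = ∫⁻ ω, ∫⁻ v, F (T v + R ω) ∂(π.map V) ∂π := by
    calc ∫⁻ ω, F (T (V ω) + R ω) ∂π
        = ∫⁻ p, F (T p.1 + p.2) ∂(π.map fun ω => (V ω, R ω)) :=
          (lintegral_map hFT (hV.prodMk hR)).symm
      _ = ∫⁻ r, ∫⁻ v, F (T v + r) ∂(π.map V) ∂(π.map R) := by
          rw [hprod, lintegral_prod_symm _ hFT.aemeasurable]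
      _ = _ := by
          rw [lintegral_map _ hR]
          exact hFT.lintegral_prod_left
  have e2 : ∀ ω, ∫⁻ v, F (T v + R ω) ∂(π.map V)
      = ENNReal.ofReal |(LinearMap.det (T : E →ₗ[ℝ] E))⁻¹|
        * ∫⁻ z, q (T.symm (z - R ω)) * F z := fun ω => by
    have hFω : Measurable fun v => F (T v + R ω) := hFm.comp (hTm.add_const _)
    have hG : Measurable fun z => q (T.symm (z - R ω)) * F z :=
      (hq.comp (hTsm.comp (measurable_id.sub_const _))).mul hFm
    rw [hlaw, lintegral_withDensity_eq_lintegral_mul _ hq hFω, ← lintegral_comp_affine T (R ω) hG]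
    congr 1; ext v
    simp
  have hjm : Measurable fun p : Ω × E => q (T.symm (p.2 - R p.1)) :=
    hq.comp (hTsm.comp (measurable_snd.sub (hR.comp measurable_fst)))
  rw [e1]
  simp_rw [e2]
  rw [lintegral_const_mul' _ _ ENNReal.ofReal_ne_top]
  rw [lintegral_lintegral_swap]
  · rw [← lintegral_indicator hs, ← lintegral_const_mul' _ _ ENNReal.ofReal_ne_top]
    congr 1; ext z
    by_cases hz : z ∈ s
    · rw [Set.indicator_of_mem hz, lintegral_const_mul' _ _ ENNReal.ofReal_ne_top]
      simp [hF, hz]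
    · simp [hF, hz]
  · exact (hjm.mul (hFm.comp measurable_snd)).aemeasurable

end AffineDensity

/-! ### Joint density of independent coefficients. -/

section ProductDensity

lemma pi_coeffLaw_eq_withDensity {Ψ : ℝ → ℝ} (h : IsAdmissible Ψ) (m : ℕ) :
    (Measure.pi fun _ : Fin m => coeffLaw Ψ)
      = volume.withDensity fun v => ENNReal.ofReal (∏ i, Real.exp (-Ψ (v i))) := by
  have := h.isProbabilityMeasure
  have hΨ := h.continuous
  refine Measure.pi_eq fun s hs => ?_
  have hi : Integrable fun x => Real.exp (-Ψ x) := by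
    have := (integrable_coeffLaw_iff hΨ).1 (integrable_const (1 : ℝ))
    simpa using this
  rw [withDensity_apply _ (MeasurableSet.univ_pi hs),
    ← ofReal_integral_eq_lintegral_ofReal (integrableOn_pi_prod s fun i => hi.integrableOn)
      (Filter.Eventually.of_forall fun v => Finset.prod_nonneg fun i _ => (Real.exp_pos _).le),
    setIntegral_pi_prod s fun x => Real.exp (-Ψ x), ENNReal.ofReal_prod_of_nonneg
      (fun i _ => integral_nonneg fun x => (Real.exp_pos _).le)]
  refine Finset.prod_congr rfl fun i _ => ?_
  rw [coeffLaw, withDensity_apply _ (hs i), ofReal_integral_eq_lintegral_ofReal hi.integrableOn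
    (Filter.Eventually.of_forall fun v => (Real.exp_pos _).le)]

/-- The joint density of `2m` independent coefficients. -/
noncomputable def jointDensity (Ψ : ℝ → ℝ) {m : ℕ} (v : (Fin m → ℝ) × (Fin m → ℝ)) : ℝ :=
  (∏ i, Real.exp (-Ψ (v.1 i))) * ∏ i, Real.exp (-Ψ (v.2 i))

lemma jointDensity_nonneg (Ψ : ℝ → ℝ) {m : ℕ} (v : (Fin m → ℝ) × (Fin m → ℝ)) :
    0 ≤ jointDensity Ψ v := by unfold jointDensity; positivity

lemma continuous_jointDensity {Ψ : ℝ → ℝ} (h : Continuous Ψ) {m : ℕ} :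
    Continuous (jointDensity Ψ (m := m)) := by
  unfold jointDensity; fun_prop

lemma jointDensity_le {Ψ : ℝ → ℝ} {B : ℝ} (hB : ∀ x, Real.exp (-Ψ x) ≤ B) {m : ℕ}
    (v : (Fin m → ℝ) × (Fin m → ℝ)) : jointDensity Ψ v ≤ B ^ m * B ^ m := by
  have hB0 : 0 ≤ B := (Real.exp_pos _).le.trans (hB 0)
  unfold jointDensity
  have : ∀ u : Fin m → ℝ, ∏ i, Real.exp (-Ψ (u i)) ≤ B ^ m := fun u => by
    calc _ ≤ ∏ _i : Fin m, B := Finset.prod_le_prod (fun i _ => (Real.exp_pos _).le) fun i _ => hB _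
      _ = B ^ m := by simp
  exact mul_le_mul (this _) (this _) (Finset.prod_nonneg fun i _ => (Real.exp_pos _).le) (by positivity)

lemma prod_pi_coeffLaw_eq_withDensity {Ψ : ℝ → ℝ} (h : IsAdmissible Ψ) (m : ℕ) :
    (Measure.pi fun _ : Fin m => coeffLaw Ψ).prod (Measure.pi fun _ : Fin m => coeffLaw Ψ)
      = volume.withDensity fun v => ENNReal.ofReal (jointDensity Ψ v) := by
  have hΨ := h.continuous
  rw [pi_coeffLaw_eq_withDensity h, prod_withDensity (by fun_prop) (by fun_prop)]
  congr 1; ext v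
  rw [jointDensity, ENNReal.ofReal_mul (Finset.prod_nonneg fun i _ => (Real.exp_pos _).le)]

end ProductDensity

end RandomTrig

namespace RandomTrig

/-! ### The continuous density of the jet vector off the diagonals. -/

section JetDensity

variable {m N : ℕ}

/-- The inclusion of the first `m` modes. -/
def modeEmb (h : m ≤ N) : Fin m ⊕ Fin m ↪ Fin N ⊕ Fin N :=
  (Fin.castLEEmb h).sumMap (Fin.castLEEmb h)

/-- The coefficients of the first `m` modes. -/
def lowCoef (h : m ≤ N) (w : Fin N ⊕ Fin N → ℝ) : (Fin m → ℝ) × (Fin m → ℝ) :=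
  (fun n => w (modeEmb h (Sum.inl n)), fun n => w (modeEmb h (Sum.inr n)))

/-- The contribution of the first `m` modes to the `k`-th derivative. -/
noncomputable def lowSum (h : m ≤ N) (k : ℕ) (s : ℝ) (v : (Fin m → ℝ) × (Fin m → ℝ)) : ℝ :=
  ∑ j, wt N k s (modeEmb h j) * Sum.elim v.1 v.2 j

/-- The contribution of the other modes to the `k`-th derivative. -/
noncomputable def highSum (h : m ≤ N) (k : ℕ) (s : ℝ) (w : Fin N ⊕ Fin N → ℝ) : ℝ :=
  ∑ i ∈ (Finset.univ.map (modeEmb h))ᶜ, wt N k s i * w i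

lemma field_eq_low_add_high (h : m ≤ N) (k : ℕ) (s : ℝ) (w : Fin N ⊕ Fin N → ℝ) :
    field w k s = lowSum h k s (lowCoef h w) + highSum h k s w := by
  unfold field lowSum highSum
  rw [← Finset.sum_add_sum_compl (Finset.univ.map (modeEmb h)), Finset.sum_map]
  congr 1
  refine Finset.sum_congr rfl fun j _ => ?_
  rcases j with j | j <;> rfl

/-- The linear map taking the first `m` coefficients to their contribution to the jet vector. -/
noncomputable def lowJet (h : m ≤ N) (t : Fin m → ℝ) :
    ((Fin m → ℝ) × (Fin m → ℝ)) →L[ℝ] ((Fin m → ℝ) × (Fin m → ℝ)) :=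
  LinearMap.toContinuousLinearMap
    { toFun := fun v => (fun i => lowSum h 0 (t i) v, fun i => lowSum h 1 (t i) v)
      map_add' := fun v v' => by
        have : ∀ k s, lowSum h k s (v + v') = lowSum h k s v + lowSum h k s v' := fun k s => by
          simp only [lowSum, Fintype.sum_sum_type, Sum.elim_inl, Sum.elim_inr, Prod.fst_add,
            Prod.snd_add, Pi.add_apply, mul_add, Finset.sum_add_distrib]
          ring
        ext i <;> simp [this]
      map_smul' := fun c v => by
        have : ∀ k s, lowSum h k s (c • v) = c * lowSum h k s v := fun k s => by
          simp only [lowSum, Fintype.sum_sum_type, Sum.elim_inl, Sum.elim_inr, Prod.smul_fst,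
            Prod.smul_snd, Pi.smul_apply, smul_eq_mul, mul_add, Finset.mul_sum]
          congr 1 <;> exact Finset.sum_congr rfl fun _ _ => by ring
        ext i <;> simp [this] }

lemma lowJet_apply (h : m ≤ N) (t : Fin m → ℝ) (v : (Fin m → ℝ) × (Fin m → ℝ)) :
    lowJet h t v = (fun i => lowSum h 0 (t i) v, fun i => lowSum h 1 (t i) v) := rfl

/-- The contribution of the other modes to the jet vector. -/
noncomputable def highJet (h : m ≤ N) (t : Fin m → ℝ) (w : Fin N ⊕ Fin N → ℝ) :
    (Fin m → ℝ) × (Fin m → ℝ) :=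
  (fun i => highSum h 0 (t i) w, fun i => highSum h 1 (t i) w)

lemma continuous_lowJet (h : m ≤ N) : Continuous (lowJet h) := by
  rw [continuous_clm_apply]
  intro v
  simp only [lowJet_apply, lowSum]
  have : ∀ k (i : Fin m) j, Continuous fun t : Fin m → ℝ => wt N k (t i) (modeEmb h j) :=
    fun k i j => (continuous_wt k _).comp (continuous_apply i)
  fun_prop

lemma continuous_highJet (h : m ≤ N) :
    Continuous fun p : (Fin m → ℝ) × (Fin N ⊕ Fin N → ℝ) => highJet h p.1 p.2 := by
  simp only [highJet, highSum]
  have : ∀ k (i : Fin m) j, Continuous fun p : (Fin m → ℝ) × (Fin N ⊕ Fin N → ℝ) =>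
      wt N k (p.1 i) j :=
    fun k i j => (continuous_wt k _).comp ((continuous_apply i).comp continuous_fst)
  fun_prop

lemma continuous_highJet_right (h : m ≤ N) (t : Fin m → ℝ) : Continuous (highJet h t) := by
  unfold highJet highSum
  fun_prop

lemma deriv_field (w : Fin N ⊕ Fin N → ℝ) : deriv (field w 0) = field w 1 :=
  funext fun t => (hasDerivAt_field w 0 t).deriv

lemma jetVector_field (h : m ≤ N) (t : Fin m → ℝ) (w : Fin N ⊕ Fin N → ℝ) :
    jetVector (field w 0) t = lowJet h t (lowCoef h w) + highJet h t w := by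
  rw [lowJet_apply, jetVector, highJet, deriv_field]
  ext i
  · exact field_eq_low_add_high h 0 (t i) w
  · exact field_eq_low_add_high h 1 (t i) w

lemma lowSum_eq_trigSum (h : m ≤ N) (k : ℕ) (s : ℝ) (v : (Fin m → ℝ) × (Fin m → ℝ)) :
    lowSum h k s v = trigSum (fun n => ((freq N (Fin.castLE h n) ^ k / Real.sqrt N : ℝ) : ℂ)
      * Complex.I ^ k * (v.1 n - Complex.I * v.2 n)) (s / N) := by
  unfold lowSum trigSum
  rw [Fintype.sum_sum_type, ← Finset.sum_add_distrib]
  exact Finset.sum_congr rfl fun n _ => wt_mode_eq k (Fin.castLE h n) s _ _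

/-- A kernel vector is a trigonometric sum with frequencies `1, …, m` vanishing together with its
derivative at the `m` points `t i / N`, which are distinct modulo `2π`. Such a sum is zero. -/
lemma injective_lowJet (h : m ≤ N) {a b : ℝ} (hab : b - a < 2 * Real.pi * N) {t : Fin m → ℝ}
    (ht : t ∈ cube m (Set.Icc a b) \ diag m (Set.Icc a b)) : Function.Injective (lowJet h t) := by
  rw [injective_iff_map_eq_zero]
  intro v hv
  rcases Nat.eq_zero_or_pos m with rfl | hm
  · exact Subsingleton.elim _ _
  have hN : (0 : ℝ) < N := by exact_mod_cast hm.trans_le h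
  rw [lowJet_apply] at hv
  have h0 : ∀ i, lowSum h 0 (t i) v = 0 := fun i => congrFun (congrArg Prod.fst hv) i
  have h1 : ∀ i, lowSum h 1 (t i) v = 0 := fun i => congrFun (congrArg Prod.snd hv) i
  set g : Fin m → ℂ := fun n => ((1 / Real.sqrt N : ℝ) : ℂ) * (v.1 n - Complex.I * v.2 n) with hg
  have e0 : ∀ s, lowSum h 0 s v = trigSum g (s / N) := fun s => by
    rw [lowSum_eq_trigSum]; simp [hg]
  have e1 : ∀ s, lowSum h 1 s v
      = (1 / N) * trigSum (fun n => (Complex.I * ((n : ℕ) + 1)) * g n) (s / N) := fun s => by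
    rw [lowSum_eq_trigSum, trigSum, trigSum, Finset.mul_sum]
    refine Finset.sum_congr rfl fun n _ => ?_
    rw [← Complex.re_ofReal_mul]
    congr 1
    simp only [freq, hg, Fin.val_castLE]
    push_cast
    ring
  have hinj : Function.Injective fun i => Complex.exp (((t i / N : ℝ) : ℂ) * Complex.I) := by
    intro i j hij
    by_contra hne
    refine ht.2 ⟨ht.1, i, j, hne, ?_⟩
    have := exp_mul_I_injOn (a := a / N) (b := b / N)
      (by rw [← sub_div, div_lt_iff₀ hN]; exact hab)
      (x₁ := t i / N) ⟨by gcongr; exact (ht.1 i).1, by gcongr; exact (ht.1 i).2⟩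
      (x₂ := t j / N) ⟨by gcongr; exact (ht.1 j).1, by gcongr; exact (ht.1 j).2⟩ hij
    exact (div_left_inj' hN.ne').1 this
  have hg0 : g = 0 := by
    refine trigSum_eq_zero_of_double_zeros (s := fun i => t i / N) hinj
      (fun i => by rw [← e0, h0]) fun i => ?_
    have := h1 (i := i)
    rw [e1] at this
    exact (mul_eq_zero.1 this).resolve_left (by positivity)
  have hz : ∀ n, v.1 n = 0 ∧ v.2 n = 0 := fun n => by
    have h2 := congrFun hg0 n
    simp only [hg, Pi.zero_apply] at h2
    refine sub_I_mul_eq_zero_iff.1 ((mul_eq_zero.1 h2).resolve_left ?_)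
    exact Complex.ofReal_ne_zero.2 (by positivity)
  ext n
  · exact (hz n).1
  · exact (hz n).2

/-- Invertibility is phrased through units of the normed ring of operators so that `Ring.inverse`
depends continuously on `t`. -/
lemma exists_unit_lowJet (h : m ≤ N) {a b : ℝ} (hab : b - a < 2 * Real.pi * N) {t : Fin m → ℝ}
    (ht : t ∈ cube m (Set.Icc a b) \ diag m (Set.Icc a b)) :
    ∃ u : (((Fin m → ℝ) × (Fin m → ℝ)) →L[ℝ] ((Fin m → ℝ) × (Fin m → ℝ)))ˣ,
      (u : ((Fin m → ℝ) × (Fin m → ℝ)) →L[ℝ] ((Fin m → ℝ) × (Fin m → ℝ))) = lowJet h t := by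
  refine ⟨ContinuousLinearEquiv.toUnit (LinearEquiv.ofInjectiveEndo
    (lowJet h t : ((Fin m → ℝ) × (Fin m → ℝ)) →ₗ[ℝ] _)
    (injective_lowJet h hab ht)).toContinuousLinearEquiv, ?_⟩
  ext v <;> rfl

/-- The density of the jet vector of the random trigonometric polynomial. -/
noncomputable def jetDensity (Ψ : ℝ → ℝ) (h : m ≤ N) (t : Fin m → ℝ)
    (z : (Fin m → ℝ) × (Fin m → ℝ)) : ℝ :=
  |((lowJet h t).det)⁻¹| * ∫ w, jointDensity Ψ (Ring.inverse (lowJet h t) (z - highJet h t w))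
    ∂(Measure.pi fun _ : Fin N ⊕ Fin N => coeffLaw Ψ)

lemma jetDensity_nonneg (Ψ : ℝ → ℝ) (h : m ≤ N) (t : Fin m → ℝ)
    (z : (Fin m → ℝ) × (Fin m → ℝ)) : 0 ≤ jetDensity Ψ h t z :=
  mul_nonneg (abs_nonneg _) (integral_nonneg fun _ => jointDensity_nonneg _ _)

variable {Ψ : ℝ → ℝ}

lemma continuous_jointDensity_comp (hΨ : IsAdmissible Ψ) (h : m ≤ N) (t : Fin m → ℝ)
    (L : ((Fin m → ℝ) × (Fin m → ℝ)) →L[ℝ] ((Fin m → ℝ) × (Fin m → ℝ)))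
    (z : (Fin m → ℝ) × (Fin m → ℝ)) :
    Continuous fun w => jointDensity Ψ (L (z - highJet h t w)) := by
  have hh : Continuous (highJet h t) := continuous_highJet_right h t
  have h1 : Continuous fun w => L (z - highJet h t w) := L.continuous.comp (continuous_const.sub hh)
  exact (continuous_jointDensity hΨ.continuous).comp h1

/-- Dominated convergence: the joint density of the low coefficients is continuous and bounded, and
inversion is continuous at units. Joint continuity in `t` also serves for measurability in the
Kac–Rice integrals. -/
lemma continuousOn_jetDensity (hΨ : IsAdmissible Ψ) (h : m ≤ N) {a b : ℝ}
    (hab : b - a < 2 * Real.pi * N) :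
    ContinuousOn (fun p : (Fin m → ℝ) × ((Fin m → ℝ) × (Fin m → ℝ)) => jetDensity Ψ h p.1 p.2)
      ((cube m (Set.Icc a b) \ diag m (Set.Icc a b)) ×ˢ Set.univ) := by
  have := hΨ.isProbabilityMeasure
  obtain ⟨B, -, hB⟩ := hΨ.exists_density_le
  have hq := continuous_jointDensity hΨ.continuous (m := m)
  unfold jetDensity
  refine ContinuousOn.mul ?_ ?_
  · refine ContinuousOn.abs (ContinuousOn.inv₀ ?_ ?_)
    · exact (ContinuousLinearMap.continuous_det.comp
        ((continuous_lowJet h).comp continuous_fst)).continuousOn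
    · intro p hp
      obtain ⟨u, hu⟩ := exists_unit_lowJet h hab hp.1
      rw [← hu]
      exact (LinearEquiv.isUnit_det' (ContinuousLinearEquiv.unitsEquiv ℝ _ u).toLinearEquiv).ne_zero
  · refine continuousOn_of_dominated (bound := fun _ => B ^ m * B ^ m) (fun p _ => ?_)
      (fun p _ => Filter.Eventually.of_forall fun w => ?_) (integrable_const _)
      (Filter.Eventually.of_forall fun w => ?_)
    · exact (continuous_jointDensity_comp hΨ h p.1 _ p.2).aestronglyMeasurable
    · rw [Real.norm_eq_abs, abs_of_nonneg (jointDensity_nonneg _ _)]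
      exact jointDensity_le hB _
    · refine hq.comp_continuousOn (ContinuousOn.clm_apply ?_ ?_)
      · intro p hp
        obtain ⟨u, hu⟩ := exists_unit_lowJet h hab hp.1
        have h1 := NormedRing.inverse_continuousAt u
        rw [hu] at h1
        exact (ContinuousAt.comp (f := fun p : (Fin m → ℝ) × ((Fin m → ℝ) × (Fin m → ℝ)) =>
          lowJet h p.1) h1
          ((continuous_lowJet h).comp continuous_fst).continuousAt).continuousWithinAt
      · exact (continuous_snd.sub ((continuous_highJet h).comp
          (continuous_fst.prodMk continuous_const))).continuousOn

lemma continuous_jetDensity (hΨ : IsAdmissible Ψ) (h : m ≤ N) {a b : ℝ}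
    (hab : b - a < 2 * Real.pi * N) {t : Fin m → ℝ}
    (ht : t ∈ cube m (Set.Icc a b) \ diag m (Set.Icc a b)) : Continuous (jetDensity Ψ h t) := by
  have h1 := continuousOn_jetDensity hΨ h hab
  have h2 : Continuous fun z : (Fin m → ℝ) × (Fin m → ℝ) => (t, z) :=
    continuous_const.prodMk continuous_id
  have h3 := ContinuousOn.comp_continuous (f := fun z : (Fin m → ℝ) × (Fin m → ℝ) => (t, z)) h1 h2
    fun z => ⟨ht, trivial⟩
  exact h3

lemma map_lowCoef (hΨ : IsAdmissible Ψ) (h : m ≤ N) :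
    (Measure.pi fun _ : Fin N ⊕ Fin N => coeffLaw Ψ).map (lowCoef h)
      = volume.withDensity fun v => ENNReal.ofReal (jointDensity Ψ v) := by
  have := hΨ.isProbabilityMeasure
  set π := Measure.pi fun _ : Fin N ⊕ Fin N => coeffLaw Ψ
  have h1 : iIndepFun (fun (j : Fin m ⊕ Fin m) (w : Fin N ⊕ Fin N → ℝ) => w (modeEmb h j)) π :=
    (iIndepFun_eval (μ := coeffLaw Ψ)).precomp (modeEmb h).injective
  have h2 : π.map (fun w j => w (modeEmb h j)) = Measure.pi fun _ : Fin m ⊕ Fin m => coeffLaw Ψ := by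
    rw [h1.map_fun_eq_pi_map fun j => (measurable_pi_apply _).aemeasurable]
    congr 1; ext1 j
    exact map_eval_pi (μ := coeffLaw Ψ) (modeEmb h j)
  have h3 := (measurePreserving_sumPiEquivProdPi fun _ : Fin m ⊕ Fin m => coeffLaw Ψ).map_eq
  rw [prod_pi_coeffLaw_eq_withDensity hΨ] at h3
  rw [← h3, ← h2, Measure.map_map (MeasurableEquiv.measurable _) (by fun_prop)]
  rfl

lemma indepFun_lowCoef_highJet (hΨ : IsAdmissible Ψ) (h : m ≤ N) (t : Fin m → ℝ) :
    IndepFun (lowCoef h) (highJet h t) (Measure.pi fun _ : Fin N ⊕ Fin N => coeffLaw Ψ) := by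
  have := hΨ.isProbabilityMeasure
  set S : Finset (Fin N ⊕ Fin N) := Finset.univ.map (modeEmb h) with hS
  have hmem : ∀ j, modeEmb h j ∈ S := fun j => Finset.mem_map_of_mem _ (Finset.mem_univ j)
  have h0 := (iIndepFun_eval (ι := Fin N ⊕ Fin N) (μ := coeffLaw Ψ)).indepFun_finset S Sᶜ
    disjoint_compl_right (fun j => measurable_pi_apply j)
  have hφ : Measurable fun v : S → ℝ =>
      ((fun n : Fin m => v ⟨_, hmem (Sum.inl n)⟩, fun n : Fin m => v ⟨_, hmem (Sum.inr n)⟩) :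
        (Fin m → ℝ) × (Fin m → ℝ)) := by fun_prop
  have hψ : Measurable fun v : ↥Sᶜ → ℝ =>
      ((fun i => ∑ j, wt N 0 (t i) j.1 * v j, fun i => ∑ j, wt N 1 (t i) j.1 * v j) :
        (Fin m → ℝ) × (Fin m → ℝ)) := by fun_prop
  have h1 := h0.comp hφ hψ
  have e : highJet h t = (fun v : ↥Sᶜ → ℝ =>
      ((fun i => ∑ j, wt N 0 (t i) j.1 * v j, fun i => ∑ j, wt N 1 (t i) j.1 * v j) :
        (Fin m → ℝ) × (Fin m → ℝ))) ∘ fun w j => w j := by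
    ext w i
    · exact (Finset.sum_coe_sort Sᶜ fun j => wt N 0 (t i) j * w j).symm
    · exact (Finset.sum_coe_sort Sᶜ fun j => wt N 1 (t i) j * w j).symm
  rw [e]
  exact h1

/-- The jet vector is the invertible low-mode part plus the independent high-mode part, so the
affine density formula applies. -/
lemma isContinuousDensity_jetDensity (hΨ : IsAdmissible Ψ) (h : m ≤ N) {a b : ℝ}
    (hab : b - a < 2 * Real.pi * N) {t : Fin m → ℝ}
    (ht : t ∈ cube m (Set.Icc a b) \ diag m (Set.Icc a b)) :
    IsContinuousDensity ((Measure.pi fun _ : Fin N ⊕ Fin N => coeffLaw Ψ).map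
      fun w => jetVector (field w 0) t) (jetDensity Ψ h t) := by
  have := hΨ.isProbabilityMeasure
  set π := Measure.pi fun _ : Fin N ⊕ Fin N => coeffLaw Ψ with hπ
  refine ⟨continuous_jetDensity hΨ h hab ht, jetDensity_nonneg Ψ h t, ?_⟩
  · obtain ⟨u, hu⟩ := exists_unit_lowJet h hab ht
    set T := ContinuousLinearEquiv.unitsEquiv ℝ _ u with hT
    have hq := continuous_jointDensity hΨ.continuous (m := m)
    have hTv : ∀ v, T v = lowJet h t v := fun v => by rw [← hu]; rfl
    have hTs : ∀ v, T.symm v = Ring.inverse (lowJet h t) v := fun v => by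
      rw [← hu, Ring.inverse_unit]; rfl
    have hhm : Measurable (highJet h t) :=
      (continuous_highJet_right h t).measurable
    have hlm : Measurable (lowCoef h) := by unfold lowCoef; fun_prop
    have : (volume : Measure ((Fin m → ℝ) × (Fin m → ℝ))).IsAddHaarMeasure :=
      Measure.prod.instIsAddHaarMeasure volume volume
    have key := map_affine_eq_withDensity hlm hhm (indepFun_lowCoef_highJet hΨ h t)
      (by fun_prop) (map_lowCoef hΨ h) T
    have e1 : (fun w => jetVector (field w 0) t) = fun w => T (lowCoef h w) + highJet h t w := by
      ext1 w; rw [jetVector_field h, hTv]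
    rw [e1, key]
    congr 1
    ext1 z
    have hdet : LinearMap.det ((T : _ ≃L[ℝ] _) : ((Fin m → ℝ) × (Fin m → ℝ)) →ₗ[ℝ] _)
        = (lowJet h t).det := by
      rw [← hu]; rfl
    obtain ⟨B, -, hB⟩ := hΨ.exists_density_le
    have hcont : Continuous fun w => jointDensity Ψ (Ring.inverse (lowJet h t) (z - highJet h t w)) :=
      continuous_jointDensity_comp hΨ h t _ z
    rw [lintegral_const_mul' _ _ ENNReal.ofReal_ne_top, hdet, jetDensity,
      ENNReal.ofReal_mul (abs_nonneg _), ofReal_integral_eq_lintegral_ofReal]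
    · simp_rw [hTs]
    · refine Integrable.of_bound hcont.aestronglyMeasurable (B ^ m * B ^ m)
        (Filter.Eventually.of_forall fun w => ?_)
      rw [Real.norm_eq_abs, abs_of_nonneg (jointDensity_nonneg _ _)]
      exact jointDensity_le hB _
    · exact Filter.Eventually.of_forall fun w => jointDensity_nonneg _ _

end JetDensity

end RandomTrig

namespace RandomTrig

/-! ### Probability estimates uniform in the degree. -/

section Uniform

/-- The law of the coefficients of a random trigonometric polynomial of degree `N`. -/
noncomputable def fieldLaw (Ψ : ℝ → ℝ) (N : ℕ) : Measure (Fin N ⊕ Fin N → ℝ) :=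
  Measure.pi fun _ => coeffLaw Ψ

variable {Ψ : ℝ → ℝ} {N : ℕ}

lemma IsAdmissible.isProbabilityMeasure_fieldLaw (hΨ : IsAdmissible Ψ) (N : ℕ) :
    IsProbabilityMeasure (fieldLaw Ψ N) := by
  have := hΨ.isProbabilityMeasure
  unfold fieldLaw; infer_instance

lemma scoreNorm_nonneg (Ψ : ℝ → ℝ) : 0 ≤ scoreNorm Ψ := Real.sqrt_nonneg _

lemma measure_abs_field_le (hΨ : IsAdmissible Ψ) (hN : 0 < N) (t : ℝ) {r : ℝ} (hr : 0 < r) :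
    fieldLaw Ψ N {w | |field w 0 t| ≤ r} ≤ ENNReal.ofReal (Real.pi * scoreNorm Ψ * r) := by
  have := hΨ.isProbabilityMeasure_fieldLaw N
  rw [ENNReal.le_ofReal_iff_toReal_le (measure_ne_top _ _)
    (by have := scoreNorm_nonneg Ψ; have := Real.pi_pos; positivity)]
  exact hΨ.measure_abs_sum_le (wt N 0 t) (sum_wt_zero_sq hN t) hr

lemma lintegral_field_sq_le (hΨ : IsAdmissible Ψ) (k : ℕ) (t : ℝ) :
    ∫⁻ w, ENNReal.ofReal (field w k t ^ 2) ∂(fieldLaw Ψ N) ≤ 1 := by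
  have := hΨ.isProbabilityMeasure
  have hL : MemLp (fun w : Fin N ⊕ Fin N → ℝ => field w k t) 2 (fieldLaw Ψ N) :=
    memLp_sum_pi (wt N k t) hΨ.memLp_two
  rw [← ofReal_integral_eq_lintegral_ofReal hL.integrable_sq
    (Filter.Eventually.of_forall fun w => sq_nonneg _)]
  have h := integral_sum_sq_pi (wt N k t) measurable_id hΨ.memLp_two hΨ.mean
  simp only [id] at h
  rw [hΨ.variance, mul_one] at h
  unfold fieldLaw field
  rw [h]
  exact ENNReal.ofReal_le_one.2 (sum_wt_sq_le_one k t)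

/-- Markov's inequality for the Sobolev majorant `S`, a measurable functional whose mean is at most
`1 + 2 (b - a)`. -/
lemma measure_exists_lt_abs_field_le (hΨ : IsAdmissible Ψ) (k : ℕ) {a b : ℝ} (hab : a ≤ b) {M : ℝ}
    (hM : 0 < M) : fieldLaw Ψ N {w | ∃ t ∈ Set.Icc a b, M < |field w k t|}
      ≤ ENNReal.ofReal ((1 + 2 * (b - a)) / M ^ 2) := by
  have := hΨ.isProbabilityMeasure_fieldLaw N
  have hm : ∀ j, Measurable fun p : (Fin N ⊕ Fin N → ℝ) × ℝ => field p.1 j p.2 :=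
    fun j => (continuous_field_uncurry j).measurable
  have hmt : ∀ j t, Measurable fun w : Fin N ⊕ Fin N → ℝ => field w j t :=
    fun j t => (continuous_field_left j t).measurable
  set S : (Fin N ⊕ Fin N → ℝ) → ℝ≥0∞ := fun w => ENNReal.ofReal (field w k a ^ 2)
    + ∫⁻ s in Set.Icc a b, (ENNReal.ofReal (field w k s ^ 2)
      + ENNReal.ofReal (field w (k + 1) s ^ 2)) with hS
  have hjm : Measurable fun p : (Fin N ⊕ Fin N → ℝ) × ℝ => ENNReal.ofReal (field p.1 k p.2 ^ 2)
      + ENNReal.ofReal (field p.1 (k + 1) p.2 ^ 2) :=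
    ((hm k).pow_const 2).ennreal_ofReal.add ((hm (k + 1)).pow_const 2).ennreal_ofReal
  have hSm : Measurable S :=
    ((hmt k a).pow_const 2).ennreal_ofReal.add hjm.lintegral_prod_right'
  have hsub : {w : Fin N ⊕ Fin N → ℝ | ∃ t ∈ Set.Icc a b, M < |field w k t|}
      ⊆ {w | ENNReal.ofReal (M ^ 2) ≤ S w} := by
    rintro w ⟨t, ht, hMt⟩
    have h1 := sq_le_sobolev (hasDerivAt_field w k) (continuous_field w (k + 1)) ht
    have hc : Continuous fun s => field w k s ^ 2 + field w (k + 1) s ^ 2 :=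
      ((continuous_field w k).pow 2).add ((continuous_field w (k + 1)).pow 2)
    have h2 : S w = ENNReal.ofReal (field w k a ^ 2
        + ∫ s in Set.Icc a b, (field w k s ^ 2 + field w (k + 1) s ^ 2)) := by
      rw [ENNReal.ofReal_add (sq_nonneg _) (integral_nonneg fun s => by positivity),
        ofReal_integral_eq_lintegral_ofReal hc.continuousOn.integrableOn_Icc
          (Filter.Eventually.of_forall fun s => by positivity)]
      simp only [hS, ENNReal.ofReal_add (sq_nonneg _) (sq_nonneg _)]
    simp only [Set.mem_ofPred_eq, h2]
    refine ENNReal.ofReal_le_ofReal (le_trans ?_ h1)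
    rw [← sq_abs (field w k t)]
    gcongr
  have hE : ∫⁻ w, S w ∂(fieldLaw Ψ N) ≤ ENNReal.ofReal (1 + 2 * (b - a)) := by
    calc ∫⁻ w, S w ∂(fieldLaw Ψ N)
        = ∫⁻ w, ENNReal.ofReal (field w k a ^ 2) ∂(fieldLaw Ψ N)
          + ∫⁻ s in Set.Icc a b, ∫⁻ w, (ENNReal.ofReal (field w k s ^ 2)
            + ENNReal.ofReal (field w (k + 1) s ^ 2)) ∂(fieldLaw Ψ N) := by
          rw [lintegral_add_left ((hmt k a).pow_const 2).ennreal_ofReal,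
            lintegral_lintegral_swap hjm.aemeasurable]
      _ ≤ 1 + ∫⁻ s in Set.Icc a b, 2 := by
          refine add_le_add (lintegral_field_sq_le hΨ k a) (lintegral_mono fun s => ?_)
          rw [lintegral_add_left ((hmt k s).pow_const 2).ennreal_ofReal,
            ← one_add_one_eq_two (R := ℝ≥0∞)]
          exact add_le_add (lintegral_field_sq_le hΨ k s) (lintegral_field_sq_le hΨ (k + 1) s)
      _ = _ := by
          rw [setLIntegral_const, Real.volume_Icc, ENNReal.ofReal_add zero_le_one (by linarith),
            ENNReal.ofReal_mul zero_le_two]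
          simp
  calc _ ≤ fieldLaw Ψ N {w | ENNReal.ofReal (M ^ 2) ≤ S w} := measure_mono hsub
    _ ≤ (∫⁻ w, S w ∂(fieldLaw Ψ N)) / ENNReal.ofReal (M ^ 2) :=
        meas_ge_le_lintegral_div hSm.aemeasurable (by simp; positivity) ENNReal.ofReal_ne_top
    _ ≤ ENNReal.ofReal (1 + 2 * (b - a)) / ENNReal.ofReal (M ^ 2) := by gcongr
    _ = _ := (ENNReal.ofReal_div_of_pos (by positivity)).symm

/-- The coefficients for which a zero of the field is `ε`-close to a zero of its derivative. -/
def closeZeros (N : ℕ) (a b ε : ℝ) : Set (Fin N ⊕ Fin N → ℝ) :=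
  {w | ∃ s ∈ Set.Icc a b, ∃ c ∈ Set.Icc a b, |s - c| ≤ ε ∧ field w 0 s = 0 ∧ field w 1 c = 0}

/-- With `ε = η³`, the event `sup |X''| > 1/η` has probability of order `η²`. Otherwise some point
of a grid of mesh `ε` has `|X| ≤ 2 ε² / η`. About `1/ε` points, each with probability of order `ε² /
η`, again give `ε / η = η²`. -/
lemma measure_closeZeros_le (hΨ : IsAdmissible Ψ) (hN : 0 < N) {a b : ℝ} (hab : a ≤ b) {η : ℝ}
    (hη : 0 < η) (hη1 : η ≤ 1) :
    fieldLaw Ψ N (closeZeros N a b (η ^ 3)) ≤ ENNReal.ofReal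
      ((1 + 2 * (b - a) + 2 * (Real.pi * scoreNorm Ψ) * (b - a + 1)) * η ^ 2) := by
  have := hΨ.isProbabilityMeasure_fieldLaw N
  set ε := η ^ 3 with hε
  have hε0 : 0 < ε := by positivity
  have hC0 : 0 ≤ Real.pi * scoreNorm Ψ := mul_nonneg Real.pi_pos.le (scoreNorm_nonneg Ψ)
  set n := ⌊(b - a) / ε⌋₊ with hn
  set τ : ℕ → ℝ := fun j => a + j * ε with hτ
  have hsub : closeZeros N a b ε ⊆ {w | ∃ t ∈ Set.Icc a b, 1 / η < |field w 2 t|}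
      ∪ ⋃ j ∈ Finset.range (n + 1), {w | |field w 0 (τ j)| ≤ 2 * ε ^ 2 * (1 / η)} := by
    rintro w ⟨s, hs, c, hc, hsc, hs0, hc0⟩
    by_cases hM : ∃ t ∈ Set.Icc a b, 1 / η < |field w 2 t|
    · exact Or.inl hM
    · right
      push Not at hM
      set j := ⌊(s - a) / ε⌋₊ with hj
      have h1 : (j : ℝ) * ε ≤ s - a := by
        rw [← le_div_iff₀ hε0]
        exact Nat.floor_le (div_nonneg (by linarith [hs.1]) hε0.le)
      have h2 : s - a ≤ (j + 1) * ε := by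
        rw [← div_le_iff₀ hε0]
        exact (Nat.lt_floor_add_one _).le
      have hjn : j ≤ n := Nat.floor_le_floor (by gcongr; exact hs.2)
      have hτI : τ j ∈ Set.Icc a b :=
        ⟨by simp only [hτ]; nlinarith [(Nat.cast_nonneg j : (0 : ℝ) ≤ j)],
          by simp only [hτ]; linarith [hs.2]⟩
      refine Set.mem_biUnion (x := j) (by simp; omega) ?_
      refine abs_le_of_close_zeros (hasDerivAt_field w 0) (hasDerivAt_field w 1) hM hs hc hτI hs0
        hc0 hsc ?_
      simp only [hτ]
      rw [abs_le]; constructor <;> nlinarith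
  have hgrid : ∀ j ∈ Finset.range (n + 1), fieldLaw Ψ N {w | |field w 0 (τ j)| ≤ 2 * ε ^ 2 * (1 / η)}
      ≤ ENNReal.ofReal (Real.pi * scoreNorm Ψ * (2 * ε ^ 2 * (1 / η))) := fun j _ =>
    measure_abs_field_le hΨ hN _ (by positivity)
  have hcount : ((n + 1 : ℕ) : ℝ) ≤ (b - a + 1) / ε := by
    have h1 : (n : ℝ) ≤ (b - a) / ε := Nat.floor_le (div_nonneg (by linarith) hε0.le)
    have h2 : 1 ≤ 1 / ε := by
      rw [le_div_iff₀ hε0, one_mul, hε]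
      exact pow_le_one₀ hη.le hη1
    push_cast
    rw [add_div]; linarith
  calc fieldLaw Ψ N (closeZeros N a b ε)
      ≤ fieldLaw Ψ N {w | ∃ t ∈ Set.Icc a b, 1 / η < |field w 2 t|}
        + ∑ j ∈ Finset.range (n + 1), fieldLaw Ψ N {w | |field w 0 (τ j)| ≤ 2 * ε ^ 2 * (1 / η)} :=
        (measure_mono hsub).trans ((measure_union_le _ _).trans
          (add_le_add le_rfl (measure_biUnion_finset_le _ _)))
    _ ≤ ENNReal.ofReal ((1 + 2 * (b - a)) / (1 / η) ^ 2)
        + ∑ j ∈ Finset.range (n + 1), ENNReal.ofReal (Real.pi * scoreNorm Ψ * (2 * ε ^ 2 * (1 / η))) :=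
        add_le_add (measure_exists_lt_abs_field_le hΨ 2 hab (by positivity))
          (Finset.sum_le_sum hgrid)
    _ = ENNReal.ofReal ((1 + 2 * (b - a)) / (1 / η) ^ 2
        + ((n + 1 : ℕ) : ℝ) * (Real.pi * scoreNorm Ψ * (2 * ε ^ 2 * (1 / η)))) := by
        rw [Finset.sum_const, Finset.card_range, nsmul_eq_mul, ENNReal.ofReal_add
          (div_nonneg (by linarith) (by positivity)) (by positivity), ENNReal.ofReal_mul
          (Nat.cast_nonneg _), ENNReal.ofReal_natCast]
    _ ≤ _ := by
        refine ENNReal.ofReal_le_ofReal ?_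
        calc _ ≤ (1 + 2 * (b - a)) / (1 / η) ^ 2
              + (b - a + 1) / ε * (Real.pi * scoreNorm Ψ * (2 * ε ^ 2 * (1 / η))) := by gcongr
          _ = _ := by
              rw [hε]; field_simp

/-- A double zero puts the coefficients in `closeZeros` at every scale, so its probability is at
most `C η²` for all small `η`. -/
lemma ae_nondegenerate (hΨ : IsAdmissible Ψ) (hN : 0 < N) {a b : ℝ} (hab : a ≤ b) :
    ∀ᵐ w ∂(fieldLaw Ψ N), ∀ t ∈ Set.Icc a b, field w 0 t = 0 → field w 1 t ≠ 0 := by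
  have := hΨ.isProbabilityMeasure_fieldLaw N
  rw [ae_iff]
  refine le_antisymm ?_ bot_le
  set C := 1 + 2 * (b - a) + 2 * (Real.pi * scoreNorm Ψ) * (b - a + 1)
  have hlim : Filter.Tendsto (fun η : ℝ => ENNReal.ofReal (C * η ^ 2)) (nhdsWithin 0 (Set.Ioi 0))
      (nhds 0) := by
    have : Filter.Tendsto (fun η : ℝ => ENNReal.ofReal (C * η ^ 2)) (nhds 0)
        (nhds (ENNReal.ofReal (C * 0 ^ 2))) := by
      refine ENNReal.tendsto_ofReal ?_
      exact (by fun_prop : Continuous fun η : ℝ => C * η ^ 2).tendsto 0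
    simp only [ne_eq, OfNat.ofNat_ne_zero, not_false_eq_true, zero_pow, mul_zero,
      ENNReal.ofReal_zero] at this
    exact this.mono_left nhdsWithin_le_nhds
  refine ge_of_tendsto hlim ?_
  filter_upwards [self_mem_nhdsWithin, mem_nhdsWithin_of_mem_nhds (Iic_mem_nhds zero_lt_one)]
    with η hη hη1
  refine (measure_mono fun w hw => ?_).trans (measure_closeZeros_le hΨ hN hab hη hη1)
  simp only [Set.mem_ofPred_eq] at hw
  push Not at hw
  obtain ⟨t, ht, h0, h1⟩ := hw
  have hη : 0 < η := hη
  exact ⟨t, ht, t, ht, by simp; positivity, h0, h1⟩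

lemma ae_field_ne_zero (hΨ : IsAdmissible Ψ) (hN : 0 < N) (t : ℝ) :
    ∀ᵐ w ∂(fieldLaw Ψ N), field w 0 t ≠ 0 := by
  rw [ae_iff]
  simp only [ne_eq, not_not]
  refine le_antisymm ?_ bot_le
  set C := Real.pi * scoreNorm Ψ
  have hlim : Filter.Tendsto (fun r : ℝ => ENNReal.ofReal (C * r)) (nhdsWithin 0 (Set.Ioi 0))
      (nhds 0) := by
    have : Filter.Tendsto (fun r : ℝ => ENNReal.ofReal (C * r)) (nhds 0)
        (nhds (ENNReal.ofReal (C * 0))) :=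
      ENNReal.tendsto_ofReal ((by fun_prop : Continuous fun r : ℝ => C * r).tendsto 0)
    rw [mul_zero, ENNReal.ofReal_zero] at this
    exact this.mono_left nhdsWithin_le_nhds
  refine ge_of_tendsto hlim ?_
  filter_upwards [self_mem_nhdsWithin] with r hr
  have hr : 0 < r := hr
  refine (measure_mono fun w hw => ?_).trans (measure_abs_field_le hΨ hN t hr)
  simp only [Set.mem_ofPred_eq] at hw ⊢
  rw [hw]; simpa using hr.le

/-- The coefficients for which the field has `k` zeros in one of `n` consecutive intervals of
length `1/2`. -/
def manyZeros (N : ℕ) (a : ℝ) (n k : ℕ) : Set (Fin N ⊕ Fin N → ℝ) :=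
  {w | ∃ j < n, ∃ s : Finset ℝ, s.card = k ∧
    ∀ x ∈ s, x ∈ Set.Icc (a + j * (1 / 2)) (a + j * (1 / 2) + 1 / 2) ∧ field w 0 x = 0}

/-- With `k` zeros in an interval of length `1/2`, the field at its left end is at most `2^{-k}`
times the supremum of the `k`-th derivative. -/
lemma measure_manyZeros_le (hΨ : IsAdmissible Ψ) (hN : 0 < N) (a : ℝ) (n k : ℕ) :
    fieldLaw Ψ N (manyZeros N a n k)
      ≤ ENNReal.ofReal (n * (2 + Real.pi * scoreNorm Ψ) * (16 / 25) ^ k) := by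
  have := hΨ.isProbabilityMeasure_fieldLaw N
  have hC0 : 0 ≤ Real.pi * scoreNorm Ψ := mul_nonneg Real.pi_pos.le (scoreNorm_nonneg Ψ)
  -- Any base between 1 and 2 makes both costs geometric. This one gives `2 M⁻² = 2 (16/25)^k` for a
  -- large derivative and `(5/8)^k ≤ (16/25)^k` for the small ball.
  set M : ℝ := (5 / 4) ^ k with hM
  have hM0 : 0 < M := by positivity
  set σ : ℕ → ℝ := fun j => a + j * (1 / 2) with hσ
  have hsub : manyZeros N a n k ⊆ ⋃ j ∈ Finset.range n,
      ({w | ∃ t ∈ Set.Icc (σ j) (σ j + 1 / 2), M < |field w k t|}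
        ∪ {w | |field w 0 (σ j)| ≤ (1 / 2) ^ k * M}) := by
    rintro w ⟨j, hj, s, hs, hsI⟩
    refine Set.mem_biUnion (x := j) (by simpa using hj) ?_
    by_cases hMt : ∃ t ∈ Set.Icc (σ j) (σ j + 1 / 2), M < |field w k t|
    · exact Or.inl hMt
    · right
      push Not at hMt
      exact abs_le_of_card_zeros (F := field w) (hasDerivAt_field w) hMt s hs
        (fun x hx => (hsI x hx).1) (fun x hx => (hsI x hx).2) ⟨le_rfl, by linarith⟩
  have hj : ∀ j, fieldLaw Ψ N ({w | ∃ t ∈ Set.Icc (σ j) (σ j + 1 / 2), M < |field w k t|}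
        ∪ {w | |field w 0 (σ j)| ≤ (1 / 2) ^ k * M})
      ≤ ENNReal.ofReal ((2 + Real.pi * scoreNorm Ψ) * (16 / 25) ^ k) := fun j => by
    refine (measure_union_le _ _).trans ((add_le_add
      (measure_exists_lt_abs_field_le hΨ k (by linarith) hM0)
      (measure_abs_field_le hΨ hN (σ j) (by positivity))).trans ?_)
    rw [← ENNReal.ofReal_add (by rw [add_sub_cancel_left]; positivity) (by positivity)]
    refine ENNReal.ofReal_le_ofReal ?_
    have e1 : (1 + 2 * (σ j + 1 / 2 - σ j)) / M ^ 2 = 2 * (16 / 25) ^ k := by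
      rw [hM, ← pow_mul, mul_comm k 2, pow_mul, add_sub_cancel_left, div_eq_mul_inv, ← inv_pow]
      norm_num
    have e2 : (1 / 2 : ℝ) ^ k * M ≤ (16 / 25) ^ k := by
      rw [hM, ← mul_pow]
      gcongr; norm_num
    rw [e1, add_mul]
    gcongr
  calc _ ≤ ∑ j ∈ Finset.range n, ENNReal.ofReal ((2 + Real.pi * scoreNorm Ψ) * (16 / 25) ^ k) :=
        (measure_mono hsub).trans ((measure_biUnion_finset_le _ _).trans
          (Finset.sum_le_sum fun j _ => hj j))
    _ = _ := by
        rw [Finset.sum_const, Finset.card_range, nsmul_eq_mul, mul_assoc,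
          ENNReal.ofReal_mul (Nat.cast_nonneg n), ENNReal.ofReal_natCast]

/-- Pigeonhole over the `n` intervals of length `1/2`, which cover `[a, b]` because `2 (b - a) < n`.
-/
lemma mem_manyZeros {w : Fin N ⊕ Fin N → ℝ} {a b : ℝ} {n : ℕ} (hn : 2 * (b - a) < n)
    {Z : Finset ℝ} (hZ : ∀ t ∈ Z, t ∈ Set.Icc a b ∧ field w 0 t = 0) (hab : a ≤ b) :
    w ∈ manyZeros N a n (Z.card / n) := by
  classical
  have hn0 : 0 < n := by
    have : (0 : ℝ) < n := by linarith
    exact_mod_cast this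
  have hfloor : ∀ x ∈ Z, ⌊2 * (x - a)⌋₊ ∈ Finset.range n := fun x hx => by
    rw [Finset.mem_range, Nat.floor_lt (by linarith [(hZ x hx).1.1])]
    linarith [(hZ x hx).1.2]
  obtain ⟨j, hj, hcard⟩ := Finset.exists_le_card_fiber_of_mul_le_card_of_maps_to
    (n := Z.card / n) hfloor ⟨0, by simpa using hn0⟩
    (by rw [Finset.card_range]; exact Nat.mul_div_le _ _)
  obtain ⟨s, hs, hsc⟩ := Finset.exists_subset_card_eq hcard
  refine ⟨j, Finset.mem_range.1 hj, s, hsc, fun x hx => ?_⟩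
  obtain ⟨hxZ, hxj⟩ := Finset.mem_filter.1 (hs hx)
  have h0 : 0 ≤ 2 * (x - a) := by linarith [(hZ x hxZ).1.1]
  have h1 := Nat.floor_le h0
  have h2 := (Nat.lt_floor_add_one (2 * (x - a))).le
  rw [hxj] at h1 h2
  exact ⟨⟨by linarith, by linarith⟩, (hZ x hxZ).2⟩

/-- All moments of the number of zeros are bounded, uniformly in the degree. -/
lemma exists_moment_bound (hΨ : IsAdmissible Ψ) {a b : ℝ} (hab : a ≤ b) (q : ℕ) :
    ∃ K : ℝ, 0 ≤ K ∧ ∀ N : ℕ, 0 < N → ∫⁻ w : Fin N ⊕ Fin N → ℝ,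
      ((zeroCount (field w 0) (Set.Icc a b) : ℕ) : ℝ≥0∞) ^ q ∂(fieldLaw Ψ N)
        ≤ ENNReal.ofReal K := by
  obtain ⟨n, hn⟩ := exists_nat_gt (2 * (b - a))
  have hn0 : 0 < n := by
    have : (0 : ℝ) < n := by linarith
    exact_mod_cast this
  set A : ℝ := n * (2 + Real.pi * scoreNorm Ψ) with hA
  have hA0 : 0 ≤ A := mul_nonneg (Nat.cast_nonneg n)
    (add_nonneg zero_le_two (mul_nonneg Real.pi_pos.le (scoreNorm_nonneg Ψ)))
  set u : ℕ → ℝ := fun k => ((n * (k + 1) : ℕ) : ℝ) ^ q * (A * (16 / 25) ^ k) with hu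
  have hu0 : ∀ k, 0 ≤ u k := fun k => by positivity
  have hus : Summable u := by
    have h1 := summable_pow_mul_geometric_of_norm_lt_one q (r := (16 / 25 : ℝ))
      (by rw [Real.norm_eq_abs, abs_of_pos] <;> norm_num)
    have h2 := ((summable_nat_add_iff 1).2 h1).mul_left ((n : ℝ) ^ q * A * (25 / 16))
    refine h2.congr fun k => ?_
    simp only [hu]
    push_cast
    rw [pow_succ, mul_pow]
    ring
  refine ⟨∑' k, u k, tsum_nonneg hu0, fun N hN => ?_⟩
  have := hΨ.isProbabilityMeasure_fieldLaw N
  -- Measurable hulls have the same measure, so measurability of the events themselves is never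
  -- needed.
  set T : ℕ → Set (Fin N ⊕ Fin N → ℝ) := fun k => toMeasurable (fieldLaw Ψ N) (manyZeros N a n k)
    with hT
  have hpt : ∀ w : Fin N ⊕ Fin N → ℝ,
      ((zeroCount (field w 0) (Set.Icc a b) : ℕ) : ℝ≥0∞) ^ q
        ≤ ∑' k, (T k).indicator (fun _ => ((n * (k + 1) : ℕ) : ℝ≥0∞) ^ q) w := fun w => by
    by_cases hfin : (zeroSet (field w 0) (Set.Icc a b)).Finite
    · set Z := hfin.toFinset
      have hcard : zeroCount (field w 0) (Set.Icc a b) = Z.card :=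
        Set.ncard_eq_toFinset_card _ hfin
      have hmem : w ∈ T (Z.card / n) := subset_toMeasurable _ _
        (mem_manyZeros hn (fun t ht => (hfin.mem_toFinset.1 ht)) hab)
      refine le_trans ?_ (ENNReal.le_tsum (Z.card / n))
      rw [Set.indicator_of_mem hmem, hcard]
      gcongr
      exact (Nat.lt_mul_div_succ Z.card hn0).le
    -- An infinite zero set has `ncard` equal to 0, so the bound holds here as well, the event for
    -- `k = 0` containing every `w`.
    · have hcard : zeroCount (field w 0) (Set.Icc a b) = 0 := Set.Infinite.ncard hfin
      have hmem : w ∈ T 0 := subset_toMeasurable _ _ ⟨0, hn0, ∅, rfl, by simp⟩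
      refine le_trans ?_ (ENNReal.le_tsum 0)
      rw [Set.indicator_of_mem hmem, hcard]
      gcongr
      exact Nat.zero_le _
  calc _ ≤ ∫⁻ w, ∑' k, (T k).indicator (fun _ => ((n * (k + 1) : ℕ) : ℝ≥0∞) ^ q) w
        ∂(fieldLaw Ψ N) := lintegral_mono hpt
    _ = ∑' k, ((n * (k + 1) : ℕ) : ℝ≥0∞) ^ q * fieldLaw Ψ N (manyZeros N a n k) := by
        rw [lintegral_tsum fun k =>
          (measurable_const.indicator (measurableSet_toMeasurable _ _)).aemeasurable]
        congr 1; ext k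
        rw [lintegral_indicator_const (measurableSet_toMeasurable _ _), measure_toMeasurable]
    _ ≤ ∑' k, ENNReal.ofReal (u k) := by
        refine ENNReal.tsum_le_tsum fun k => ?_
        simp only [hu]
        rw [ENNReal.ofReal_mul (by positivity), ENNReal.ofReal_pow (Nat.cast_nonneg _),
          ENNReal.ofReal_natCast]
        gcongr
        exact measure_manyZeros_le hΨ hN a n k
    _ = _ := (ENNReal.ofReal_tsum_of_nonneg hu0 hus).symm

end Uniform

end RandomTrig

namespace RandomTrig

open Filter Topology

/-! ### Test kernels: a cutoff in the derivatives and a box approximate identity in the values. -/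

section Kernel

/-- A continuous cutoff, equal to one on the ball of radius `R` and vanishing outside the ball of
radius `R + 1`. -/
noncomputable def cutoff {m : ℕ} (R : ℝ) (y : Fin m → ℝ) : ℝ := max 0 (min 1 (R + 1 - ‖y‖))

variable {m : ℕ}

lemma continuous_cutoff (R : ℝ) : Continuous (cutoff (m := m) R) := by unfold cutoff; fun_prop

lemma cutoff_nonneg (R : ℝ) (y : Fin m → ℝ) : 0 ≤ cutoff R y := le_max_left _ _

lemma cutoff_le_one (R : ℝ) (y : Fin m → ℝ) : cutoff R y ≤ 1 :=
  max_le zero_le_one (min_le_left _ _)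

lemma cutoff_mono {R R' : ℝ} (h : R ≤ R') (y : Fin m → ℝ) : cutoff R y ≤ cutoff R' y := by
  unfold cutoff; gcongr

lemma cutoff_eq_one {R : ℝ} {y : Fin m → ℝ} (h : ‖y‖ ≤ R) : cutoff R y = 1 := by
  unfold cutoff
  rw [min_eq_left (by linarith), max_eq_right zero_le_one]

lemma cutoff_eq_zero {R : ℝ} {y : Fin m → ℝ} (h : R + 1 ≤ ‖y‖) : cutoff R y = 0 := by
  unfold cutoff
  rw [max_eq_left]
  exact (min_le_right _ _).trans (by linarith)

lemma tendsto_cutoff (y : Fin m → ℝ) : Tendsto (fun R : ℕ => cutoff (R : ℝ) y) atTop (𝓝 1) := by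
  refine tendsto_const_nhds.congr' ?_
  obtain ⟨n, hn⟩ := exists_nat_ge ‖y‖
  filter_upwards [eventually_ge_atTop n] with R hR
  exact (cutoff_eq_one (hn.trans (by exact_mod_cast hR))).symm

/-- The product of the `|y_i|`, cut off. -/
noncomputable def cutProd (R : ℝ) (y : Fin m → ℝ) : ℝ := cutoff R y * ∏ i, |y i|

lemma continuous_cutProd (R : ℝ) : Continuous (cutProd (m := m) R) := by
  have := continuous_cutoff (m := m) R
  unfold cutProd; fun_prop

lemma cutProd_nonneg (R : ℝ) (y : Fin m → ℝ) : 0 ≤ cutProd R y :=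
  mul_nonneg (cutoff_nonneg R y) (Finset.prod_nonneg fun _ _ => abs_nonneg _)

lemma integrable_cutProd (R : ℝ) : Integrable (cutProd (m := m) R) := by
  refine (continuous_cutProd R).integrable_of_hasCompactSupport ?_
  refine HasCompactSupport.intro (isCompact_closedBall (0 : Fin m → ℝ) (R + 1)) fun y hy => ?_
  rw [cutProd, cutoff_eq_zero, zero_mul]
  rw [Metric.mem_closedBall, dist_zero_right, not_le] at hy
  exact hy.le

lemma exists_cutProd_le (R : ℝ) : ∃ C, 0 ≤ C ∧ ∀ y : Fin m → ℝ, cutProd R y ≤ C := by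
  have hc : HasCompactSupport (cutProd (m := m) R) := by
    refine HasCompactSupport.intro (isCompact_closedBall (0 : Fin m → ℝ) (R + 1)) fun y hy => ?_
    rw [cutProd, cutoff_eq_zero, zero_mul]
    rw [Metric.mem_closedBall, dist_zero_right, not_le] at hy
    exact hy.le
  obtain ⟨C, hC⟩ := hc.exists_bound_of_continuous (continuous_cutProd R)
  exact ⟨C, (norm_nonneg _).trans (hC 0), fun y => (le_abs_self _).trans (hC y)⟩

/-- The uniform density on the box of half-width `δ`. -/
noncomputable def boxKernel (δ : ℝ) (x : Fin m → ℝ) : ℝ := ∏ i, kd id (fun _ => 1) δ (x i)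

lemma kd_eq_mul (f f' : ℝ → ℝ) (δ t : ℝ) :
    kd f f' δ t = |f' t| * kd id (fun _ => 1) δ (f t) := by
  unfold kd
  simp only [id, abs_one]
  split_ifs <;> ring

lemma boxKernel_nonneg {δ : ℝ} (hδ : 0 < δ) (x : Fin m → ℝ) : 0 ≤ boxKernel δ x :=
  Finset.prod_nonneg fun _ _ => kd_nonneg hδ _

lemma measurable_boxKernel (δ : ℝ) : Measurable (boxKernel (m := m) δ) := by
  have : Measurable (kd id (fun _ => 1) δ) := measurable_kd measurable_id measurable_const
  unfold boxKernel
  fun_prop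

lemma boxKernel_le {δ : ℝ} (hδ : 0 < δ) (x : Fin m → ℝ) : boxKernel δ x ≤ (1 / (2 * δ)) ^ m := by
  calc boxKernel δ x ≤ ∏ _i : Fin m, 1 / (2 * δ) :=
        Finset.prod_le_prod (fun i _ => kd_nonneg hδ _)
          fun i _ => (kd_le hδ _).trans_eq (by rw [abs_one])
    _ = _ := by simp

lemma integrable_boxKernel {δ : ℝ} (hδ : 0 < δ) : Integrable (boxKernel (m := m) δ) ∧
    ∫ x : Fin m → ℝ, boxKernel δ x = 1 := by
  have h := integrable_box hδ
  have e : kd id (fun _ => 1) δ = fun x : ℝ => if |x| < δ then 1 / (2 * δ) else 0 := by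
    ext x; simp [kd]
  constructor
  · unfold boxKernel
    exact Integrable.fintype_prod (f := fun _ => kd id (fun _ => 1) δ) fun _ => by rw [e]; exact h.1
  · unfold boxKernel
    rw [volume_pi, integral_fintype_prod_eq_pow (kd id (fun _ => 1) δ), e, h.2, one_pow]

/-- The approximate identity property is the zero-counting limit applied to the identity function,
whose only zero is 0. -/
lemma tendsto_integral_boxKernel {Q : (Fin m → ℝ) → ℝ} (hQ : Continuous Q) :
    Tendsto (fun δ => ∫ x, Q x * boxKernel δ x) (𝓝[>] (0 : ℝ)) (𝓝 (Q 0)) := by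
  have h := tendsto_integral_prod_kd (m := m) (a := -1) (b := 1) (f := id) (f' := fun _ => 1)
    (fun x => hasDerivAt_id x) continuous_const (Z := {0})
    (fun t => by
      simp only [Finset.mem_singleton, Set.mem_Icc, id]
      constructor
      · rintro rfl; norm_num
      · exact fun h => h.2)
    (fun z hz => by rw [Finset.mem_singleton.1 hz]; norm_num) (fun _ _ => one_ne_zero) hQ
  have e : ∑ τ ∈ Fintype.piFinset (fun _ : Fin m => ({0} : Finset ℝ)), Q τ = Q 0 := by
    rw [Fintype.piFinset_singleton fun _ : Fin m => (0 : ℝ), Finset.sum_singleton]; rfl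
  rw [e] at h
  refine h.congr' ?_
  filter_upwards [mem_nhdsWithin_of_mem_nhds (Iio_mem_nhds zero_lt_one)] with δ hδ
  refine setIntegral_eq_integral_of_forall_compl_eq_zero
    (f := fun x : Fin m → ℝ => Q x * ∏ i, kd id (fun _ => 1) δ (x i)) fun x hx => ?_
  have : ∃ i, x i ∉ Set.Icc (-1 : ℝ) 1 := by
    by_contra hcon
    push Not at hcon
    exact hx hcon
  obtain ⟨i, hi⟩ := this
  rw [Finset.prod_eq_zero (Finset.mem_univ i), mul_zero]
  rw [kd, if_neg]
  intro hlt
  have hδ : δ < 1 := hδ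
  have hlt' := abs_lt.1 hlt
  simp only [id] at hlt'
  exact hi ⟨by linarith [hlt'.1], by linarith [hlt'.2]⟩

/-- The test function applied to the jet vector. -/
noncomputable def jetKernel (R δ : ℝ) (z : (Fin m → ℝ) × (Fin m → ℝ)) : ℝ :=
  cutProd R z.2 * boxKernel δ z.1

lemma measurable_jetKernel (R δ : ℝ) : Measurable (jetKernel (m := m) R δ) :=
  ((continuous_cutProd R).measurable.comp measurable_snd).mul
    ((measurable_boxKernel δ).comp measurable_fst)

lemma jetKernel_nonneg (R : ℝ) {δ : ℝ} (hδ : 0 < δ) (z : (Fin m → ℝ) × (Fin m → ℝ)) :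
    0 ≤ jetKernel R δ z := mul_nonneg (cutProd_nonneg _ _) (boxKernel_nonneg hδ _)

lemma exists_jetKernel_le (R : ℝ) {δ : ℝ} (hδ : 0 < δ) :
    ∃ C, ∀ z : (Fin m → ℝ) × (Fin m → ℝ), jetKernel R δ z ≤ C := by
  obtain ⟨C, hC0, hC⟩ := exists_cutProd_le (m := m) R
  exact ⟨C * (1 / (2 * δ)) ^ m, fun z =>
    mul_le_mul (hC _) (boxKernel_le hδ _) (boxKernel_nonneg hδ _) hC0⟩

lemma integrable_jetKernel (R : ℝ) {δ : ℝ} (hδ : 0 < δ) :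
    Integrable (jetKernel (m := m) R δ) ∧ ∫ z, jetKernel (m := m) R δ z = ∫ y, cutProd (m := m) R y := by
  have h1 := (integrable_boxKernel (m := m) hδ)
  have e : jetKernel (m := m) R δ = fun z => boxKernel δ z.1 * cutProd R z.2 := by
    ext z; rw [jetKernel, mul_comm]
  rw [e]
  constructor
  · exact h1.1.mul_prod (integrable_cutProd R)
  · rw [Measure.volume_eq_prod, integral_prod_mul, h1.2, one_mul]

/-- The box concentrates the first block at 0 while the cutoff keeps the second block integrable;
the first part supplies the domination in `t`. -/
lemma integral_jetKernel_mul {p : (Fin m → ℝ) × (Fin m → ℝ) → ℝ} (hp : Continuous p) {D : ℝ}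
    (hp0 : ∀ z, 0 ≤ p z) (hD : ∀ z, p z ≤ D) (R : ℝ) :
    (∀ δ > 0, |∫ z, jetKernel R δ z * p z| ≤ D * ∫ y, cutProd (m := m) R y) ∧
    Tendsto (fun δ => ∫ z, jetKernel R δ z * p z) (𝓝[>] (0 : ℝ))
      (𝓝 (∫ y, cutProd R y * p (0, y))) := by
  have hi : ∀ δ > 0, Integrable fun z => jetKernel R δ z * p z := fun δ hδ =>
    (integrable_jetKernel R hδ).1.mul_bdd hp.aestronglyMeasurable (c := D)
      (Eventually.of_forall fun z => by rw [Real.norm_eq_abs, abs_of_nonneg (hp0 z)]; exact hD z)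
  constructor
  · intro δ hδ
    rw [abs_of_nonneg (integral_nonneg fun z => mul_nonneg (jetKernel_nonneg R hδ z) (hp0 z)),
      ← (integrable_jetKernel R hδ).2, mul_comm, ← integral_mul_const]
    refine integral_mono (hi δ hδ) ((integrable_jetKernel R hδ).1.mul_const D) fun z => ?_
    exact mul_le_mul_of_nonneg_left (hD z) (jetKernel_nonneg R hδ z)
  · set Q : (Fin m → ℝ) → ℝ := fun x => ∫ y, cutProd R y * p (x, y) with hQ
    have hQc : Continuous Q := by
      refine continuous_of_dominated (bound := fun y => cutProd R y * D) (fun x => ?_)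
        (fun x => Eventually.of_forall fun y => ?_) ((integrable_cutProd R).mul_const D)
        (Eventually.of_forall fun y => ?_)
      · have h2 : Continuous fun y : Fin m → ℝ => p (x, y) :=
          hp.comp (continuous_const.prodMk continuous_id)
        exact ((continuous_cutProd R).mul h2).aestronglyMeasurable
      · rw [Real.norm_eq_abs, abs_of_nonneg (mul_nonneg (cutProd_nonneg _ _) (hp0 _))]
        exact mul_le_mul_of_nonneg_left (hD _) (cutProd_nonneg _ _)
      · have h2 : Continuous fun x : Fin m → ℝ => p (x, y) :=
          hp.comp (continuous_id.prodMk continuous_const)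
        exact continuous_const.mul h2
    refine (tendsto_integral_boxKernel hQc).congr' ?_
    filter_upwards [self_mem_nhdsWithin] with δ hδ
    have hiδ := hi δ hδ
    rw [Measure.volume_eq_prod] at hiδ ⊢
    rw [integral_prod _ hiδ]
    congr 1; ext x
    simp only [hQ, jetKernel]
    rw [← integral_mul_const]
    congr 1; ext y; ring

end Kernel

/-! ### Separated tuples form a compact set, on which the jet density is uniformly bounded. -/

section Compact

variable {m : ℕ}

lemma separated_eq (a b ε : ℝ) : cube m (Set.Icc a b) \ diagEnl m (Set.Icc a b) ε
    = cube m (Set.Icc a b) ∩ {t | ∀ i j, i ≠ j → ε ≤ |t i - t j|} := by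
  ext t
  constructor
  · rintro ⟨h1, h2⟩
    refine ⟨h1, fun i j hij => ?_⟩
    by_contra hlt
    exact h2 ⟨h1, i, j, hij, not_le.1 hlt⟩
  · rintro ⟨h1, h2⟩
    exact ⟨h1, fun ⟨_, i, j, hij, hlt⟩ => absurd (h2 i j hij) (not_le.2 hlt)⟩

lemma isCompact_separated (a b ε : ℝ) :
    IsCompact (cube m (Set.Icc a b) \ diagEnl m (Set.Icc a b) ε) := by
  rw [separated_eq]
  refine (isCompact_cube m a b).inter_right ?_
  simp only [Set.ofPred_forall]
  refine isClosed_iInter fun i => isClosed_iInter fun j => isClosed_iInter fun _ => ?_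
  exact isClosed_le continuous_const (by fun_prop)

lemma measurableSet_separated (a b ε : ℝ) :
    MeasurableSet (cube m (Set.Icc a b) \ diagEnl m (Set.Icc a b) ε) :=
  (isCompact_separated a b ε).isClosed.measurableSet

lemma separated_subset {a b ε : ℝ} (hε : 0 < ε) : cube m (Set.Icc a b) \ diagEnl m (Set.Icc a b) ε
    ⊆ cube m (Set.Icc a b) \ diag m (Set.Icc a b) := by
  rintro t ⟨h1, h2⟩
  refine ⟨h1, fun ⟨_, i, j, hij, h⟩ => h2 ⟨h1, i, j, hij, ?_⟩⟩
  rw [h, sub_self, abs_zero]; exact hε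

lemma exists_jetDensity_le {Ψ : ℝ → ℝ} (hΨ : IsAdmissible Ψ) {N : ℕ} (h : m ≤ N) {a b : ℝ}
    (hab : b - a < 2 * Real.pi * N) {ε : ℝ} (hε : 0 < ε) :
    ∃ D, 0 ≤ D ∧ ∀ t ∈ cube m (Set.Icc a b) \ diagEnl m (Set.Icc a b) ε, ∀ z,
      jetDensity Ψ h t z ≤ D := by
  have := hΨ.isProbabilityMeasure
  obtain ⟨B, hB0, hB⟩ := hΨ.exists_density_le
  have hc : ContinuousOn (fun t => ((lowJet h t).det)⁻¹)
      (cube m (Set.Icc a b) \ diagEnl m (Set.Icc a b) ε) := by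
    refine ContinuousOn.inv₀ ?_ fun t ht => ?_
    · exact (ContinuousLinearMap.continuous_det.comp (continuous_lowJet h)).continuousOn
    · obtain ⟨u, hu⟩ := exists_unit_lowJet h hab (separated_subset hε ht)
      rw [← hu]
      exact (LinearEquiv.isUnit_det' (ContinuousLinearEquiv.unitsEquiv ℝ _ u).toLinearEquiv).ne_zero
  obtain ⟨C, hC⟩ := (isCompact_separated a b ε).exists_bound_of_continuousOn hc
  refine ⟨|C| * (B ^ m * B ^ m), by positivity, fun t ht z => ?_⟩
  unfold jetDensity
  refine mul_le_mul ((hC t ht).trans (le_abs_self C)) ?_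
    (integral_nonneg fun _ => jointDensity_nonneg _ _) (abs_nonneg _)
  calc _ ≤ ∫ w : Fin N ⊕ Fin N → ℝ, B ^ m * B ^ m ∂(Measure.pi fun _ => coeffLaw Ψ) := by
        refine integral_mono_of_nonneg (Eventually.of_forall fun _ => jointDensity_nonneg _ _)
          (integrable_const _) (Eventually.of_forall fun w => jointDensity_le hB _)
    _ = _ := by simp

end Compact

end RandomTrig

namespace RandomTrig

open Filter Topology

/-! ### The Kac–Rice formula away from the diagonals. -/

section KacRice

open Classical in
/-- The zeros of the field in `[a, b]`, as a finite set (empty if there are infinitely many). -/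
noncomputable def zeroFinset {N : ℕ} (a b : ℝ) (w : Fin N ⊕ Fin N → ℝ) : Finset ℝ :=
  if h : (zeroSet (field w 0) (Set.Icc a b)).Finite then h.toFinset else ∅

/-- The sum of `g` over the `m`-tuples of zeros of the field. -/
noncomputable def tupleSum {N m : ℕ} (a b : ℝ) (w : Fin N ⊕ Fin N → ℝ) (g : (Fin m → ℝ) → ℝ) : ℝ :=
  ∑ τ ∈ Fintype.piFinset (fun _ : Fin m => zeroFinset a b w), g τ

variable {Ψ : ℝ → ℝ} {m N : ℕ} {a b : ℝ}

lemma mem_zeroFinset {w : Fin N ⊕ Fin N → ℝ} (hw : w ≠ 0) (hab : b - a < 2 * Real.pi * N) (t : ℝ) :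
    t ∈ zeroFinset a b w ↔ t ∈ Set.Icc a b ∧ field w 0 t = 0 := by
  have hfin : (zeroSet (field w 0) (Set.Icc a b)).Finite := by
    obtain ⟨s, -, hs⟩ := exists_finset_zeros_field hw 0 hab
    exact s.finite_toSet.subset fun t ht => (hs t).2 ht
  rw [zeroFinset, dif_pos hfin, Set.Finite.mem_toFinset]
  rfl

lemma ae_regular (hΨ : IsAdmissible Ψ) (hN : 0 < N) (hab : a ≤ b)
    (habN : b - a < 2 * Real.pi * N) :
    ∀ᵐ w ∂(fieldLaw Ψ N), w ≠ 0 ∧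
      (∀ t, t ∈ zeroFinset a b w ↔ t ∈ Set.Icc a b ∧ field w 0 t = 0) ∧
      (∀ z ∈ zeroFinset a b w, z ∈ Set.Ioo a b) ∧ ∀ z ∈ zeroFinset a b w, field w 1 z ≠ 0 := by
  filter_upwards [ae_nondegenerate hΨ hN hab, ae_field_ne_zero hΨ hN a, ae_field_ne_zero hΨ hN b]
    with w h1 ha hb
  have hw : w ≠ 0 := by
    rintro rfl
    exact ha (by simp [field])
  refine ⟨hw, mem_zeroFinset hw habN, fun z hz => ?_, fun z hz => ?_⟩
  · obtain ⟨hzI, hz0⟩ := (mem_zeroFinset hw habN z).1 hz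
    exact ⟨lt_of_le_of_ne hzI.1 fun e => ha (by rwa [e]),
      lt_of_le_of_ne hzI.2 fun e => hb (by rwa [← e])⟩
  · obtain ⟨hzI, hz0⟩ := (mem_zeroFinset hw habN z).1 hz
    exact h1 z hzI hz0

lemma measurable_field_uncurry (k : ℕ) :
    Measurable fun p : (Fin N ⊕ Fin N → ℝ) × ℝ => field p.1 k p.2 :=
  (continuous_field_uncurry k).measurable

lemma measurable_jetVector_field :
    Measurable fun p : (Fin N ⊕ Fin N → ℝ) × (Fin m → ℝ) => jetVector (field p.1 0) p.2 := by
  simp only [jetVector, deriv_field]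
  have h : ∀ k (i : Fin m), Measurable fun p : (Fin N ⊕ Fin N → ℝ) × (Fin m → ℝ) =>
      field p.1 k (p.2 i) := fun k i => by
    have hp : Measurable fun p : (Fin N ⊕ Fin N → ℝ) × (Fin m → ℝ) => (p.1, p.2 i) := by fun_prop
    have h1 := (measurable_field_uncurry (N := N) k).comp hp
    exact h1
  exact (measurable_pi_lambda _ fun i => h 0 i).prodMk (measurable_pi_lambda _ fun i => h 1 i)

/-- The approximation of the sum over tuples of zeros. -/
noncomputable def approxSum (a b R δ : ℝ) (g : (Fin m → ℝ) → ℝ) (w : Fin N ⊕ Fin N → ℝ) : ℝ :=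
  ∫ t in cube m (Set.Icc a b), g t * jetKernel R δ (jetVector (field w 0) t)

/-- The same integral seen in two ways: as a jet kernel it can be averaged with the jet density, as
a product of `kd` it converges to a sum over zeros for each fixed `w`. -/
lemma approxSum_eq (R δ : ℝ) (g : (Fin m → ℝ) → ℝ) (w : Fin N ⊕ Fin N → ℝ) :
    approxSum a b R δ g w = ∫ t in cube m (Set.Icc a b),
      (g t * cutoff R fun i => field w 1 (t i)) * ∏ i, kd (field w 0) (field w 1) δ (t i) := by
  unfold approxSum
  congr 1; ext t
  simp_rw [kd_eq_mul (field w 0), Finset.prod_mul_distrib]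
  simp only [jetKernel, cutProd, jetVector, deriv_field, boxKernel]
  ring

lemma stronglyMeasurable_approxSum (R δ : ℝ) {g : (Fin m → ℝ) → ℝ} (hg : Continuous g) :
    StronglyMeasurable (approxSum (N := N) a b R δ g) := by
  unfold approxSum
  refine StronglyMeasurable.integral_prod_right' (f := fun p : (Fin N ⊕ Fin N → ℝ) × (Fin m → ℝ) =>
    g p.2 * jetKernel R δ (jetVector (field p.1 0) p.2)) ?_
  exact ((hg.measurable.comp measurable_snd).mul
    ((measurable_jetKernel R δ).comp measurable_jetVector_field)).stronglyMeasurable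

lemma tendsto_approxSum (hΨ : IsAdmissible Ψ) (hN : 0 < N) (hab : a ≤ b)
    (habN : b - a < 2 * Real.pi * N) {g : (Fin m → ℝ) → ℝ} (hg : Continuous g) (R : ℝ) :
    ∀ᵐ w ∂(fieldLaw Ψ N), Tendsto (fun δ => approxSum a b R δ g w) (𝓝[>] (0 : ℝ))
      (𝓝 (tupleSum a b w fun t => g t * cutoff R fun i => field w 1 (t i))) := by
  filter_upwards [ae_regular hΨ hN hab habN] with w hw
  obtain ⟨-, h1, h2, h3⟩ := hw
  simp_rw [approxSum_eq]
  refine tendsto_integral_prod_kd (hasDerivAt_field w 0) (continuous_field w 1) h1 h2 h3 ?_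
  refine hg.mul ((continuous_cutoff R).comp ?_)
  have := continuous_field w 1
  fun_prop

/-- Measurability of sums over random zeros is inherited from the integral approximations, which are
measurable by Fubini. -/
lemma aestronglyMeasurable_tupleSum_cutoff (hΨ : IsAdmissible Ψ) (hN : 0 < N) (hab : a ≤ b)
    (habN : b - a < 2 * Real.pi * N) {g : (Fin m → ℝ) → ℝ} (hg : Continuous g) (R : ℝ) :
    AEStronglyMeasurable
      (fun w : Fin N ⊕ Fin N → ℝ => tupleSum a b w fun t => g t * cutoff R fun i => field w 1 (t i))
      (fieldLaw Ψ N) :=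
  aestronglyMeasurable_of_tendsto_ae (𝓝[>] (0 : ℝ))
    (fun δ => (stronglyMeasurable_approxSum R δ hg).aestronglyMeasurable)
    (tendsto_approxSum hΨ hN hab habN hg R)

lemma tendsto_tupleSum_cutoff (w : Fin N ⊕ Fin N → ℝ) (g : (Fin m → ℝ) → ℝ) :
    Tendsto (fun R : ℕ => tupleSum a b w fun t => g t * cutoff (R : ℝ) fun i => field w 1 (t i)) atTop
      (𝓝 (tupleSum a b w g)) := by
  unfold tupleSum
  refine tendsto_finsetSum _ fun τ _ => ?_
  simpa using (tendsto_cutoff fun i => field w 1 (τ i)).const_mul (g τ)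

lemma aestronglyMeasurable_tupleSum (hΨ : IsAdmissible Ψ) (hN : 0 < N) (hab : a ≤ b)
    (habN : b - a < 2 * Real.pi * N) {g : (Fin m → ℝ) → ℝ} (hg : Continuous g) :
    AEStronglyMeasurable (fun w : Fin N ⊕ Fin N → ℝ => tupleSum a b w g) (fieldLaw Ψ N) :=
  aestronglyMeasurable_of_tendsto_ae atTop
    (fun R : ℕ => aestronglyMeasurable_tupleSum_cutoff hΨ hN hab habN hg (R : ℝ))
    (Eventually.of_forall fun w => tendsto_tupleSum_cutoff w g)

/-- The derivative has at most `2N` zeros, so the approximations are bounded independently of `δ`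
and `w`. The bound grows with `N`, which is harmless because `N` is fixed in this limit. -/
lemma abs_approxSum_le {w : Fin N ⊕ Fin N → ℝ} (hw : w ≠ 0)
    (habN : b - a < 2 * Real.pi * N) {g : (Fin m → ℝ) → ℝ} (hg1 : ∀ t, |g t| ≤ 1) (R : ℝ)
    {δ : ℝ} (hδ : 0 < δ) : |approxSum a b R δ g w| ≤ 1 * (2 ^ (2 * N)) ^ m := by
  obtain ⟨s, hs, hs'⟩ := exists_finset_zeros_field hw 1 habN
  rw [approxSum_eq]
  refine (abs_integral_prod_kd_le (hasDerivAt_field w 0) (continuous_field w 1) hδ s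
    (fun x hx h0 => (hs' x).2 ⟨Set.Ioo_subset_Icc_self hx, h0⟩) (H := 1) (fun t _ => ?_)
    zero_le_one).trans ?_
  · rw [abs_mul, abs_of_nonneg (cutoff_nonneg _ _)]
    exact mul_le_one₀ (hg1 t) (cutoff_nonneg _ _) (cutoff_le_one _ _)
  · gcongr
    norm_num

lemma tendsto_integral_approxSum (hΨ : IsAdmissible Ψ) (hN : 0 < N) (hab : a ≤ b)
    (habN : b - a < 2 * Real.pi * N) {g : (Fin m → ℝ) → ℝ} (hg : Continuous g)
    (hg1 : ∀ t, |g t| ≤ 1) (R : ℝ) :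
    Tendsto (fun δ => ∫ w, approxSum a b R δ g w ∂(fieldLaw Ψ N)) (𝓝[>] (0 : ℝ))
      (𝓝 (∫ w, tupleSum a b w (fun t => g t * cutoff R fun i => field w 1 (t i))
        ∂(fieldLaw Ψ N))) := by
  have := hΨ.isProbabilityMeasure_fieldLaw N
  refine tendsto_integral_filter_of_dominated_convergence (fun _ => 1 * (2 ^ (2 * N)) ^ m)
    (Eventually.of_forall fun δ => (stronglyMeasurable_approxSum R δ hg).aestronglyMeasurable)
    ?_ (integrable_const _) (tendsto_approxSum hΨ hN hab habN hg R)
  filter_upwards [self_mem_nhdsWithin] with δ hδ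
  filter_upwards [ae_regular hΨ hN hab habN] with w hw
  exact abs_approxSum_le hw.1 habN hg1 R hδ

lemma integral_approxSum (hΨ : IsAdmissible Ψ) {g : (Fin m → ℝ) → ℝ} (hg : Continuous g)
    (hg1 : ∀ t, |g t| ≤ 1) (R : ℝ) {δ : ℝ} (hδ : 0 < δ) :
    ∫ w, approxSum a b R δ g w ∂(fieldLaw Ψ N)
      = ∫ t in cube m (Set.Icc a b), g t * ∫ w, jetKernel R δ (jetVector (field w 0) t)
        ∂(fieldLaw Ψ N) := by
  have := hΨ.isProbabilityMeasure_fieldLaw N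
  obtain ⟨C, hC⟩ := exists_jetKernel_le (m := m) R hδ
  have : IsFiniteMeasure (volume.restrict (cube m (Set.Icc a b))) :=
    ⟨by rw [Measure.restrict_apply_univ]; exact (isCompact_cube m a b).measure_lt_top⟩
  unfold approxSum
  rw [integral_integral_swap]
  · simp_rw [integral_const_mul]
  · refine Integrable.of_bound (C := 1 * C) ?_ (Eventually.of_forall fun p => ?_)
    · exact ((hg.measurable.comp measurable_snd).mul
        ((measurable_jetKernel R δ).comp measurable_jetVector_field)).aestronglyMeasurable
    · simp only [Function.uncurry]
      rw [Real.norm_eq_abs, abs_mul, abs_of_nonneg (jetKernel_nonneg R hδ _)]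
      exact mul_le_mul (hg1 _) (hC _) (jetKernel_nonneg R hδ _) zero_le_one

lemma integral_jetKernel_jetVector (hΨ : IsAdmissible Ψ) (h : m ≤ N)
    (habN : b - a < 2 * Real.pi * N) {t : Fin m → ℝ}
    (ht : t ∈ cube m (Set.Icc a b) \ diag m (Set.Icc a b)) (R δ : ℝ) :
    ∫ w, jetKernel R δ (jetVector (field w 0) t) ∂(fieldLaw Ψ N)
      = ∫ z, jetKernel R δ z * jetDensity Ψ h t z := by
  have hd := isContinuousDensity_jetDensity hΨ h habN ht
  have hm : Measurable fun w : Fin N ⊕ Fin N → ℝ => jetVector (field w 0) t := by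
    have hp : Measurable fun w : Fin N ⊕ Fin N → ℝ => (w, t) :=
      measurable_id.prodMk measurable_const
    have h0 := (measurable_jetVector_field (m := m) (N := N)).comp hp
    exact h0
  have h1 := integral_map (μ := fieldLaw Ψ N) hm.aemeasurable (f := jetKernel R δ)
    (measurable_jetKernel R δ).aestronglyMeasurable
  rw [← h1, fieldLaw, hd.eq_withDensity, integral_withDensity_eq_integral_toReal_smul
    hd.continuous.measurable.ennreal_ofReal (by simp)]
  congr 1; ext z
  rw [ENNReal.toReal_ofReal (hd.nonneg z), smul_eq_mul, mul_comm]

/-- The Kac–Rice formula with cutoffs, for test functions supported away from the diagonals. -/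
lemma kac_rice_cutoff (hΨ : IsAdmissible Ψ) (hN : 0 < N) (h : m ≤ N) (hab : a ≤ b)
    (habN : b - a < 2 * Real.pi * N) {g : (Fin m → ℝ) → ℝ} (hg : Continuous g)
    (hg0 : ∀ t, 0 ≤ g t) (hg1 : ∀ t, g t ≤ 1) {ε : ℝ} (hε : 0 < ε)
    (hgs : ∀ t ∈ cube m (Set.Icc a b), g t ≠ 0 → t ∉ diagEnl m (Set.Icc a b) ε) (R : ℝ) :
    ∫⁻ w, ENNReal.ofReal (tupleSum a b w fun t => g t * cutoff R fun i => field w 1 (t i))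
        ∂(fieldLaw Ψ N)
      = ∫⁻ t in cube m (Set.Icc a b), ∫⁻ y,
          ENNReal.ofReal (g t * (cutProd R y * jetDensity Ψ h t (0, y))) := by
  have := hΨ.isProbabilityMeasure_fieldLaw N
  obtain ⟨D, hD0, hD⟩ := exists_jetDensity_le hΨ h habN hε
  have hg1' : ∀ t, |g t| ≤ 1 := fun t => by rw [abs_of_nonneg (hg0 t)]; exact hg1 t
  have hfin : IsFiniteMeasure (volume.restrict (cube m (Set.Icc a b))) :=
    ⟨by rw [Measure.restrict_apply_univ]; exact (isCompact_cube m a b).measure_lt_top⟩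
  have hI0 : 0 ≤ ∫ y, cutProd (m := m) R y := integral_nonneg fun y => cutProd_nonneg R y
  set F : ℝ → (Fin m → ℝ) → ℝ := fun δ t =>
    g t * ∫ w, jetKernel R δ (jetVector (field w 0) t) ∂(fieldLaw Ψ N) with hF
  set F₀ : (Fin m → ℝ) → ℝ := fun t => g t * ∫ y, cutProd R y * jetDensity Ψ h t (0, y) with hF₀
  have hker : ∀ t ∈ cube m (Set.Icc a b), g t ≠ 0 →
      (∀ δ > 0, |∫ w, jetKernel R δ (jetVector (field w 0) t) ∂(fieldLaw Ψ N)|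
        ≤ D * ∫ y, cutProd (m := m) R y) ∧
      Tendsto (fun δ => ∫ w, jetKernel R δ (jetVector (field w 0) t) ∂(fieldLaw Ψ N))
        (𝓝[>] (0 : ℝ)) (𝓝 (∫ y, cutProd R y * jetDensity Ψ h t (0, y))) := fun t ht hgt => by
    have htK := (⟨ht, hgs t ht hgt⟩ : t ∈ cube m (Set.Icc a b) \ diagEnl m (Set.Icc a b) ε)
    have htd := separated_subset hε htK
    simp_rw [integral_jetKernel_jetVector hΨ h habN htd]
    exact integral_jetKernel_mul (continuous_jetDensity hΨ h habN htd) (jetDensity_nonneg Ψ h t)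
      (hD t htK) R
  have hFm : ∀ δ, AEStronglyMeasurable (F δ) (volume.restrict (cube m (Set.Icc a b))) := fun δ => by
    refine (hg.stronglyMeasurable.mul ?_).aestronglyMeasurable
    exact StronglyMeasurable.integral_prod_left' (f := fun p : (Fin N ⊕ Fin N → ℝ) × (Fin m → ℝ) =>
      jetKernel R δ (jetVector (field p.1 0) p.2))
      ((measurable_jetKernel R δ).comp measurable_jetVector_field).stronglyMeasurable
  have hFlim : ∀ᵐ t ∂(volume.restrict (cube m (Set.Icc a b))),
      Tendsto (fun δ => F δ t) (𝓝[>] (0 : ℝ)) (𝓝 (F₀ t)) := by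
    filter_upwards [ae_restrict_mem (measurableSet_cube m a b)] with t ht
    by_cases hgt : g t = 0
    · simp only [hF, hF₀, hgt, zero_mul]; exact tendsto_const_nhds
    · exact (hker t ht hgt).2.const_mul _
  have hFb : ∀ δ > 0, ∀ t ∈ cube m (Set.Icc a b), ‖F δ t‖ ≤ D * ∫ y, cutProd (m := m) R y :=
    fun δ hδ t ht => by
      by_cases hgt : g t = 0
      · simp only [hF, hgt, zero_mul, norm_zero]; positivity
      · rw [Real.norm_eq_abs, hF, abs_mul]
        refine (mul_le_mul (hg1' t) ((hker t ht hgt).1 δ hδ) (abs_nonneg _) zero_le_one).trans_eq ?_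
        rw [one_mul]
  have lim1 : Tendsto (fun δ => ∫ t in cube m (Set.Icc a b), F δ t) (𝓝[>] (0 : ℝ))
      (𝓝 (∫ t in cube m (Set.Icc a b), F₀ t)) := by
    refine tendsto_integral_filter_of_dominated_convergence (fun _ => D * ∫ y, cutProd (m := m) R y)
      (Eventually.of_forall hFm) ?_ (integrable_const _) hFlim
    filter_upwards [self_mem_nhdsWithin] with δ hδ
    filter_upwards [ae_restrict_mem (measurableSet_cube m a b)] with t ht using hFb δ hδ t ht
  have lim2 := tendsto_integral_approxSum hΨ hN hab habN hg hg1' R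
  -- Both sides are limits, as `δ → 0`, of quantities that agree for each `δ > 0` by Fubini.
  have heq : ∫ w, tupleSum a b w (fun t => g t * cutoff R fun i => field w 1 (t i)) ∂(fieldLaw Ψ N)
      = ∫ t in cube m (Set.Icc a b), F₀ t := by
    refine tendsto_nhds_unique (lim2.congr' ?_) lim1
    filter_upwards [self_mem_nhdsWithin] with δ hδ
    exact integral_approxSum hΨ hg hg1' R hδ
  have hts0 : ∀ w : Fin N ⊕ Fin N → ℝ,
      0 ≤ tupleSum a b w fun t => g t * cutoff R fun i => field w 1 (t i) := fun w =>
    Finset.sum_nonneg fun τ _ => mul_nonneg (hg0 _) (cutoff_nonneg _ _)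
  have htsi : Integrable (fun w : Fin N ⊕ Fin N → ℝ =>
      tupleSum a b w fun t => g t * cutoff R fun i => field w 1 (t i)) (fieldLaw Ψ N) := by
    refine Integrable.of_bound (aestronglyMeasurable_tupleSum_cutoff hΨ hN hab habN hg R)
      (1 * (2 ^ (2 * N)) ^ m) ?_
    filter_upwards [ae_regular hΨ hN hab habN, tendsto_approxSum hΨ hN hab habN hg R] with w hw hlim
    refine le_of_tendsto hlim.norm ?_
    filter_upwards [self_mem_nhdsWithin] with δ hδ
    exact abs_approxSum_le hw.1 habN hg1' R hδ
  have hF₀i : IntegrableOn F₀ (cube m (Set.Icc a b)) := by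
    refine Integrable.of_bound (aestronglyMeasurable_of_tendsto_ae (𝓝[>] (0 : ℝ)) hFm hFlim)
      (D * ∫ y, cutProd (m := m) R y) ?_
    filter_upwards [ae_restrict_mem (measurableSet_cube m a b), hFlim] with t ht hlim
    refine le_of_tendsto hlim.norm ?_
    filter_upwards [self_mem_nhdsWithin] with δ hδ using hFb δ hδ t ht
  have hF₀0 : ∀ t, 0 ≤ F₀ t := fun t => mul_nonneg (hg0 t)
    (integral_nonneg fun y => mul_nonneg (cutProd_nonneg _ _) (jetDensity_nonneg _ _ _ _))
  rw [← ofReal_integral_eq_lintegral_ofReal htsi (Eventually.of_forall hts0), heq,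
    ofReal_integral_eq_lintegral_ofReal hF₀i (Eventually.of_forall hF₀0)]
  refine setLIntegral_congr_fun (measurableSet_cube m a b) fun t ht => ?_
  simp only [hF₀]
  by_cases hgt : g t = 0
  · simp [hgt]
  · have htK := (⟨ht, hgs t ht hgt⟩ : t ∈ cube m (Set.Icc a b) \ diagEnl m (Set.Icc a b) ε)
    have hpc := continuous_jetDensity hΨ h habN (separated_subset hε htK)
    have hpc' : Continuous fun y : Fin m → ℝ => jetDensity Ψ h t (0, y) :=
      hpc.comp (continuous_const.prodMk continuous_id)
    have hi : Integrable fun y => cutProd R y * jetDensity Ψ h t (0, y) :=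
      (integrable_cutProd R).mul_bdd hpc'.aestronglyMeasurable (c := D) (Eventually.of_forall fun z => by
        rw [Real.norm_eq_abs, abs_of_nonneg (jetDensity_nonneg _ _ _ _)]; exact hD t htK _)
    rw [← integral_const_mul, ofReal_integral_eq_lintegral_ofReal (hi.const_mul _)
      (Eventually.of_forall fun y => mul_nonneg (hg0 t)
        (mul_nonneg (cutProd_nonneg _ _) (jetDensity_nonneg _ _ _ _)))]

/-- The Kac–Rice formula for test functions supported away from the diagonals. -/
lemma kac_rice (hΨ : IsAdmissible Ψ) (hN : 0 < N) (h : m ≤ N) (hab : a ≤ b)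
    (habN : b - a < 2 * Real.pi * N) {g : (Fin m → ℝ) → ℝ} (hg : Continuous g)
    (hg0 : ∀ t, 0 ≤ g t) (hg1 : ∀ t, g t ≤ 1) {ε : ℝ} (hε : 0 < ε)
    (hgs : ∀ t ∈ cube m (Set.Icc a b), g t ≠ 0 → t ∉ diagEnl m (Set.Icc a b) ε) :
    ∫⁻ w, ENNReal.ofReal (tupleSum a b w g) ∂(fieldLaw Ψ N)
      = ∫⁻ t in cube m (Set.Icc a b), ∫⁻ y,
          ENNReal.ofReal (g t * ((∏ i, |y i|) * jetDensity Ψ h t (0, y))) := by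
  -- The derivative cutoff is removed by monotone convergence on both sides, so integrability of the
  -- uncut product is not presupposed.
  set J : ℕ → (Fin m → ℝ) → ℝ≥0∞ := fun R t => ∫⁻ y,
    ENNReal.ofReal (g t * (cutProd (R : ℝ) y * jetDensity Ψ h t (0, y))) with hJ
  set J₀ : (Fin m → ℝ) → ℝ≥0∞ := fun t => ∫⁻ y,
    ENNReal.ofReal (g t * ((∏ i, |y i|) * jetDensity Ψ h t (0, y))) with hJ₀
  have hK : ∀ t ∈ cube m (Set.Icc a b), g t ≠ 0 →
      t ∈ cube m (Set.Icc a b) \ diagEnl m (Set.Icc a b) ε := fun t ht hgt => ⟨ht, hgs t ht hgt⟩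
  have hJmono : ∀ t, Monotone fun R => J R t := fun t R R' hRR' => by
    refine lintegral_mono fun y => ENNReal.ofReal_le_ofReal ?_
    refine mul_le_mul_of_nonneg_left (mul_le_mul_of_nonneg_right ?_ (jetDensity_nonneg _ _ _ _))
      (hg0 t)
    exact mul_le_mul_of_nonneg_right (cutoff_mono (by exact_mod_cast hRR') y)
      (Finset.prod_nonneg fun _ _ => abs_nonneg _)
  have hpt : ∀ t y, Tendsto (fun R : ℕ =>
      ENNReal.ofReal (g t * (cutProd (R : ℝ) y * jetDensity Ψ h t (0, y)))) atTop
      (𝓝 (ENNReal.ofReal (g t * ((∏ i, |y i|) * jetDensity Ψ h t (0, y))))) := fun t y => by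
    refine ENNReal.tendsto_ofReal (Tendsto.const_mul _ (Tendsto.mul_const _ ?_))
    simpa [cutProd] using (tendsto_cutoff y).mul_const (∏ i, |y i|)
  have hJlim : ∀ t ∈ cube m (Set.Icc a b), Tendsto (fun R => J R t) atTop (𝓝 (J₀ t)) :=
    fun t ht => by
      by_cases hgt : g t = 0
      · simp [hJ, hJ₀, hgt]
      · have hpc := continuous_jetDensity hΨ h habN (separated_subset hε (hK t ht hgt))
        have hpc' : Continuous fun y : Fin m → ℝ => jetDensity Ψ h t (0, y) :=
          hpc.comp (continuous_const.prodMk continuous_id)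
        refine lintegral_tendsto_of_tendsto_of_monotone (fun R => ?_)
          (Eventually.of_forall fun y R R' hRR' => ENNReal.ofReal_le_ofReal ?_)
          (Eventually.of_forall fun y => hpt t y)
        · exact (continuous_const.mul
            ((continuous_cutProd _).mul hpc')).measurable.ennreal_ofReal.aemeasurable
        · refine mul_le_mul_of_nonneg_left (mul_le_mul_of_nonneg_right ?_
            (jetDensity_nonneg _ _ _ _)) (hg0 t)
          exact mul_le_mul_of_nonneg_right (cutoff_mono (by exact_mod_cast hRR') y)
            (Finset.prod_nonneg fun _ _ => abs_nonneg _)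
  have hJm : ∀ R, AEMeasurable (J R) (volume.restrict (cube m (Set.Icc a b))) := fun R => by
    have hKm := measurableSet_separated (m := m) a b ε
    have hc : ContinuousOn (fun p : (Fin m → ℝ) × (Fin m → ℝ) =>
        ENNReal.ofReal (g p.1 * (cutProd (R : ℝ) p.2 * jetDensity Ψ h p.1 (0, p.2))))
        ((cube m (Set.Icc a b) \ diagEnl m (Set.Icc a b) ε) ×ˢ Set.univ) := by
      refine ENNReal.continuous_ofReal.comp_continuousOn ?_
      refine ((hg.comp continuous_fst).continuousOn).mul
        (((continuous_cutProd _).comp continuous_snd).continuousOn.mul ?_)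
      have h2 : Continuous fun p : (Fin m → ℝ) × (Fin m → ℝ) =>
          (p.1, ((0 : Fin m → ℝ), p.2)) :=
        continuous_fst.prodMk (continuous_const.prodMk continuous_snd)
      have hmaps : Set.MapsTo (fun p : (Fin m → ℝ) × (Fin m → ℝ) => (p.1, ((0 : Fin m → ℝ), p.2)))
          ((cube m (Set.Icc a b) \ diagEnl m (Set.Icc a b) ε) ×ˢ Set.univ)
          ((cube m (Set.Icc a b) \ diag m (Set.Icc a b)) ×ˢ Set.univ) :=
        fun p hp => ⟨separated_subset hε hp.1, trivial⟩
      have h3 := (continuousOn_jetDensity hΨ h habN).comp h2.continuousOn hmaps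
      exact h3
    have hm1 : AEMeasurable (fun p : (Fin m → ℝ) × (Fin m → ℝ) =>
        ENNReal.ofReal (g p.1 * (cutProd (R : ℝ) p.2 * jetDensity Ψ h p.1 (0, p.2))))
        ((volume.restrict (cube m (Set.Icc a b) \ diagEnl m (Set.Icc a b) ε)).prod volume) := by
      have := hc.aemeasurable (μ := (volume : Measure ((Fin m → ℝ) × (Fin m → ℝ))))
        (hKm.prod MeasurableSet.univ)
      rwa [Measure.volume_eq_prod, ← Measure.prod_restrict, Measure.restrict_univ] at this
    have hm2 : AEMeasurable (J R)
        (volume.restrict (cube m (Set.Icc a b) \ diagEnl m (Set.Icc a b) ε)) :=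
      hm1.lintegral_prod_right'
    rw [← aemeasurable_indicator_iff hKm] at hm2
    have e : (cube m (Set.Icc a b) \ diagEnl m (Set.Icc a b) ε).indicator (J R)
        =ᵐ[volume.restrict (cube m (Set.Icc a b))] J R := by
      filter_upwards [ae_restrict_mem (measurableSet_cube m a b)] with t ht
      by_cases hgt : g t = 0
      · simp [hJ, hgt]
      · rw [Set.indicator_of_mem (hK t ht hgt)]
    exact hm2.restrict.congr e
  have l1 : Tendsto (fun R : ℕ => ∫⁻ w, ENNReal.ofReal
      (tupleSum a b w fun t => g t * cutoff (R : ℝ) fun i => field w 1 (t i)) ∂(fieldLaw Ψ N)) atTop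
      (𝓝 (∫⁻ w, ENNReal.ofReal (tupleSum a b w g) ∂(fieldLaw Ψ N))) := by
    refine lintegral_tendsto_of_tendsto_of_monotone
      (fun R => (aestronglyMeasurable_tupleSum_cutoff hΨ hN hab habN hg _).aemeasurable.ennreal_ofReal)
      (Eventually.of_forall fun w R R' hRR' => ENNReal.ofReal_le_ofReal ?_)
      (Eventually.of_forall fun w => ENNReal.tendsto_ofReal (tendsto_tupleSum_cutoff w g))
    exact Finset.sum_le_sum fun τ _ =>
      mul_le_mul_of_nonneg_left (cutoff_mono (by exact_mod_cast hRR') _) (hg0 _)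
  have l2 : Tendsto (fun R : ℕ => ∫⁻ t in cube m (Set.Icc a b), J R t) atTop
      (𝓝 (∫⁻ t in cube m (Set.Icc a b), J₀ t)) := by
    refine lintegral_tendsto_of_tendsto_of_monotone hJm (Eventually.of_forall fun t => hJmono t) ?_
    filter_upwards [ae_restrict_mem (measurableSet_cube m a b)] with t ht using hJlim t ht
  exact tendsto_nhds_unique
    (l1.congr fun R => kac_rice_cutoff hΨ hN h hab habN hg hg0 hg1 hε hgs _) l2

end KacRice

end RandomTrig

namespace RandomTrig

open Filter Topology

/-! ### A continuous separator of tuples. -/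

section TestFunction

variable {m : ℕ}

/-- A continuous function of `t` that vanishes if two coordinates are `ε`-close and equals one if
all coordinates are `2ε`-separated. -/
noncomputable def separator (ε : ℝ) (t : Fin m → ℝ) : ℝ :=
  ∏ i, ∏ j, if i = j then 1 else min 1 (max 0 (|t i - t j| / ε - 1))

lemma continuous_separator (ε : ℝ) : Continuous (separator (m := m) ε) := by
  unfold separator
  refine continuous_finsetProd _ fun i _ => continuous_finsetProd _ fun j _ => ?_
  split_ifs
  · exact continuous_const
  · fun_prop

lemma separator_factor_mem (ε : ℝ) (t : Fin m → ℝ) (i j : Fin m) :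
    (if i = j then 1 else min 1 (max 0 (|t i - t j| / ε - 1))) ∈ Set.Icc (0 : ℝ) 1 := by
  split_ifs
  · exact ⟨zero_le_one, le_rfl⟩
  · exact ⟨le_min zero_le_one (le_max_left _ _), min_le_left _ _⟩

lemma separator_nonneg (ε : ℝ) (t : Fin m → ℝ) : 0 ≤ separator ε t :=
  Finset.prod_nonneg fun i _ => Finset.prod_nonneg fun j _ => (separator_factor_mem ε t i j).1

lemma separator_le_one (ε : ℝ) (t : Fin m → ℝ) : separator ε t ≤ 1 :=
  Finset.prod_le_one
    (fun i _ => Finset.prod_nonneg fun j _ => (separator_factor_mem ε t i j).1)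
    fun i _ => Finset.prod_le_one (fun j _ => (separator_factor_mem ε t i j).1)
      fun j _ => (separator_factor_mem ε t i j).2

lemma separator_eq_zero {ε : ℝ} (hε : 0 < ε) {t : Fin m → ℝ} {i j : Fin m} (hij : i ≠ j)
    (h : |t i - t j| < ε) : separator ε t = 0 := by
  refine Finset.prod_eq_zero (Finset.mem_univ i) (Finset.prod_eq_zero (Finset.mem_univ j) ?_)
  rw [if_neg hij, max_eq_left, min_eq_right zero_le_one]
  rw [sub_nonpos, div_le_one hε]; exact h.le

lemma separator_eq_one {ε : ℝ} (hε : 0 < ε) {t : Fin m → ℝ}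
    (h : ∀ i j, i ≠ j → 2 * ε ≤ |t i - t j|) : separator ε t = 1 := by
  refine Finset.prod_eq_one fun i _ => Finset.prod_eq_one fun j _ => ?_
  split_ifs with hij
  · rfl
  · have : 1 ≤ |t i - t j| / ε - 1 := by
      rw [le_sub_iff_add_le, le_div_iff₀ hε]; linarith [h i j hij]
    exact min_eq_left (this.trans (le_max_right _ _))

lemma notMem_diagEnl_of_separator_ne_zero {ε : ℝ} (hε : 0 < ε) {I : Set ℝ} {t : Fin m → ℝ}
    (h : separator ε t ≠ 0) : t ∉ diagEnl m I ε :=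
  fun ⟨_, _, _, hij, hlt⟩ => h (separator_eq_zero hε hij hlt)

end TestFunction

/-! ### Factorial moments as sums over injective tuples of zeros. -/

section Counting

variable {m N : ℕ} {a b : ℝ}

lemma zeroCount_eq_card (w : Fin N ⊕ Fin N → ℝ) :
    zeroCount (field w 0) (Set.Icc a b) = (zeroFinset a b w).card := by
  unfold zeroCount zeroFinset
  split_ifs with h
  · exact Set.ncard_eq_toFinset_card _ h
  · exact Set.Infinite.ncard h

open Classical in
lemma card_filter_injective (Z : Finset ℝ) :
    ((Fintype.piFinset fun _ : Fin m => Z).filter Function.Injective).card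
      = Z.card.descFactorial m := by
  have e : (Fintype.piFinset fun _ : Fin m => Z).filter Function.Injective
      = (Finset.univ : Finset (Fin m ↪ Z)).image fun f i => (f i : ℝ) := by
    ext τ
    simp only [Finset.mem_filter, Fintype.mem_piFinset, Finset.mem_image, Finset.mem_univ, true_and]
    constructor
    · rintro ⟨h1, h2⟩
      exact ⟨⟨fun i => ⟨τ i, h1 i⟩, fun i j hij => h2 (congrArg Subtype.val hij)⟩, rfl⟩
    · rintro ⟨f, rfl⟩
      exact ⟨fun i => (f i).2, fun i j hij => f.injective (Subtype.ext hij)⟩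
  rw [e, Finset.card_image_of_injective _ fun f f' hff' =>
    DFunLike.ext _ _ fun i => Subtype.ext (congrFun hff' i)]
  rw [Finset.card_univ, Fintype.card_embedding_eq]
  simp

open Classical in
lemma tupleSum_separator {ε : ℝ} (hε : 0 < ε) (w : Fin N ⊕ Fin N → ℝ) :
    tupleSum a b w (separator (m := m) ε) = ∑ τ ∈ (Fintype.piFinset fun _ : Fin m =>
      zeroFinset a b w).filter Function.Injective, separator ε τ := by
  unfold tupleSum
  refine (Finset.sum_filter_of_ne fun τ _ h => ?_).symm
  intro i j hij
  by_contra hne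
  exact h (separator_eq_zero hε hne (by rw [hij, sub_self, abs_zero]; exact hε))

lemma tupleSum_separator_le {ε : ℝ} (hε : 0 < ε) (w : Fin N ⊕ Fin N → ℝ) :
    tupleSum a b w (separator (m := m) ε)
      ≤ ((zeroCount (field w 0) (Set.Icc a b)).descFactorial m : ℝ) := by
  classical
  rw [tupleSum_separator hε, zeroCount_eq_card, ← card_filter_injective]
  refine (Finset.sum_le_sum fun τ _ => separator_le_one ε τ).trans ?_
  simp

/-- If two distinct zeros were closer than `2ε`, Rolle would give a critical point within `2ε` of a
zero. Outside that event the separator equals 1 on every injective tuple. -/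
lemma descFactorial_le_tupleSum {ε : ℝ} (hε : 0 < ε) {w : Fin N ⊕ Fin N → ℝ}
    (hz : ∀ t, t ∈ zeroFinset a b w ↔ t ∈ Set.Icc a b ∧ field w 0 t = 0)
    (hw : w ∉ closeZeros N a b (2 * ε)) :
    ((zeroCount (field w 0) (Set.Icc a b)).descFactorial m : ℝ)
      ≤ tupleSum a b w (separator (m := m) ε) := by
  classical
  rw [tupleSum_separator hε, zeroCount_eq_card, ← card_filter_injective]
  refine le_of_eq ?_
  rw [Finset.sum_congr rfl (g := fun _ => (1 : ℝ))]
  · simp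
  · intro τ hτ
    obtain ⟨hτZ, hτi⟩ := Finset.mem_filter.1 hτ
    rw [Fintype.mem_piFinset] at hτZ
    refine separator_eq_one hε fun i j hij => ?_
    by_contra hlt
    push Not at hlt
    obtain ⟨hiI, hi0⟩ := (hz _).1 (hτZ i)
    obtain ⟨hjI, hj0⟩ := (hz _).1 (hτZ j)
    obtain ⟨c, hc, hc0⟩ := exists_deriv_zero_of_close_zeros (hasDerivAt_field w 0)
      (hτi.ne hij) hi0 hj0
    refine hw ⟨τ i, hiI, c, Set.uIcc_subset_Icc hiI hjI hc, ?_, hi0, hc0⟩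
    have := Set.abs_sub_left_of_mem_uIcc hc
    rw [abs_sub_comm]
    rw [abs_sub_comm (τ j)] at this
    linarith

end Counting

/-! ### Comparison of the factorial moment with the Kac–Rice mass. -/

section Main

variable {Ψ : ℝ → ℝ} {m N : ℕ} {a b : ℝ}

/-- The count is the tuple sum of the constant 1 for `m = 1`, whose measurability is known. -/
lemma aemeasurable_zeroCount (hΨ : IsAdmissible Ψ) (hN : 0 < N) (hab : a ≤ b)
    (habN : b - a < 2 * Real.pi * N) :
    AEMeasurable (fun w : Fin N ⊕ Fin N → ℝ => zeroCount (field w 0) (Set.Icc a b))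
      (fieldLaw Ψ N) := by
  have h := (aestronglyMeasurable_tupleSum (m := 1) hΨ hN hab habN
    (continuous_const (y := (1 : ℝ)))).aemeasurable
  have e : (fun w : Fin N ⊕ Fin N → ℝ => zeroCount (field w 0) (Set.Icc a b))
      = fun w => ⌊tupleSum a b w fun _ : Fin 1 → ℝ => (1 : ℝ)⌋₊ := by
    ext w
    rw [zeroCount_eq_card, tupleSum]
    simp
  rw [e]
  exact Nat.measurable_floor.comp_aemeasurable h

/-- The mass of the Kac–Rice density off the `ε`-enlargement of the diagonals. -/
noncomputable def kacRiceMass (Ψ : ℝ → ℝ) (h : m ≤ N) (a b ε : ℝ) : ℝ≥0∞ :=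
  ∫⁻ t in cube m (Set.Icc a b) \ diagEnl m (Set.Icc a b) ε, ∫⁻ y,
    ENNReal.ofReal ((∏ i, |y i|) * jetDensity Ψ h t (0, y))

/-- The separator at scale `ε / 2` equals 1 on all `ε`-separated tuples, so the mass is dominated by
its Kac–Rice integral. -/
lemma kacRiceMass_le (hΨ : IsAdmissible Ψ) (hN : 0 < N) (h : m ≤ N) (hab : a ≤ b)
    (habN : b - a < 2 * Real.pi * N) {ε : ℝ} (hε : 0 < ε) :
    kacRiceMass Ψ h a b ε ≤ ∫⁻ w,
      ((zeroCount (field w 0) (Set.Icc a b)).descFactorial m : ℝ≥0∞) ∂(fieldLaw Ψ N) := by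
  have hε2 : 0 < ε / 2 := by positivity
  have key := kac_rice hΨ hN h hab habN (continuous_separator (m := m) (ε / 2))
    (separator_nonneg _) (separator_le_one _) hε2
    (fun t _ ht => notMem_diagEnl_of_separator_ne_zero hε2 ht)
  calc kacRiceMass Ψ h a b ε
      = ∫⁻ t in cube m (Set.Icc a b) \ diagEnl m (Set.Icc a b) ε, ∫⁻ y, ENNReal.ofReal
          (separator (ε / 2) t * ((∏ i, |y i|) * jetDensity Ψ h t (0, y))) := by
        refine setLIntegral_congr_fun (measurableSet_separated a b ε) fun t ht => ?_
        rw [separated_eq] at ht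
        simp only [separator_eq_one hε2 (t := t) fun i j hij => by linarith [ht.2 i j hij], one_mul]
    _ ≤ ∫⁻ t in cube m (Set.Icc a b), ∫⁻ y, ENNReal.ofReal
          (separator (ε / 2) t * ((∏ i, |y i|) * jetDensity Ψ h t (0, y))) :=
        lintegral_mono_set Set.sdiff_subset
    _ = _ := key.symm
    _ ≤ _ := by
        refine lintegral_mono fun w => ?_
        rw [← ENNReal.ofReal_natCast]
        exact ENNReal.ofReal_le_ofReal (tupleSum_separator_le hε2 w)

/-- At scale `ε` the separator is at most 1 and is supported on `ε`-separated tuples. -/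
lemma lintegral_tupleSum_separator_le (hΨ : IsAdmissible Ψ) (hN : 0 < N) (h : m ≤ N) (hab : a ≤ b)
    (habN : b - a < 2 * Real.pi * N) {ε : ℝ} (hε : 0 < ε) :
    ∫⁻ w, ENNReal.ofReal (tupleSum a b w (separator (m := m) ε)) ∂(fieldLaw Ψ N)
      ≤ kacRiceMass Ψ h a b ε := by
  rw [kac_rice hΨ hN h hab habN (continuous_separator (m := m) ε)
    (separator_nonneg _) (separator_le_one _) hε
    (fun t _ ht => notMem_diagEnl_of_separator_ne_zero hε ht), kacRiceMass,
    ← lintegral_indicator (measurableSet_separated a b ε), ← lintegral_indicator (measurableSet_cube m a b)]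
  refine lintegral_mono fun t => ?_
  by_cases ht : t ∈ cube m (Set.Icc a b)
  · rw [Set.indicator_of_mem ht]
    by_cases hs : separator ε t = 0
    · simp [hs]
    · rw [Set.indicator_of_mem (show t ∈ cube m (Set.Icc a b) \ diagEnl m (Set.Icc a b) ε from
        ⟨ht, notMem_diagEnl_of_separator_ne_zero hε hs⟩)]
      refine lintegral_mono fun y => ENNReal.ofReal_le_ofReal ?_
      exact mul_le_of_le_one_left (mul_nonneg (Finset.prod_nonneg fun _ _ => abs_nonneg _)
        (jetDensity_nonneg _ _ _ _)) (separator_le_one ε t)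
  · rw [Set.indicator_of_notMem ht]; exact bot_le

/-- Completing the square. On the bad event it separates the moment of the count from the
probability of the event, replacing Cauchy–Schwarz. -/
lemma pow_mul_le (z : ℝ≥0∞) (m : ℕ) {η : ℝ} (hη : 0 < η) (hz : z ≠ ∞) :
    z ^ m ≤ ENNReal.ofReal η * z ^ (2 * m) + ENNReal.ofReal η⁻¹ := by
  lift z to ℝ≥0 using hz
  lift η to ℝ≥0 using hη.le
  rw [← NNReal.coe_inv, ENNReal.ofReal_coe_nnreal, ENNReal.ofReal_coe_nnreal]
  norm_cast
  rw [← NNReal.coe_le_coe]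
  push_cast
  have h1 : (η : ℝ) * (η : ℝ)⁻¹ = 1 := mul_inv_cancel₀ hη.ne'
  have h2 : 0 < (η : ℝ)⁻¹ := inv_pos.2 hη
  rw [mul_comm 2 m, pow_mul]
  have h3 : 0 ≤ (η : ℝ)⁻¹ * (η * (z : ℝ) ^ m - 1 / 2) ^ 2 := by positivity
  have h4 : (η : ℝ)⁻¹ * (η * (z : ℝ) ^ m - 1 / 2) ^ 2
      = (η * (η : ℝ)⁻¹) * (η * ((z : ℝ) ^ m) ^ 2 - (z : ℝ) ^ m) + (η : ℝ)⁻¹ / 4 := by ring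
  rw [h4, h1] at h3
  linarith

/-- Uniformly in the degree, the factorial moment of the number of zeros exceeds the Kac–Rice mass
off the `ε`-enlargement of the diagonals by at most `C ε^{1/5}`. -/
lemma exists_factorial_moment_le (hΨ : IsAdmissible Ψ) (m : ℕ) (hab : a ≤ b) :
    ∃ C : ℝ, 0 ≤ C ∧ ∀ (N : ℕ) (_ : 0 < N) (h : m ≤ N) (_ : b - a < 2 * Real.pi * N),
      ∫⁻ w, ((zeroCount (field w 0) (Set.Icc a b)).descFactorial m : ℝ≥0∞) ∂(fieldLaw Ψ N)
        ≤ ENNReal.ofReal C ∧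
      ∀ ε > 0, ∫⁻ w, ((zeroCount (field w 0) (Set.Icc a b)).descFactorial m : ℝ≥0∞)
          ∂(fieldLaw Ψ N)
        ≤ kacRiceMass Ψ h a b ε + ENNReal.ofReal (C * ε ^ (1 / 5 : ℝ)) := by
  obtain ⟨K₁, hK₁, hm₁⟩ := exists_moment_bound hΨ hab m
  obtain ⟨K₂, hK₂, hm₂⟩ := exists_moment_bound hΨ hab (2 * m)
  set A : ℝ := 1 + 2 * (b - a) + 2 * (Real.pi * scoreNorm Ψ) * (b - a + 1) with hA
  have hA0 : 0 ≤ A := by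
    have h1 := mul_nonneg Real.pi_pos.le (scoreNorm_nonneg Ψ)
    have h2 : 0 ≤ b - a := by linarith
    positivity
  have hfac : ∀ n : ℕ, (n.descFactorial m : ℝ≥0∞) ≤ (n : ℝ≥0∞) ^ m := fun n => by
    exact_mod_cast Nat.descFactorial_le_pow n m
  refine ⟨(K₁ + K₂ + A) * 2, by positivity, fun N hN h habN => ?_⟩
  have := hΨ.isProbabilityMeasure_fieldLaw N
  have hbd : ∫⁻ w, ((zeroCount (field w 0) (Set.Icc a b)).descFactorial m : ℝ≥0∞) ∂(fieldLaw Ψ N)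
      ≤ ENNReal.ofReal K₁ := (lintegral_mono fun w => hfac _).trans (hm₁ N hN)
  refine ⟨hbd.trans (ENNReal.ofReal_le_ofReal (by linarith)), fun ε hε => ?_⟩
  have h2ε : (2 * ε) ^ (1 / 5 : ℝ) ≤ 2 * ε ^ (1 / 5 : ℝ) := by
    rw [Real.mul_rpow zero_le_two hε.le]
    gcongr
    exact Real.rpow_le_self_of_one_le one_le_two (by norm_num)
  -- For `ε ≥ 1/2` the target `C ε^{1/5}` already dominates the whole factorial moment.
  by_cases hε1 : 1 ≤ 2 * ε
  · refine hbd.trans (le_add_left (ENNReal.ofReal_le_ofReal ?_))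
    have h1 : 1 ≤ (2 * ε) ^ (1 / 5 : ℝ) := Real.one_le_rpow hε1 (by norm_num)
    calc K₁ = K₁ * 1 := (mul_one _).symm
      _ ≤ (K₁ + K₂ + A) * (2 * ε ^ (1 / 5 : ℝ)) :=
          mul_le_mul (by linarith) (h1.trans h2ε) zero_le_one (by positivity)
      _ = _ := by ring
  · push Not at hε1
    -- Chosen so that `η³ = 2ε` is the scale of `closeZeros`. The error is then `η K₂ + η⁻¹ A η²`,
    -- of order `ε^{1/3}`, which is weakened to `ε^{1/5}`.
    set η := (2 * ε) ^ (1 / 3 : ℝ) with hη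
    have hη0 : 0 < η := by positivity
    have hη1 : η ≤ 1 := Real.rpow_le_one (by positivity) hε1.le (by norm_num)
    have hη3 : η ^ 3 = 2 * ε := by
      rw [hη, ← Real.rpow_natCast, ← Real.rpow_mul (by positivity)]
      norm_num
    have hη5 : η ≤ (2 * ε) ^ (1 / 5 : ℝ) :=
      Real.rpow_le_rpow_of_exponent_ge (by positivity) hε1.le (by norm_num)
    set T := toMeasurable (fieldLaw Ψ N) (closeZeros N a b (2 * ε)) with hT
    have hPT : fieldLaw Ψ N T ≤ ENNReal.ofReal (A * η ^ 2) := by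
      rw [hT, measure_toMeasurable, ← hη3]
      exact measure_closeZeros_le hΨ hN hab hη0 hη1
    have hpt : ∀ᵐ w ∂(fieldLaw Ψ N),
        ((zeroCount (field w 0) (Set.Icc a b)).descFactorial m : ℝ≥0∞)
          ≤ ENNReal.ofReal (tupleSum a b w (separator (m := m) ε))
            + (ENNReal.ofReal η * ((zeroCount (field w 0) (Set.Icc a b) : ℕ) : ℝ≥0∞) ^ (2 * m)
              + T.indicator (fun _ => ENNReal.ofReal η⁻¹) w) := by
      filter_upwards [ae_regular hΨ hN hab habN] with w hw
      by_cases hwT : w ∈ T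
      · rw [Set.indicator_of_mem hwT]
        exact ((hfac _).trans (pow_mul_le _ m hη0 (ENNReal.natCast_ne_top _))).trans le_add_self
      · refine le_trans ?_ le_self_add
        rw [← ENNReal.ofReal_natCast]
        exact ENNReal.ofReal_le_ofReal (descFactorial_le_tupleSum hε hw.2.1
          fun hc => hwT (subset_toMeasurable _ _ hc))
    have hZm := aemeasurable_zeroCount hΨ hN hab habN
    have hZm' : AEMeasurable (fun w : Fin N ⊕ Fin N → ℝ =>
        ENNReal.ofReal η * ((zeroCount (field w 0) (Set.Icc a b) : ℕ) : ℝ≥0∞) ^ (2 * m))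
        (fieldLaw Ψ N) :=
      (measurable_from_nat (f := fun n : ℕ => ENNReal.ofReal η * (n : ℝ≥0∞) ^ (2 * m))).comp_aemeasurable
        hZm
    have hts : AEMeasurable (fun w : Fin N ⊕ Fin N → ℝ =>
        ENNReal.ofReal (tupleSum a b w (separator (m := m) ε))) (fieldLaw Ψ N) :=
      (aestronglyMeasurable_tupleSum hΨ hN hab habN
        (continuous_separator ε)).aemeasurable.ennreal_ofReal
    calc _ ≤ ∫⁻ w, (ENNReal.ofReal (tupleSum a b w (separator (m := m) ε))
            + (ENNReal.ofReal η * ((zeroCount (field w 0) (Set.Icc a b) : ℕ) : ℝ≥0∞) ^ (2 * m)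
              + T.indicator (fun _ => ENNReal.ofReal η⁻¹) w)) ∂(fieldLaw Ψ N) :=
          lintegral_mono_ae hpt
      _ = ∫⁻ w, ENNReal.ofReal (tupleSum a b w (separator (m := m) ε)) ∂(fieldLaw Ψ N)
          + (ENNReal.ofReal η * ∫⁻ w, ((zeroCount (field w 0) (Set.Icc a b) : ℕ) : ℝ≥0∞) ^ (2 * m)
              ∂(fieldLaw Ψ N) + ENNReal.ofReal η⁻¹ * fieldLaw Ψ N T) := by
          rw [lintegral_add_left' hts, lintegral_add_left' hZm',
            lintegral_const_mul' _ _ ENNReal.ofReal_ne_top,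
            lintegral_indicator_const (measurableSet_toMeasurable _ _)]
      _ ≤ kacRiceMass Ψ h a b ε + (ENNReal.ofReal η * ENNReal.ofReal K₂
            + ENNReal.ofReal η⁻¹ * ENNReal.ofReal (A * η ^ 2)) := by
          gcongr
          · exact lintegral_tupleSum_separator_le hΨ hN h hab habN hε
          · exact hm₂ N hN
      _ ≤ _ := by
          gcongr
          rw [← ENNReal.ofReal_mul hη0.le, ← ENNReal.ofReal_mul (inv_pos.2 hη0).le,
            ← ENNReal.ofReal_add (by positivity) (by positivity)]
          refine ENNReal.ofReal_le_ofReal ?_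
          have e : η * K₂ + η⁻¹ * (A * η ^ 2) = (K₂ + A) * η := by field_simp
          rw [e]
          calc (K₂ + A) * η ≤ (K₁ + K₂ + A) * (2 * ε ^ (1 / 5 : ℝ)) :=
                mul_le_mul (by linarith) (hη5.trans h2ε) hη0.le (by positivity)
            _ = _ := by ring

lemma integrable_descFactorial (hΨ : IsAdmissible Ψ) (hN : 0 < N) (hab : a ≤ b)
    (habN : b - a < 2 * Real.pi * N)
    (hfin : ∫⁻ w, ((zeroCount (field w 0) (Set.Icc a b)).descFactorial m : ℝ≥0∞) ∂(fieldLaw Ψ N)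
      ≠ ∞) :
    Integrable (fun w : Fin N ⊕ Fin N → ℝ =>
      ((zeroCount (field w 0) (Set.Icc a b)).descFactorial m : ℝ)) (fieldLaw Ψ N) ∧
    ENNReal.ofReal (∫ w : Fin N ⊕ Fin N → ℝ,
        ((zeroCount (field w 0) (Set.Icc a b)).descFactorial m : ℝ) ∂(fieldLaw Ψ N))
      = ∫⁻ w, ((zeroCount (field w 0) (Set.Icc a b)).descFactorial m : ℝ≥0∞) ∂(fieldLaw Ψ N) := by
  have hm : AEMeasurable (fun w : Fin N ⊕ Fin N → ℝ =>
      ((zeroCount (field w 0) (Set.Icc a b)).descFactorial m : ℝ)) (fieldLaw Ψ N) :=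
    (measurable_from_nat (f := fun n : ℕ => (n.descFactorial m : ℝ))).comp_aemeasurable
      (aemeasurable_zeroCount hΨ hN hab habN)
  have h0 : ∀ᵐ w : Fin N ⊕ Fin N → ℝ ∂(fieldLaw Ψ N),
      0 ≤ ((zeroCount (field w 0) (Set.Icc a b)).descFactorial m : ℝ) :=
    Eventually.of_forall fun w => Nat.cast_nonneg _
  have hi : Integrable (fun w : Fin N ⊕ Fin N → ℝ =>
      ((zeroCount (field w 0) (Set.Icc a b)).descFactorial m : ℝ)) (fieldLaw Ψ N) := by
    refine ⟨hm.aestronglyMeasurable, ?_⟩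
    rw [hasFiniteIntegral_iff_ofReal h0]
    simp only [ENNReal.ofReal_natCast]
    exact hfin.lt_top
  refine ⟨hi, ?_⟩
  rw [ofReal_integral_eq_lintegral_ofReal hi h0]
  simp only [ENNReal.ofReal_natCast]

lemma integrableOn_kacRice (hΨ : IsAdmissible Ψ) (h : m ≤ N)
    (habN : b - a < 2 * Real.pi * N) {ε : ℝ} (hε : 0 < ε) (hfin : kacRiceMass Ψ h a b ε ≠ ∞) :
    IntegrableOn (fun z : (Fin m → ℝ) × (Fin m → ℝ) => (∏ i, |z.2 i|) * jetDensity Ψ h z.1 (0, z.2))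
        ((cube m (Set.Icc a b) \ diagEnl m (Set.Icc a b) ε) ×ˢ Set.univ) ∧
    ENNReal.ofReal (∫ t in cube m (Set.Icc a b) \ diagEnl m (Set.Icc a b) ε,
        ∫ y : Fin m → ℝ, (∏ i, |y i|) * jetDensity Ψ h t (0, y)) = kacRiceMass Ψ h a b ε := by
  have hKm := measurableSet_separated (m := m) a b ε
  set f : (Fin m → ℝ) × (Fin m → ℝ) → ℝ := fun z => (∏ i, |z.2 i|) * jetDensity Ψ h z.1 (0, z.2)
    with hf
  have hf0 : ∀ z, 0 ≤ f z := fun z =>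
    mul_nonneg (Finset.prod_nonneg fun _ _ => abs_nonneg _) (jetDensity_nonneg _ _ _ _)
  have hc : ContinuousOn f ((cube m (Set.Icc a b) \ diagEnl m (Set.Icc a b) ε) ×ˢ Set.univ) := by
    have h1 : Continuous fun z : (Fin m → ℝ) × (Fin m → ℝ) => ∏ i, |z.2 i| := by fun_prop
    have h2 : Continuous fun p : (Fin m → ℝ) × (Fin m → ℝ) => (p.1, ((0 : Fin m → ℝ), p.2)) :=
      continuous_fst.prodMk (continuous_const.prodMk continuous_snd)
    have hmaps : Set.MapsTo (fun p : (Fin m → ℝ) × (Fin m → ℝ) => (p.1, ((0 : Fin m → ℝ), p.2)))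
        ((cube m (Set.Icc a b) \ diagEnl m (Set.Icc a b) ε) ×ˢ Set.univ)
        ((cube m (Set.Icc a b) \ diag m (Set.Icc a b)) ×ˢ Set.univ) :=
      fun p hp => ⟨separated_subset hε hp.1, trivial⟩
    have h3 := (continuousOn_jetDensity hΨ h habN).comp h2.continuousOn hmaps
    exact h1.continuousOn.mul h3
  have hm := hc.aestronglyMeasurable (μ := (volume : Measure ((Fin m → ℝ) × (Fin m → ℝ))))
    (hKm.prod MeasurableSet.univ)
  have hmass : ∫⁻ z in (cube m (Set.Icc a b) \ diagEnl m (Set.Icc a b) ε) ×ˢ Set.univ,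
      ENNReal.ofReal (f z) = kacRiceMass Ψ h a b ε := by
    have hm' := hm.aemeasurable.ennreal_ofReal
    rw [Measure.volume_eq_prod, ← Measure.prod_restrict, Measure.restrict_univ] at hm' ⊢
    rw [lintegral_prod _ hm']
    rfl
  have hi : IntegrableOn f ((cube m (Set.Icc a b) \ diagEnl m (Set.Icc a b) ε) ×ˢ Set.univ) := by
    refine ⟨hm, ?_⟩
    rw [hasFiniteIntegral_iff_ofReal (Eventually.of_forall hf0), hmass]
    exact hfin.lt_top
  refine ⟨hi, ?_⟩
  rw [← hmass, ← ofReal_integral_eq_lintegral_ofReal hi (Eventually.of_forall hf0)]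
  congr 1
  have h1 := hi
  rw [Measure.volume_eq_prod] at h1 ⊢
  rw [setIntegral_prod _ h1]
  simp only [Measure.restrict_univ, hf]

/-! ### Passage from an arbitrary probability space to the law of the coefficients. -/

section Transfer

variable {Ω : Type*} {A B : ℕ → Ω → ℝ}

/-- The first `N` coefficients of each kind. -/
def coefVector (A B : ℕ → Ω → ℝ) (N : ℕ) (ω : Ω) : Fin N ⊕ Fin N → ℝ :=
  Sum.elim (fun n => A n ω) fun n => B n ω

lemma trigPoly_eq_field_coefVector (A B : ℕ → Ω → ℝ) (N : ℕ) (ω : Ω) :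
    trigPoly (fun n => A n ω) (fun n => B n ω) N = field (coefVector A B N ω) 0 :=
  funext fun t => trigPoly_eq_field _ _ N t

variable [MeasurableSpace Ω] {P : Measure Ω}

lemma aemeasurable_coefVector (hA : ∀ n, HasLaw (A n) (coeffLaw Ψ) P)
    (hB : ∀ n, HasLaw (B n) (coeffLaw Ψ) P) (N : ℕ) : AEMeasurable (coefVector A B N) P := by
  refine aemeasurable_pi_lambda _ fun i => ?_
  rcases i with n | n
  · exact (hA n).aemeasurable
  · exact (hB n).aemeasurable

lemma map_coefVector (hA : ∀ n, HasLaw (A n) (coeffLaw Ψ) P)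
    (hB : ∀ n, HasLaw (B n) (coeffLaw Ψ) P) (hind : iIndepFun (Sum.elim A B) P) (N : ℕ) :
    P.map (coefVector A B N) = fieldLaw Ψ N := by
  have hinj : Function.Injective (Sum.map (Fin.val : Fin N → ℕ) (Fin.val : Fin N → ℕ)) :=
    Sum.map_injective.2 ⟨Fin.val_injective, Fin.val_injective⟩
  have h1 := hind.precomp hinj
  have hm : ∀ i : Fin N ⊕ Fin N, AEMeasurable
      (Sum.elim A B (Sum.map (Fin.val : Fin N → ℕ) (Fin.val : Fin N → ℕ) i)) P := by
    rintro (n | n)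
    · exact (hA n).aemeasurable
    · exact (hB n).aemeasurable
  have h2 := h1.map_fun_eq_pi_map hm
  have e1 : coefVector A B N = fun ω (i : Fin N ⊕ Fin N) =>
      Sum.elim A B (Sum.map (Fin.val : Fin N → ℕ) (Fin.val : Fin N → ℕ) i) ω := by
    ext ω i
    rcases i with n | n <;> rfl
  rw [e1, h2, fieldLaw]
  congr 1
  ext1 i
  rcases i with n | n
  · exact (hA n).map_eq
  · exact (hB n).map_eq

lemma map_jetVector_field_coefVector (hA : ∀ n, HasLaw (A n) (coeffLaw Ψ) P)
    (hB : ∀ n, HasLaw (B n) (coeffLaw Ψ) P) (hind : iIndepFun (Sum.elim A B) P) (N : ℕ)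
    (t : Fin m → ℝ) :
    P.map (fun ω => jetVector (field (coefVector A B N ω) 0) t)
      = (fieldLaw Ψ N).map fun w => jetVector (field w 0) t := by
  have hm : Measurable fun w : Fin N ⊕ Fin N → ℝ => jetVector (field w 0) t := by
    have hp : Measurable fun w : Fin N ⊕ Fin N → ℝ => (w, t) :=
      measurable_id.prodMk measurable_const
    have h0 := (measurable_jetVector_field (m := m) (N := N)).comp hp
    exact h0
  rw [← map_coefVector hA hB hind N,
    AEMeasurable.map_map_of_aemeasurable hm.aemeasurable (aemeasurable_coefVector hA hB N)]
  rfl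

end Transfer

end Main

end RandomTrig

/-! ### Conclusion. -/

theorem corollary3p6 (Ψ : ℝ → ℝ) (hΨ : RandomTrig.IsAdmissible Ψ)
    (m : ℕ) (hm : 1 ≤ m) (α β : ℝ) (hαβ : α ≤ β) :
    ∃ (C : ℝ) (N₀ : ℕ), ∀ (Ω : Type*) [MeasurableSpace Ω] (P : Measure Ω) [IsProbabilityMeasure P]
      (a b : ℕ → Ω → ℝ),
      (∀ n, HasLaw (a n) (RandomTrig.coeffLaw Ψ) P) →
      (∀ n, HasLaw (b n) (RandomTrig.coeffLaw Ψ) P) →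
      iIndepFun (Sum.elim a b) P →
      ∀ N : ℕ, N₀ ≤ N →
        -- the random function `X_N` and the number of its zeros in `I = [α, β]`
        let X : Ω → ℝ → ℝ := fun ω => RandomTrig.trigPoly (fun n => a n ω) (fun n => b n ω) N
        let I : Set ℝ := Set.Icc α β
        let Z : Ω → ℕ := fun ω => RandomTrig.zeroCount (X ω) I
        (∀ᵐ ω ∂P, (RandomTrig.zeroSet (X ω) I).Finite) ∧
        Integrable (fun ω => ((Z ω).descFactorial m : ℝ)) P ∧
        ∃ p : (Fin m → ℝ) → (Fin m → ℝ) × (Fin m → ℝ) → ℝ,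
          (∀ t ∈ RandomTrig.cube m I \ RandomTrig.diag m I,
            RandomTrig.IsContinuousDensity (P.map fun ω => RandomTrig.jetVector (X ω) t) (p t)) ∧
          ∀ ε : ℝ, 0 < ε →
            IntegrableOn (fun z : (Fin m → ℝ) × (Fin m → ℝ) => (∏ i, |z.2 i|) * p z.1 (0, z.2))
              ((RandomTrig.cube m I \ RandomTrig.diagEnl m I ε) ×ˢ Set.univ) ∧
            |(∫ ω, ((Z ω).descFactorial m : ℝ) ∂P) -
                ∫ t in RandomTrig.cube m I \ RandomTrig.diagEnl m I ε,
                  ∫ y : Fin m → ℝ, (∏ i, |y i|) * p t (0, y)|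
              ≤ C * ε ^ (1 / 5 : ℝ) := by

  obtain ⟨C, hC0, hC⟩ := RandomTrig.exists_factorial_moment_le hΨ m hαβ
  obtain ⟨n, hn⟩ := exists_nat_gt (β - α)
  -- Beyond this threshold there are at least `m` modes to condition on, and the interval is shorter
  -- than the period `2πN`.
  refine ⟨C, max m n + 1, ?_⟩
  intro Ω _ P _ a b ha hb hind N hN X I Z
  have hN0 : 0 < N := by omega
  have hmN : m ≤ N := (le_max_left m n).trans (by omega)
  have hnN : n ≤ N := (le_max_right m n).trans (by omega)
  have hβα : β - α < 2 * Real.pi * N := by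
    have h1 : (n : ℝ) ≤ N := by exact_mod_cast hnN
    have h2 : (0 : ℝ) ≤ N := Nat.cast_nonneg N
    nlinarith [Real.pi_gt_three]
  obtain ⟨hbd, hmom⟩ := hC N hN0 hmN hβα
  have hfin := ne_top_of_le_ne_top ENNReal.ofReal_ne_top hbd
  have hXf : ∀ ω, X ω = RandomTrig.field (RandomTrig.coefVector a b N ω) 0 := fun ω =>
    RandomTrig.trigPoly_eq_field_coefVector a b N ω
  have hWm := RandomTrig.aemeasurable_coefVector ha hb N
  have hWlaw := RandomTrig.map_coefVector ha hb hind N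
  obtain ⟨hint, hintEq⟩ := RandomTrig.integrable_descFactorial hΨ hN0 hαβ hβα hfin
  have hexp : ∫ ω, ((Z ω).descFactorial m : ℝ) ∂P = ∫ w : Fin N ⊕ Fin N → ℝ,
      ((RandomTrig.zeroCount (RandomTrig.field w 0) (Set.Icc α β)).descFactorial m : ℝ)
        ∂(RandomTrig.fieldLaw Ψ N) := by
    rw [← hWlaw] at hint ⊢
    rw [integral_map hWm hint.aestronglyMeasurable]
    simp only [Z, I, hXf]
  refine ⟨?_, ?_, RandomTrig.jetDensity Ψ hmN, ?_, fun ε hε => ?_⟩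
  · have h1 := RandomTrig.ae_regular hΨ hN0 hαβ hβα
    rw [← hWlaw] at h1
    filter_upwards [ae_of_ae_map hWm h1] with ω hω
    rw [hXf]
    exact (RandomTrig.zeroFinset α β (RandomTrig.coefVector a b N ω)).finite_toSet.subset
      fun t ht => (hω.2.1 t).2 ht
  · rw [← hWlaw] at hint
    have h1 := hint.comp_aemeasurable hWm
    simp only [Z, I, hXf]
    exact h1
  · intro t ht
    have h1 := RandomTrig.isContinuousDensity_jetDensity hΨ hmN hβα ht
    simp only [hXf]
    rw [RandomTrig.map_jetVector_field_coefVector ha hb hind N t]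
    exact h1
  · have hle := RandomTrig.kacRiceMass_le hΨ hN0 hmN hαβ hβα hε
    obtain ⟨hJi, hJ⟩ := RandomTrig.integrableOn_kacRice hΨ hmN hβα hε
      (ne_top_of_le_ne_top hfin hle)
    refine ⟨hJi, ?_⟩
    have hup := hmom ε hε
    have hJ0 : 0 ≤ ∫ t in RandomTrig.cube m I \ RandomTrig.diagEnl m I ε,
        ∫ y : Fin m → ℝ, (∏ i, |y i|) * RandomTrig.jetDensity Ψ hmN t (0, y) :=
      integral_nonneg fun t => integral_nonneg fun y =>
        mul_nonneg (Finset.prod_nonneg fun _ _ => abs_nonneg _) (RandomTrig.jetDensity_nonneg _ _ _ _)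
    have hCε : 0 ≤ C * ε ^ (1 / 5 : ℝ) := by positivity
    -- Both quantities are finite, so the two extended inequalities descend to the reals; the
    -- difference lies between 0 and `C ε^{1/5}`.
    rw [← hintEq, ← hJ] at hle hup
    rw [← ENNReal.ofReal_add hJ0 hCε, ENNReal.ofReal_le_ofReal_iff (by positivity)] at hup
    rw [ENNReal.ofReal_le_ofReal_iff (integral_nonneg fun w => Nat.cast_nonneg _)] at hle
    rw [hexp, abs_le]
    constructor <;> linarith
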